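/- Let $\Bbbk$ be a field. A seed $S=(N,I,\{e_i\}_{i\in I},F,[\cdot,\cdot])$ consists of a lattice $N$ of finite rank, a finite set $I$, a basis $\{e_i\}_{i\in I}$ of a saturated sublattice $N_I\subseteq N$, a subset $F\subseteq I$ (the frozen indices), and a $\mathbb Z$-valued bilinear form $[\cdot,\cdot]$ on $N$ with $[e_i,e_i]=0$ for $i\in I\setminus F$. Put $M=N^*$, $M_I=N_I^*$ with dual basis $\{e_i^*\}$, $p_1(n)=[n,\cdot]\in M$, $p_2(n)=[\cdot,n]\in M$, $\bar p_1(n)=p_1(n)|_{N_I}\in M_I$ and $K_1=\ker p_1$. Assume that $p_2(e_i)\ne 0$ for all $i\in I$ and that $p_2(e_i)$ is primitive in $M$ for all $i\in F$. **The varieties.** $\mathcal X^\star$ is the scheme obtained from the torus $U_0=\operatorname{Spec}\Bbbk[N]$ by gluing to it, for each $i\in I\setminus F$, a copy $U_i$ of $\operatorname{Spec}\Bbbk[N]$ along the open set $\{1+z^{e_i}\neq0\}$ through the mutation $U_0\dashrightarrow U_i$, $z^n\mapsto z^n(1+z^{e_i})^{-[n,e_i]}$, and, for each $i\in F$, the scheme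 $U_i=\operatorname{Spec}\Bbbk[n\in N\mid[n,e_i]\ge0]$ along the inclusion $U_0\subset U_i$; distinct $U_i,U_j$ with $i,j\in I$ are glued only along the locus in $U_0$ to which both are glued. $\mathcal A^\star$ is obtained in the same way from the torus $\operatorname{Spec}\Bbbk[M]$, with the mutations $z^m\mapsto z^m(1+z^{p_1(e_i)})^{-\langle e_i,m\rangle}$ for $i\in I\setminus F$ and the partial compactifications $\operatorname{Spec}\Bbbk[m\in M\mid\langle e_i,m\rangle\ge0]$ for $i\in F$. $\mathcal A^\star_{\mathrm{prin}}$ is the scheme $\mathcal A^\star$ of the seed with lattice $N_I\oplus M$, basis $\{(e_i,0)\}_{i\in I}$, frozen indices $F$ and form $[(n_1,m_1),(n_2,m_2)]=[n_1,n_2]+\langle n_1,m_2\rangle-\langle n_2,m_1\rangle$; its central torus is $\operatorname{Spec}\Bbbk[M_I\oplus N]$. The structure sheaf of $\mathcal A^\star_{\mathrm{prin}}$ is $M_I$-graded by $\deg z^{(m,n)}=m-\bar p_1(n)$. On every chart $z^n\mapsto z^{(\bar p_1(n),n)}$ defines a morphism $\tilde p_2:\mathcal A^\star_{\mathrm{prin}}\to\mathcal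 X^\star$. **The sheaf.** For $i\in I$ let $E_i=U_i\setminus U_0$, a reduced effective Cartier divisor in $\mathcal X^\star$, and for $m=\sum_i a_ie_i^*\in M_I$ put $W(m)=\sum_i a_iE_i$. Viewing sections of $\mathcal O_{\mathcal X^\star}(W(m))$ as elements of the function field $K(\mathcal X^\star)$, let $$\mathcal R=\bigoplus_{m\in M_I}\mathcal O_{\mathcal X^\star}(W(m))\,z^m,$$ an $M_I$-graded sheaf of $\mathcal O_{\mathcal X^\star}$-algebras with $z^mz^{m'}=z^{m+m'}$. **The fibres.** Let $\lambda:\mathcal X^\star\to T_{K_1^*}=\operatorname{Spec}\Bbbk[K_1]$ be the morphism given by the inclusion $K_1\subseteq N$, and let $\pi:\mathcal A^\star_{\mathrm{prin}}\to\operatorname{Spec}\Bbbk[N]$ be given by $z^n\mapsto z^{(0,n)}$. For a $\Bbbk$-point $\phi$ of $T_{K_1^*}$ let $\mathcal X^\star_\phi=\lambda^{-1}(\phi)$, let $\mathcal A^\star_\phi$ be the fibre over $\phi$ of the composition of $\pi$ with $\operatorname{Spec}\Bbbk[N]\to\operatorname{Spec}\Bbbk[K_1]$, and let $p_{2,\phi}:\mathcal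 A^\star_\phi\to\mathcal X^\star_\phi$ be the restriction of $\tilde p_2$. Let $W_\phi(m)=\sum_ia_iE_{i,\phi}$, where $E_{i,\phi}$ is the scheme-theoretic intersection of $E_i$ with $\mathcal X^\star_\phi$, and let $\mathcal R_\phi=\bigoplus_{m\in M_I}\mathcal O_{\mathcal X^\star_\phi}(W_\phi(m))\,z^m$, defined through the function field of $\mathcal X^\star_\phi$. **Theorem.** The scheme $\mathcal X^\star$ is integral and $\mathcal A^\star_{\mathrm{prin}}$ is the relative spectrum of $\mathcal R$ over $\mathcal X^\star$. More precisely, $\tilde p_2$ is affine, and $\tilde p_2^\sharp$ on functions together with $z^m\mapsto z^{(m,0)}$ $(m\in M_I)$ over the central torus $U_0$ extends to an isomorphism $$\tilde p_2^\sharp:\ \mathcal R\ \xrightarrow{\ \sim\ }\ (\tilde p_2)_*\mathcal O_{\mathcal A^\star_{\mathrm{prin}}}$$ of $M_I$-graded $\mathcal O_{\mathcal X^\star}$-algebras. Likewise, let $\phi$ be a $\Bbbk$-point of $T_{K_1^*}$ such that there is no $i\in I\setminus F$ with $e_i\in K_1$ and $z^{e_i}(\phi)=-1$. Then $\mathcal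 X^\star_\phi$ is integral, $p_{2,\phi}$ is affine, and $p_{2,\phi}^\sharp$ together with $z^m\mapsto z^{(m,0)}$ over $U_0\cap\mathcal X^\star_\phi$ extends to an isomorphism $\mathcal R_\phi\xrightarrow{\sim}(p_{2,\phi})_*\mathcal O_{\mathcal A^\star_\phi}$ of $M_I$-graded $\mathcal O_{\mathcal X^\star_\phi}$-algebras, so that $\mathcal A^\star_\phi$ is the relative spectrum of $\mathcal R_\phi$. -/

import Mathlib

universe u

open CategoryTheory CategoryTheory.Limits AlgebraicGeometry

noncomputable section

namespace ClusterTorsor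

lemma eqToHom_aux {C : Type*} [Category C] {A A' B B' U U' W : C} (hA : A' = A) (hB : B' = B)
    (s : A ⟶ B) (f : A ⟶ U) (f' : B ⟶ U') (x : U ⟶ W) (y : U' ⟶ W) :
    (eqToHom hA ≫ f) ≫ x = ((eqToHom hA ≫ s ≫ eqToHom hB.symm) ≫ eqToHom hB ≫ f') ≫ y ↔
      f ≫ x = s ≫ f' ≫ y := by
  subst hA hB
  simp

/-- Data for gluing schemes `U j` along a common centre: each `U j` shares the open piece `V j` with
the scheme `Z`, and `U i`, `U j` are to be glued along `V i ∩ V j`, the intersection being taken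
in `Z`. -/
structure StarData (J : Type u) where
  Z : Scheme.{u}
  V : J → Scheme.{u}
  U : J → Scheme.{u}
  a : ∀ j, V j ⟶ Z
  g : ∀ j, V j ⟶ U j
  a_open : ∀ j, IsOpenImmersion (a j)
  g_open : ∀ j, IsOpenImmersion (g j)

namespace StarData
attribute [instance] StarData.a_open StarData.g_open
variable {J : Type u} (D : StarData J)

/-- The intersection of `V i` and `V j` inside `Z`. -/
abbrev ov (i j : J) : Scheme.{u} := pullback (D.a i) (D.a j)

/-- The inclusion of `V i ∩ V j` into `V i`. -/
def fst (i j : J) : D.ov i j ⟶ D.V i := pullback.fst (D.a i) (D.a j)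

/-- The inclusion of `V i ∩ V j` into `U i`. -/
def ovMap (i j : J) : D.ov i j ⟶ D.U i := D.fst i j ≫ D.g i

/-- The identification of `V i ∩ V j` with `V j ∩ V i`. -/
def swap (i j : J) : D.ov i j ⟶ D.ov j i := (pullbackSymmetry _ _).hom

lemma swap_swap (i j : J) : D.swap i j ≫ D.swap j i = 𝟙 _ := by
  apply pullback.hom_ext <;> simp [swap]

lemma swap_fst_a (i j : J) : D.swap i j ≫ D.fst j i ≫ D.a j = D.fst i j ≫ D.a i := by
  simp [swap, fst, pullback.condition]

instance (i j : J) : IsOpenImmersion (D.fst i j) := by unfold fst; infer_instance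
instance (i j : J) : IsOpenImmersion (D.ovMap i j) := by unfold ovMap; infer_instance

lemma fst_fst (i j k : J) :
    pullback.fst (D.ovMap i j) (D.ovMap i k) ≫ D.fst i j =
      pullback.snd (D.ovMap i j) (D.ovMap i k) ≫ D.fst i k := by
  rw [← cancel_mono (D.g i)]
  simpa [ovMap] using pullback.condition (f := D.ovMap i j) (g := D.ovMap i k)

/-- The transition map on triple intersections. -/
def tri (i j k : J) : pullback (D.ovMap i j) (D.ovMap i k) ⟶
    pullback (D.ovMap j k) (D.ovMap j i) :=
  pullback.lift
    (pullback.lift (pullback.fst _ _ ≫ D.swap i j ≫ D.fst j i)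
      (pullback.snd _ _ ≫ D.swap i k ≫ D.fst k i) (by
      simp only [Category.assoc, D.swap_fst_a]
      rw [← Category.assoc, D.fst_fst, Category.assoc]))
    (pullback.fst _ _ ≫ D.swap i j) (by
      unfold ovMap
      rw [← Category.assoc]
      conv_lhs => enter [1]; exact pullback.lift_fst _ _ _
      simp only [Category.assoc])

lemma tri_fst_a (i j k : J) :
    D.tri i j k ≫ pullback.fst _ _ ≫ D.fst j k ≫ D.a j =
      pullback.fst _ _ ≫ D.fst i j ≫ D.a i := by
  have h : (D.tri i j k ≫ pullback.fst _ _) ≫ D.fst j k =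
      pullback.fst _ _ ≫ D.swap i j ≫ D.fst j i := by
    unfold tri
    rw [pullback.lift_fst]
    exact pullback.lift_fst _ _ _
  rw [← Category.assoc, ← Category.assoc, h]
  simp only [Category.assoc, D.swap_fst_a]

/-- The gluing data for the distinct pairs of indices. -/
def glueData' : GlueData' Scheme.{u} where
  J := J
  U := D.U
  V i j _ := D.ov i j
  f i j _ := D.ovMap i j
  t i j _ := D.swap i j
  t' i j k _ _ _ := D.tri i j k
  t_fac i j k _ _ _ := pullback.lift_snd _ _ _
  t_inv i j _ := D.swap_swap i j
  cocycle i j k _ _ _ := by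
    rw [← cancel_mono (pullback.fst (D.ovMap i j) (D.ovMap i k)), ← cancel_mono (D.fst i j),
      ← cancel_mono (D.a i)]
    simp only [Category.assoc, tri_fst_a, Category.id_comp]

lemma isOpenImmersion_f' (i j : J) : IsOpenImmersion (D.glueData'.f' i j) := by
  dsimp only [GlueData'.f']
  split_ifs with h
  · infer_instance
  · have : IsOpenImmersion (D.glueData'.f i j h) :=
      inferInstanceAs (IsOpenImmersion (D.ovMap i j))
    infer_instance

/-- The gluing data: `U i` and `U j` are glued along `V i ∩ V j` for `i ≠ j`. -/
def glueData : Scheme.GlueData.{u} where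
  __ := GlueData.ofGlueData' D.glueData'
  f_open i j := D.isOpenImmersion_f' i j

/-- The glued scheme. -/
def glued : Scheme.{u} := D.glueData.glued
/-- The inclusion of the open piece `U j` into the glued scheme. -/
def ι (j : J) : D.U j ⟶ D.glued := D.glueData.ι j

instance (j : J) : IsOpenImmersion (D.ι j) := D.glueData.ι_isOpenImmersion j

lemma ovMap_compat {Y : Scheme.{u}} (h : ∀ j, D.U j ⟶ Y) (b : D.Z ⟶ Y)
    (hb : ∀ j, D.g j ≫ h j = D.a j ≫ b) (i j : J) :
    D.ovMap i j ≫ h i = D.swap i j ≫ D.ovMap j i ≫ h j := by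
  have e := congrArg (· ≫ b) (D.swap_fst_a i j)
  simp only [Category.assoc] at e
  simp only [ovMap, Category.assoc, hb, e]

/-- A morphism out of the glued scheme, from morphisms on all `U j` that agree on `V j` with a
morphism on the centre `Z`. -/
def desc {Y : Scheme.{u}} (h : ∀ j, D.U j ⟶ Y) (b : D.Z ⟶ Y)
    (hb : ∀ j, D.g j ≫ h j = D.a j ≫ b) : D.glued ⟶ Y :=
  Multicoequalizer.desc D.glueData.diagram _ h (by
    classical
    rintro ⟨i, j⟩
    change D.glueData.f i j ≫ h i = (D.glueData.t i j ≫ D.glueData.f j i) ≫ h j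
    by_cases e : i = j
    · subst e
      rw [D.glueData.t_id, Category.id_comp]
    · have e0 : D.glueData.t i j =
          eqToHom (dif_neg e) ≫ D.swap i j ≫ eqToHom (dif_neg (Ne.symm e)).symm := dif_neg e
      have e1 : D.glueData.f i j = eqToHom (dif_neg e) ≫ D.ovMap i j := dif_neg e
      have e2 : D.glueData.f j i = eqToHom (dif_neg (Ne.symm e)) ≫ D.ovMap j i :=
        dif_neg (Ne.symm e)
      rw [e0, e1, e2]
      exact (eqToHom_aux _ _ (D.swap i j) (D.ovMap i j) (D.ovMap j i) (h i) (h j)).2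
        (D.ovMap_compat h b hb i j))

lemma ι_desc {Y : Scheme.{u}} (h : ∀ j, D.U j ⟶ Y) (b : D.Z ⟶ Y)
    (hb : ∀ j, D.g j ≫ h j = D.a j ≫ b) (j : J) : D.ι j ≫ D.desc h b hb = h j :=
  Multicoequalizer.π_desc _ _ _ _ _

lemma hom_ext {Y : Scheme.{u}} {x y : D.glued ⟶ Y} (h : ∀ j, D.ι j ≫ x = D.ι j ≫ y) : x = y :=
  Multicoequalizer.hom_ext _ _ _ h

lemma glue_condition (i j : J) :
    D.ovMap i j ≫ D.ι i = D.swap i j ≫ D.ovMap j i ≫ D.ι j := by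
  classical
  by_cases h : i = j
  · subst h
    have : D.ovMap i i = D.swap i i ≫ D.ovMap i i := by
      unfold ovMap
      rw [← Category.assoc]
      congr 1
      rw [← cancel_mono (D.a i), Category.assoc, D.swap_fst_a]
    rw [← Category.assoc, ← this]
  · have h1 := D.glueData.glue_condition i j
    have e0 : D.glueData.t i j =
        eqToHom (dif_neg h) ≫ D.swap i j ≫ eqToHom (dif_neg (Ne.symm h)).symm := dif_neg h
    have e1 : D.glueData.f i j = eqToHom (dif_neg h) ≫ D.ovMap i j := dif_neg h
    have e2 : D.glueData.f j i = eqToHom (dif_neg (Ne.symm h)) ≫ D.ovMap j i :=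
      dif_neg (Ne.symm h)
    rw [e0, e1, e2] at h1
    exact (eqToHom_aux _ _ (D.swap i j) (D.ovMap i j) (D.ovMap j i) (D.ι i) (D.ι j)).1
      (h1.symm.trans (Category.assoc _ _ _).symm)

lemma g_ι (o : J) [IsIso (D.a o)] (c : D.Z ⟶ D.U o) (hc : D.g o = D.a o ≫ c) (j : J) :
    D.g j ≫ D.ι j = D.a j ≫ c ≫ D.ι o := by
  have : IsIso (D.fst j o) := by
    unfold fst
    infer_instance
  rw [← cancel_epi (D.fst j o)]
  have h1 := D.glue_condition j o
  have h2 := congrArg (· ≫ c ≫ D.ι o) (D.swap_fst_a j o)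
  unfold ovMap at h1
  rw [Category.assoc, Category.assoc, hc] at h1
  rw [h1]
  simp only [Category.assoc] at h2 ⊢
  exact h2

end StarData

/-- Combinatorial data for gluing toric charts to the torus `Spec k[P]` (`P` is the lattice of
monomials). To an index `i ∉ F` belongs the mutation `z ^ v ↦ z ^ v * (1 + z ^ (ψ i)) ^ (-u i v)`,
and to a (frozen) index `i ∈ F` the partial compactification `Spec k[v ∈ P | 0 ≤ u i v]`. -/
structure MutationDatum (P I : Type u) [AddCommGroup P] where
  F : Set I
  u : I → P →+ ℤ
  ψ : I → P
  u_ψ : ∀ i ∉ F, u i (ψ i) = 0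

namespace MutationDatum
variable {P I : Type u} [AddCommGroup P] (D : MutationDatum P I) (k : Type u) [Field k]

/-- The exponents of the monomials on the charts: all of `P` on the central torus (index `none`) and on
the charts of unfrozen indices, and `{v | 0 ≤ u i v}` on the chart of a frozen index `i`. -/
def mon : Option I → AddSubmonoid P
  | none => ⊤
  | some i =>
    { carrier := {v | i ∈ D.F → 0 ≤ D.u i v}
      zero_mem' := fun _ => by simp
      add_mem' := fun {a b} ha hb h => by
        rw [map_add]
        exact add_nonneg (ha h) (hb h) }

/-- The coordinate ring of the chart of index `j`; `none` is the central torus. -/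
abbrev ChartRing (j : Option I) : Type u := AddMonoidAlgebra k (D.mon j)

/-- The exponent `u i` (and `0` for the central torus). -/
def wt : Option I → P →+ ℤ
  | none => 0
  | some i => D.u i

open scoped Classical in
/-- The function on the central torus whose nonvanishing locus is the overlap with the chart `j`: for an
unfrozen index this is `1 + z ^ (ψ i)`, which cuts out the largest open set on which the mutation is
biregular (as soon as `u i ≠ 0`); a frozen chart contains the whole central torus. -/
def den : Option I → AddMonoidAlgebra k P
  | none => 1
  | some i => if i ∈ D.F then 1 else 1 + AddMonoidAlgebra.single (D.ψ i) 1

/-- The coordinate ring of the overlap of the central torus with the chart `j`. -/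
abbrev OverlapRing (j : Option I) : Type u := Localization.Away (D.den k j)

/-- The function `den j` as a unit on the overlap. -/
def denUnit (j : Option I) : (D.OverlapRing k j)ˣ :=
  (IsLocalization.Away.algebraMap_isUnit (S := D.OverlapRing k j) (D.den k j)).unit

/-- The ring homomorphism `z ^ v ↦ z ^ v * (den j) ^ (ε * wt j v)`. -/
def mutHom (ε : ℤ) (j : Option I) : AddMonoidAlgebra k P →ₐ[k] D.OverlapRing k j :=
  AddMonoidAlgebra.lift k _ P
    { toFun := fun v => algebraMap (AddMonoidAlgebra k P) _ (AddMonoidAlgebra.single v.toAdd 1) *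
        ((D.denUnit k j ^ (ε * D.wt j v.toAdd) : (D.OverlapRing k j)ˣ) : D.OverlapRing k j)
      map_one' := by simp [← AddMonoidAlgebra.one_def]
      map_mul' := fun v w => by
        have : AddMonoidAlgebra.single (v.toAdd + w.toAdd) (1 : k) =
          AddMonoidAlgebra.single v.toAdd 1 * AddMonoidAlgebra.single w.toAdd 1 := by simp
        rw [toAdd_mul, this, map_mul, map_add, mul_add, zpow_add, Units.val_mul]
        ring }

lemma mutHom_single (ε : ℤ) (j : Option I) (v : P) :
    D.mutHom k ε j (.single v 1) = algebraMap _ _ (AddMonoidAlgebra.single v (1 : k)) *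
      ((D.denUnit k j ^ (ε * D.wt j v) : (D.OverlapRing k j)ˣ) : D.OverlapRing k j) := by
  simp [mutHom]

lemma mutHom_den (ε : ℤ) (j : Option I) :
    D.mutHom k ε j (D.den k j) = algebraMap _ _ (D.den k j) := by
  classical
  rcases j with _ | i
  · simp [den]
  · by_cases h : i ∈ D.F
    · simp [den, h]
    · have := D.mutHom_single k ε (some i) (D.ψ i)
      simp only [wt, D.u_ψ i h, mul_zero, zpow_zero, Units.val_one, mul_one] at this
      simp only [den, h, if_false, map_add, map_one] at this ⊢
      rw [this]

/-- The endomorphism of the ring of the overlap induced by `mutHom`. -/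
def extHom (ε : ℤ) (j : Option I) : D.OverlapRing k j →+* D.OverlapRing k j :=
  IsLocalization.Away.lift (D.den k j) (g := (D.mutHom k ε j).toRingHom) (by
    have := D.mutHom_den k ε j
    change IsUnit (D.mutHom k ε j (D.den k j))
    rw [this]
    exact IsLocalization.Away.algebraMap_isUnit _)

lemma extHom_algebraMap (ε : ℤ) (j : Option I) (x : AddMonoidAlgebra k P) :
    D.extHom k ε j (algebraMap _ _ x) = D.mutHom k ε j x :=
  IsLocalization.Away.lift_eq _ _ _

lemma extHom_denUnit (ε : ℤ) (j : Option I) (n : ℤ) :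
    D.extHom k ε j ((D.denUnit k j ^ n : (D.OverlapRing k j)ˣ) : D.OverlapRing k j) =
      ((D.denUnit k j ^ n : (D.OverlapRing k j)ˣ) : D.OverlapRing k j) := by
  have h : Units.map (D.extHom k ε j).toMonoidHom (D.denUnit k j) = D.denUnit k j := by
    ext
    change D.extHom k ε j (algebraMap _ _ (D.den k j)) = algebraMap _ _ (D.den k j)
    rw [extHom_algebraMap, mutHom_den]
  have := congrArg (fun x : (D.OverlapRing k j)ˣ => ((x ^ n : (D.OverlapRing k j)ˣ) :
    D.OverlapRing k j)) h
  simp only [← map_zpow] at this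
  exact this

lemma extHom_comp (ε δ : ℤ) (h : ε + δ = 0) (j : Option I) :
    (D.extHom k ε j).comp (D.extHom k δ j) = RingHom.id _ := by
  apply IsLocalization.ringHom_ext (Submonoid.powers (D.den k j))
  apply AddMonoidAlgebra.ringHom_ext
  · intro r
    have e (ε : ℤ) : D.mutHom k ε j (.single 0 r) = 
        algebraMap (AddMonoidAlgebra k P) _ (AddMonoidAlgebra.single 0 r) := by
      rw [show (AddMonoidAlgebra.single 0 r : AddMonoidAlgebra k P) =
        algebraMap k _ r from rfl, AlgHom.commutes, ← IsScalarTower.algebraMap_apply]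
    simp only [RingHom.comp_apply, extHom_algebraMap, e, RingHom.id_apply]
  · intro v
    simp only [RingHom.comp_apply, extHom_algebraMap, mutHom_single, map_mul, extHom_denUnit,
      RingHom.id_apply]
    rw [mul_assoc, ← Units.val_mul, ← zpow_add, ← add_mul, h]
    simp

/-- The automorphism of the ring of the overlap induced by the mutation. -/
def extEquiv (j : Option I) : D.OverlapRing k j ≃+* D.OverlapRing k j :=
  RingEquiv.ofRingHom (D.extHom k (-1) j) (D.extHom k 1 j)
    (D.extHom_comp k _ _ (by norm_num) j) (D.extHom_comp k _ _ (by norm_num) j)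

/-- The inclusion of the chart ring into the ring of all Laurent polynomials. -/
def chartIncl (j : Option I) : D.ChartRing k j →ₐ[k] AddMonoidAlgebra k P :=
  AddMonoidAlgebra.mapDomainAlgHom k k (D.mon j).subtype

/-- The mutation `z ^ v ↦ z ^ v * (1 + z ^ (ψ i)) ^ (-u i v)` for an unfrozen index `i`, and the inclusion
`z ^ v ↦ z ^ v` for a frozen one, as a map from functions on the chart to functions on the overlap. -/
def mutation (j : Option I) : D.ChartRing k j →ₐ[k] D.OverlapRing k j :=
  (D.mutHom k (-1) j).comp (D.chartIncl k j)

lemma exists_absorb (j : Option I) : ∃ v₀ : D.mon j, ∀ v : P, ∃ n : ℕ, v + n • (v₀ : P) ∈ D.mon j := by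
  rcases j with _ | i
  · exact ⟨0, fun v => ⟨0, trivial⟩⟩
  · by_cases h : ∃ v, 0 < D.u i v
    · obtain ⟨v, hv⟩ := h
      refine ⟨⟨v, fun _ => hv.le⟩, fun w => ⟨(D.u i w).natAbs, fun _ => ?_⟩⟩
      rw [map_add, map_nsmul, nsmul_eq_mul]
      have : (1 : ℤ) ≤ D.u i v := hv
      have h2 : -D.u i w ≤ ((D.u i w).natAbs : ℤ) := by omega
      nlinarith [Int.natCast_nonneg (D.u i w).natAbs]
    · push Not at h
      refine ⟨0, fun v => ⟨0, fun _ => ?_⟩⟩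
      have := h (-v)
      simp only [map_neg] at this
      simpa using this

lemma chartIncl_away (j : Option I) : ∃ f : D.ChartRing k j,
    letI := (D.chartIncl k j).toRingHom.toAlgebra
    IsLocalization.Away f (AddMonoidAlgebra k P) := by
  obtain ⟨v₀, hv⟩ := D.exists_absorb j
  have hinj : Function.Injective (D.chartIncl k j) :=
    AddMonoidAlgebra.mapDomain_injective Subtype.val_injective
  have hs (v : D.mon j) (r : k) : D.chartIncl k j (.single v r) = .single (v : P) r := by
    simp [chartIncl]
  refine ⟨.single v₀ 1, ?_⟩
  let _ := (D.chartIncl k j).toRingHom.toAlgebra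
  have hu (n : ℕ) : algebraMap (D.ChartRing k j) (AddMonoidAlgebra k P) (.single v₀ 1 ^ n) =
      .single (n • (v₀ : P)) 1 := by
    change D.chartIncl k j (.single v₀ 1 ^ n) = _
    rw [map_pow, hs]
    simp [AddMonoidAlgebra.single_pow]
  have hu1 := hu 1
  rw [pow_one, one_smul] at hu1
  refine IsLocalization.Away.mk _ ?_ (fun f => ?_) (fun a b h => ⟨0, by simpa using hinj h⟩)
  · rw [hu1]
    refine IsUnit.of_mul_eq_one (.single (-(v₀ : P)) 1) ?_
    simp [AddMonoidAlgebra.single_mul_single, AddMonoidAlgebra.one_def]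
  · induction f using AddMonoidAlgebra.induction_linear with
    | zero => exact ⟨0, 0, by simp⟩
    | add f g hf hg =>
      obtain ⟨n, a, ha⟩ := hf
      obtain ⟨m, b, hb⟩ := hg
      refine ⟨n + m, a * .single v₀ 1 ^ m + b * .single v₀ 1 ^ n, ?_⟩
      rw [map_add, map_mul, map_mul, ← ha, ← hb, map_pow, map_pow]
      ring
    | single v r =>
      obtain ⟨n, hn⟩ := hv v
      refine ⟨n, .single ⟨_, hn⟩ r, ?_⟩
      rw [← map_pow, hu]
      change _ = D.chartIncl k j _
      rw [hs]
      simp [AddMonoidAlgebra.single_mul_single]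

lemma isOpenImmersion_of_away {R S : CommRingCat.{u}} (φ : R ⟶ S)
    (h : ∃ f : R, letI := φ.hom.toAlgebra; IsLocalization.Away f S) :
    IsOpenImmersion (Spec.map φ) := by
  obtain ⟨f, hf⟩ := h
  algebraize [φ.hom]
  exact IsOpenImmersion.of_isLocalization (S := S) f

instance (j : Option I) :
    IsOpenImmersion (Spec.map (CommRingCat.ofHom (D.mutation k j).toRingHom)) := by
  have h1 : IsOpenImmersion (Spec.map (CommRingCat.ofHom (D.chartIncl k j).toRingHom)) :=
    isOpenImmersion_of_away _ (D.chartIncl_away k j)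
  have e : CommRingCat.ofHom (D.mutation k j).toRingHom =
      CommRingCat.ofHom (D.chartIncl k j).toRingHom ≫
        CommRingCat.ofHom (algebraMap (AddMonoidAlgebra k P) (D.OverlapRing k j)) ≫
        (D.extEquiv k j).toCommRingCatIso.hom := by
    exact CommRingCat.hom_ext (RingHom.ext fun x => (D.extHom_algebraMap k (-1) j _).symm)
  rw [e, Spec.map_comp, Spec.map_comp]
  have h2 : IsOpenImmersion (Spec.map (CommRingCat.ofHom
    (algebraMap (AddMonoidAlgebra k P) (D.OverlapRing k j)))) :=
    IsOpenImmersion.of_isLocalization (D.den k j)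
  infer_instance


/-- The charts, their overlaps with the central torus, and the gluing maps. -/
def starData : StarData (Option I) where
  Z := Spec (.of (AddMonoidAlgebra k P))
  V := fun j => Spec (.of (D.OverlapRing k j))
  U := fun j => Spec (.of (D.ChartRing k j))
  a := fun j => Spec.map (CommRingCat.ofHom
    (algebraMap (AddMonoidAlgebra k P) (D.OverlapRing k j)))
  g j := Spec.map (CommRingCat.ofHom (D.mutation k j).toRingHom)
  a_open := fun j => IsOpenImmersion.of_isLocalization (D.den k j)
  g_open := fun _ => inferInstance

/-- The scheme obtained by gluing all charts to the central torus along the mutations; two charts are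
glued to one another only along the part of the central torus that they share. -/
def scheme : Scheme.{u} := (D.starData k).glued

/-- The inclusion of a chart; the chart of index `none` is the central torus. -/
def chart (j : Option I) : Spec (.of (D.ChartRing k j)) ⟶ D.scheme k := (D.starData k).ι j

instance (j : Option I) : IsOpenImmersion (D.chart k j) :=
  inferInstanceAs (IsOpenImmersion ((D.starData k).ι j))

lemma scheme_hom_ext {Y : Scheme.{u}} {x y : D.scheme k ⟶ Y}
    (h : ∀ j, D.chart k j ≫ x = D.chart k j ≫ y) : x = y :=
  (D.starData k).hom_ext h

/-- The inclusion of the central torus `Spec k[P]`. -/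
def center : Spec (.of (AddMonoidAlgebra k P)) ⟶ D.scheme k :=
  Spec.map (CommRingCat.ofHom (D.chartIncl k none).toRingHom) ≫ D.chart k none

lemma algHom_ext_single {M A : Type*} [AddMonoid M] [Semiring A] [Algebra k A]
    {f g : AddMonoidAlgebra k M →ₐ[k] A} (h : ∀ v, f (.single v 1) = g (.single v 1)) : f = g := by
  apply (AddMonoidAlgebra.lift k A M).symm.injective
  ext v
  exact h v

lemma mutation_none :
    (D.mutation k none).toRingHom =
      (algebraMap (AddMonoidAlgebra k P) (D.OverlapRing k none)).comp
        (D.chartIncl k none).toRingHom := by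
  have : D.mutHom k (-1) none =
      IsScalarTower.toAlgHom k (AddMonoidAlgebra k P) (D.OverlapRing k none) := by
    refine algHom_ext_single k fun v => ?_
    rw [mutHom_single]
    simp [wt]
  exact congrArg (fun f => (f.comp (D.chartIncl k none)).toRingHom) this

lemma mutation_chart (j : Option I) :
    Spec.map (CommRingCat.ofHom (D.mutation k j).toRingHom) ≫ D.chart k j =
      Spec.map (CommRingCat.ofHom (algebraMap (AddMonoidAlgebra k P) (D.OverlapRing k j))) ≫
        D.center k := by
  have h : IsUnit (D.den k none) := isUnit_one
  have h1 : Function.Bijective (algebraMap (AddMonoidAlgebra k P) (D.OverlapRing k none)) :=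
    (IsLocalization.atUnit (AddMonoidAlgebra k P) (D.OverlapRing k none) (D.den k none) h).bijective
  have h2 : IsIso (CommRingCat.ofHom
      (algebraMap (AddMonoidAlgebra k P) (D.OverlapRing k none))) :=
    (ConcreteCategory.isIso_iff_bijective _).2 h1
  have h3 : IsIso ((D.starData k).a none) := inferInstanceAs (IsIso (Spec.map _))
  refine (D.starData k).g_ι none
    (Spec.map (CommRingCat.ofHom (D.chartIncl k none).toRingHom)) ?_ j
  change Spec.map _ = Spec.map _ ≫ Spec.map _
  rw [← Spec.map_comp, D.mutation_none]
  rfl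

/-- A morphism out of the glued scheme given by compatible morphisms on the charts and the central torus. -/
def desc {Y : Scheme.{u}} (h : ∀ j, Spec (.of (D.ChartRing k j)) ⟶ Y)
    (b : Spec (.of (AddMonoidAlgebra k P)) ⟶ Y)
    (hb : ∀ j, Spec.map (CommRingCat.ofHom (D.mutation k j).toRingHom) ≫ h j =
      Spec.map (CommRingCat.ofHom (algebraMap (AddMonoidAlgebra k P) (D.OverlapRing k j))) ≫ b) :
    D.scheme k ⟶ Y :=
  (D.starData k).desc h b hb

lemma chart_desc {Y : Scheme.{u}} (h : ∀ j, Spec (.of (D.ChartRing k j)) ⟶ Y)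
    (b : Spec (.of (AddMonoidAlgebra k P)) ⟶ Y)
    (hb : ∀ j, Spec.map (CommRingCat.ofHom (D.mutation k j).toRingHom) ≫ h j =
      Spec.map (CommRingCat.ofHom (algebraMap (AddMonoidAlgebra k P) (D.OverlapRing k j))) ≫ b)
    (j : Option I) : D.chart k j ≫ D.desc k h b hb = h j :=
  (D.starData k).ι_desc h b hb j

section toTorus
variable {Q : Type u} [AddCommGroup Q] (τ : Q →+ P) (hτ : ∀ i q, D.u i (τ q) = 0)

lemma mem_mon_of_eq_zero (hτ : ∀ i q, D.u i (τ q) = 0) (j : Option I) (q : Q) :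
    τ q ∈ D.mon j := by
  rcases j with _ | i
  · trivial
  · exact fun _ => (hτ i q).ge

/-- The restriction of `toTorus` to a chart, in terms of functions. -/
def toTorusChart (j : Option I) : AddMonoidAlgebra k Q →ₐ[k] D.ChartRing k j :=
  AddMonoidAlgebra.mapDomainAlgHom k k (τ.codRestrict (D.mon j) (D.mem_mon_of_eq_zero τ hτ j))

/-- The morphism to a torus `Spec k[Q]` given by `z ^ q ↦ z ^ (τ q)` on every chart, for a lattice map `τ`
whose image is killed by all `u i`. -/
def toTorus : D.scheme k ⟶ Spec (.of (AddMonoidAlgebra k Q)) :=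
  D.desc k (fun j => Spec.map (CommRingCat.ofHom (D.toTorusChart k τ hτ j).toRingHom))
    (Spec.map (CommRingCat.ofHom (AddMonoidAlgebra.mapDomainAlgHom k k τ).toRingHom)) (fun j => by
      rw [← Spec.map_comp, ← Spec.map_comp]
      congr 1
      have : (D.mutation k j).comp (D.toTorusChart k τ hτ j) =
          (IsScalarTower.toAlgHom k (AddMonoidAlgebra k P) (D.OverlapRing k j)).comp
            (AddMonoidAlgebra.mapDomainAlgHom k k τ) := by
        refine algHom_ext_single k fun q => ?_
        have h0 : D.wt j (τ q) = 0 := by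
          rcases j with _ | i
          · rfl
          · exact hτ i q
        simp [mutation, toTorusChart, chartIncl, mutHom_single, h0]
      exact CommRingCat.hom_ext (congrArg AlgHom.toRingHom this))

lemma toTorus_comp {R : Type u} [AddCommGroup R] (σ : R →+ Q)
    (hτ' : ∀ i r, D.u i ((τ.comp σ) r) = 0) :
    D.toTorus k τ hτ ≫
      Spec.map (CommRingCat.ofHom (AddMonoidAlgebra.mapDomainAlgHom k k σ).toRingHom) =
      D.toTorus k (τ.comp σ) hτ' := by
  refine D.scheme_hom_ext k fun j => ?_
  rw [← Category.assoc]
  unfold toTorus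
  rw [chart_desc, chart_desc, ← Spec.map_comp]
  congr 1
  refine CommRingCat.hom_ext (congrArg AlgHom.toRingHom
    (algHom_ext_single k
      (f := (D.toTorusChart k τ hτ j).comp (AddMonoidAlgebra.mapDomainAlgHom k k σ))
      (g := D.toTorusChart k (τ.comp σ) hτ' j) fun q => ?_))
  simp [toTorusChart]

end toTorus

section map
variable {P' : Type u} [AddCommGroup P'] (D' : MutationDatum P' I)

/-- A lattice map which respects the gluing data. -/
structure Hom where
  θ : P →+ P'
  F_eq : D.F = D'.F
  u_θ : ∀ i v, D'.u i (θ v) = D.u i v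
  θ_ψ : ∀ i, θ (D.ψ i) = D'.ψ i

variable {D D'} (T : D.Hom D')

namespace Hom

lemma map_mem (j : Option I) (v : D.mon j) : T.θ v ∈ D'.mon j := by
  rcases j with _ | i
  · trivial
  · intro hi
    rw [T.u_θ]
    exact v.2 (T.F_eq ▸ hi)

/-- The map `z ^ v ↦ z ^ (θ v)` on a chart. -/
def chartHom (j : Option I) : D.ChartRing k j →ₐ[k] D'.ChartRing k j :=
  AddMonoidAlgebra.mapDomainAlgHom k k
    ((T.θ.comp (D.mon j).subtype).codRestrict (D'.mon j) (T.map_mem j))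

/-- The map `z ^ v ↦ z ^ (θ v)` on the central torus. -/
def torusHom : AddMonoidAlgebra k P →ₐ[k] AddMonoidAlgebra k P' :=
  AddMonoidAlgebra.mapDomainAlgHom k k T.θ

lemma torusHom_single (v : P) (r : k) : T.torusHom k (.single v r) = .single (T.θ v) r := by
  simp [torusHom]

lemma torusHom_den (j : Option I) : T.torusHom k (D.den k j) = D'.den k j := by
  rcases j with _ | i
  · simp [den]
  · by_cases h : i ∈ D.F
    · have h' : i ∈ D'.F := T.F_eq ▸ h
      simp [den, h, h']
    · have h' : i ∉ D'.F := T.F_eq ▸ h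
      simp [den, h, h', torusHom_single, T.θ_ψ]

lemma wt_θ (j : Option I) (v : P) : D'.wt j (T.θ v) = D.wt j v := by
  rcases j with _ | i
  · rfl
  · exact T.u_θ i v

/-- The map `z ^ v ↦ z ^ (θ v)` on an overlap. -/
def overlapHom (j : Option I) : D.OverlapRing k j →+* D'.OverlapRing k j :=
  IsLocalization.Away.lift (D.den k j)
    (g := (algebraMap (AddMonoidAlgebra k P') (D'.OverlapRing k j)).comp (T.torusHom k).toRingHom) (by
      change IsUnit (algebraMap _ _ (T.torusHom k (D.den k j)))
      rw [torusHom_den]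
      exact IsLocalization.Away.algebraMap_isUnit _)

lemma overlapHom_algebraMap (j : Option I) (x : AddMonoidAlgebra k P) :
    T.overlapHom k j (algebraMap _ _ x) = algebraMap _ _ (T.torusHom k x) :=
  IsLocalization.Away.lift_eq _ _ _

lemma overlapHom_denUnit (j : Option I) (n : ℤ) :
    T.overlapHom k j ((D.denUnit k j ^ n : (D.OverlapRing k j)ˣ) : D.OverlapRing k j) =
      ((D'.denUnit k j ^ n : (D'.OverlapRing k j)ˣ) : D'.OverlapRing k j) := by
  have h : Units.map (T.overlapHom k j).toMonoidHom (D.denUnit k j) = D'.denUnit k j := by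
    ext
    change T.overlapHom k j (algebraMap _ _ (D.den k j)) = algebraMap _ _ (D'.den k j)
    rw [overlapHom_algebraMap, torusHom_den]
  have := congrArg (fun x : (D'.OverlapRing k j)ˣ => ((x ^ n : (D'.OverlapRing k j)ˣ) :
    D'.OverlapRing k j)) h
  simp only [← map_zpow] at this
  exact this

lemma overlapHom_mutation (j : Option I) :
    (T.overlapHom k j).comp (D.mutation k j).toRingHom =
      (D'.mutation k j).toRingHom.comp (T.chartHom k j).toRingHom := by
  refine AddMonoidAlgebra.ringHom_ext (fun r => ?_) fun v => ?_
  · have h1 : D.mutation k j (.single 0 r) = algebraMap (AddMonoidAlgebra k P) _ (.single 0 r) := by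
      rw [show (AddMonoidAlgebra.single 0 r : D.ChartRing k j) = algebraMap k _ r from rfl,
        AlgHom.commutes, IsScalarTower.algebraMap_apply k (AddMonoidAlgebra k P)]
      rfl
    have h2 : D'.mutation k j (.single 0 r) =
        algebraMap (AddMonoidAlgebra k P') _ (.single 0 r) := by
      rw [show (AddMonoidAlgebra.single 0 r : D'.ChartRing k j) = algebraMap k _ r from rfl,
        AlgHom.commutes, IsScalarTower.algebraMap_apply k (AddMonoidAlgebra k P')]
      rfl
    have h3 : T.chartHom k j (.single 0 r) = .single 0 r := by simp [chartHom]
    change T.overlapHom k j (D.mutation k j _) = D'.mutation k j (T.chartHom k j _)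
    rw [h1, h3, h2, overlapHom_algebraMap, torusHom_single, map_zero]
  · have h3 : T.chartHom k j (.single v 1) = .single ⟨T.θ v, T.map_mem j v⟩ 1 := by
      simp [chartHom]
      rfl
    change T.overlapHom k j (D.mutation k j _) = D'.mutation k j (T.chartHom k j _)
    rw [h3]
    have h4 : D.mutation k j (.single v 1) = D.mutHom k (-1) j (.single (v : P) 1) := by
      simp [mutation, chartIncl]
    have h5 : D'.mutation k j (.single ⟨T.θ v, T.map_mem j v⟩ 1) =
        D'.mutHom k (-1) j (.single (T.θ v) 1) := by
      simp [mutation, chartIncl]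
    rw [h4, h5, mutHom_single, mutHom_single, map_mul, overlapHom_algebraMap, overlapHom_denUnit,
      torusHom_single, T.wt_θ]

/-- The morphism of glued schemes given by `z ^ v ↦ z ^ (θ v)` on every chart. -/
def schemeMap : D'.scheme k ⟶ D.scheme k :=
  D'.desc k (fun j => Spec.map (CommRingCat.ofHom (T.chartHom k j).toRingHom) ≫ D.chart k j)
    (Spec.map (CommRingCat.ofHom (T.torusHom k).toRingHom) ≫ D.center k) (fun j => by
      have e1 : Spec.map (CommRingCat.ofHom (D'.mutation k j).toRingHom) ≫
          Spec.map (CommRingCat.ofHom (T.chartHom k j).toRingHom) =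
          Spec.map (CommRingCat.ofHom (T.overlapHom k j)) ≫
          Spec.map (CommRingCat.ofHom (D.mutation k j).toRingHom) := by
        rw [← Spec.map_comp, ← Spec.map_comp]
        congr 1
        exact CommRingCat.hom_ext (T.overlapHom_mutation k j).symm
      have e2 : Spec.map (CommRingCat.ofHom
            (algebraMap (AddMonoidAlgebra k P') (D'.OverlapRing k j))) ≫
          Spec.map (CommRingCat.ofHom (T.torusHom k).toRingHom) =
          Spec.map (CommRingCat.ofHom (T.overlapHom k j)) ≫
          Spec.map (CommRingCat.ofHom
            (algebraMap (AddMonoidAlgebra k P) (D.OverlapRing k j))) := by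
        rw [← Spec.map_comp, ← Spec.map_comp]
        congr 1
        exact CommRingCat.hom_ext (RingHom.ext fun x => (T.overlapHom_algebraMap k j x).symm)
      rw [← Category.assoc, e1, ← Category.assoc, e2, Category.assoc, Category.assoc,
        D.mutation_chart])

lemma chart_schemeMap (j : Option I) : D'.chart k j ≫ T.schemeMap k =
    Spec.map (CommRingCat.ofHom (T.chartHom k j).toRingHom) ≫ D.chart k j :=
  D'.chart_desc k _ _ _ j

lemma schemeMap_toTorus {Q : Type u} [AddCommGroup Q] (τ : Q →+ P) (τ' : Q →+ P')
    (hτ : ∀ i q, D.u i (τ q) = 0) (hτ' : ∀ i q, D'.u i (τ' q) = 0)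
    (h : ∀ q, T.θ (τ q) = τ' q) : T.schemeMap k ≫ D.toTorus k τ hτ = D'.toTorus k τ' hτ' := by
  refine D'.scheme_hom_ext k fun j => ?_
  rw [← Category.assoc, T.chart_schemeMap k, Category.assoc]
  unfold toTorus
  rw [chart_desc, chart_desc, ← Spec.map_comp]
  congr 1
  refine CommRingCat.hom_ext (congrArg AlgHom.toRingHom
    (algHom_ext_single k (f := (T.chartHom k j).comp (D.toTorusChart k τ hτ j))
      (g := D'.toTorusChart k τ' hτ' j) fun q => ?_))
  simp [chartHom, toTorusChart]
  congr 1
  exact Subtype.ext (h q)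

end Hom
end map

end MutationDatum

/-- A seed `(N, I, {e_i}, F, [·,·])`: the `e i` are a basis of a saturated sublattice of `N`, `F` is the set
of frozen indices, and `form` is a bilinear form with `[e i, e i] = 0` for the unfrozen indices. -/
structure Seed (N I : Type u) [AddCommGroup N] where
  e : I → N
  linearIndependent : LinearIndependent ℤ e
  saturated : ∀ (c : ℤ) (n : N), c ≠ 0 →
    c • n ∈ Submodule.span ℤ (Set.range e) → n ∈ Submodule.span ℤ (Set.range e)
  F : Set I
  form : N →ₗ[ℤ] N →ₗ[ℤ] ℤ
  form_self : ∀ i ∉ F, form (e i) (e i) = 0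

namespace Seed
variable {N I : Type u} [AddCommGroup N] (S : Seed N I) (k : Type u) [Field k]

/-- The sublattice `N_I` spanned by the `e i`. -/
abbrev NI : Submodule ℤ N := Submodule.span ℤ (Set.range S.e)

/-- The vector `e i` as an element of `N_I`. -/
def eI (i : I) : S.NI := ⟨S.e i, Submodule.subset_span ⟨i, rfl⟩⟩

/-- `M_I`, the dual of `N_I`. -/
abbrev MI : Type u := Module.Dual ℤ S.NI

/-- `p₁ n = [n, ·]`. -/
def p₁ : N →ₗ[ℤ] Module.Dual ℤ N := S.form

/-- `p₂ n = [·, n]`. -/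
def p₂ : N →ₗ[ℤ] Module.Dual ℤ N := S.form.flip

/-- `K₁ = ker p₁`. -/
abbrev K₁ : Submodule ℤ N := LinearMap.ker S.p₁

/-- The mutations `z ^ n ↦ z ^ n * (1 + z ^ (e i)) ^ (-[n, e i])` of `Spec k[N]`, and the partial
compactifications `Spec k[n | 0 ≤ [n, e i]]`. -/
def dataX : MutationDatum N I where
  F := S.F
  u i := (S.p₂ (S.e i)).toAddMonoidHom
  ψ := S.e
  u_ψ := S.form_self

/-- The mutations `z ^ m ↦ z ^ m * (1 + z ^ (p₁ (e i))) ^ (-⟨e i, m⟩)` of `Spec k[M]`, `M = N^*`, and the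
partial compactifications `Spec k[m | 0 ≤ ⟨e i, m⟩]`. -/
def dataA : MutationDatum (Module.Dual ℤ N) I where
  F := S.F
  u i := (Module.Dual.eval ℤ N (S.e i)).toAddMonoidHom
  ψ i := S.p₁ (S.e i)
  u_ψ := S.form_self

/-- The bilinear form `[(n₁, m₁), (n₂, m₂)] = [n₁, n₂] + ⟨n₁, m₂⟩ - ⟨n₂, m₁⟩` on `N_I ⊕ M`. -/
def formPrin : (S.NI × Module.Dual ℤ N) →ₗ[ℤ] (S.NI × Module.Dual ℤ N) →ₗ[ℤ] ℤ :=
  LinearMap.mk₂ ℤ (fun v w => S.form v.1 w.1 + w.2 v.1 - v.2 w.1)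
    (fun _ _ _ => by simp; ring) (fun _ _ _ => by simp; ring)
    (fun _ _ _ => by simp; ring) (fun _ _ _ => by simp; ring)

lemma span_prin : Submodule.span ℤ (Set.range fun i => ((S.eI i, 0) : S.NI × Module.Dual ℤ N)) =
    Submodule.map (LinearMap.inl ℤ S.NI (Module.Dual ℤ N)) ⊤ := by
  have h : Submodule.span ℤ (Set.range S.eI) = ⊤ := by
    rw [← Submodule.span_span_coe_preimage (R := ℤ) (s := Set.range S.e)]
    congr 1
    ext v
    exact ⟨fun ⟨i, hi⟩ => ⟨i, congrArg Subtype.val hi⟩, fun ⟨i, hi⟩ => ⟨i, Subtype.ext hi⟩⟩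
  rw [← h, Submodule.map_span, ← Set.range_comp]
  rfl

/-- The seed with principal coefficients, on the lattice `N_prin = N_I ⊕ M`, with the basis `(e i, 0)`. -/
def prin : Seed (S.NI × Module.Dual ℤ N) I where
  e i := (S.eI i, 0)
  linearIndependent := by
    refine LinearIndependent.of_comp (S.NI.subtype.comp (LinearMap.fst ℤ S.NI (Module.Dual ℤ N))) ?_
    exact S.linearIndependent
  saturated c w hc hw := by
    rw [span_prin] at hw ⊢
    obtain ⟨v, -, hv⟩ := hw
    have h2 : c • w.2 = 0 := (congrArg Prod.snd hv).symm
    have h3 : w.2 = 0 := by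
      ext n
      have := congrArg (fun f : Module.Dual ℤ N => f n) h2
      simpa [hc] using this
    exact ⟨w.1, trivial, Prod.ext rfl h3.symm⟩
  F := S.F
  form := S.formPrin
  form_self i hi := by simp [formPrin, eI, S.form_self i hi]

/-- The cluster `X`-variety of the seed. -/
abbrev X : Scheme.{u} := S.dataX.scheme k
/-- The cluster `A`-variety of the seed. -/
abbrev A : Scheme.{u} := S.dataA.scheme k
/-- The cluster `A`-variety with principal coefficients. -/
abbrev APrin : Scheme.{u} := S.prin.A k

/-- The lattice map `N_prin → M`, `(n, m) ↦ p₂ n + m`. -/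
def p₂tilde : (S.NI × Module.Dual ℤ N) →ₗ[ℤ] Module.Dual ℤ N :=
  (S.p₂.comp S.NI.subtype).coprod LinearMap.id

/-- The dual `N → N_prin^*` of `p₂tilde`. In the decomposition `N_prin^* = M_I ⊕ N` it sends `n` to
`([n, ·]|_{N_I}, n)`. -/
def p₂tildeHom : S.dataX.Hom S.prin.dataA where
  θ := S.p₂tilde.flip.toAddMonoidHom
  F_eq := rfl
  u_θ i v := by simp [p₂tilde, prin, dataA, dataX, eI]
  θ_ψ i := by
    ext w <;> simp [p₂tilde, prin, dataA, dataX, eI, p₁, p₂, formPrin]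

/-- The morphism from the `A`-variety with principal coefficients to the `X`-variety. -/
def p₂Map : S.APrin k ⟶ S.X k := S.p₂tildeHom.schemeMap k

/-- The morphism from the `X`-variety to `Spec k[K₁]` given by `z ^ n ↦ z ^ n` for `n ∈ K₁`. -/
def lamMap : S.X k ⟶ Spec (.of (AddMonoidAlgebra k S.K₁)) :=
  S.dataX.toTorus k S.K₁.subtype.toAddMonoidHom (fun i n => by
    have := congrArg (fun f : Module.Dual ℤ N => f (S.e i)) (LinearMap.mem_ker.1 n.2)
    exact this)

/-- The morphism from the `A`-variety with principal coefficients to `Spec k[N]`, the torus of `M`, given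
by `z ^ n ↦ z ^ (0, n)`. -/
def piMap : S.APrin k ⟶ Spec (.of (AddMonoidAlgebra k N)) :=
  S.prin.dataA.toTorus k
    (LinearMap.flip (LinearMap.snd ℤ S.NI (Module.Dual ℤ N))).toAddMonoidHom (fun i n => by
      simp [prin, dataA])

/-- The morphism of tori `Spec k[N] → Spec k[K₁]` given by the inclusion of `K₁` in `N`. -/
def iMap : Spec (.of (AddMonoidAlgebra k N)) ⟶ Spec (.of (AddMonoidAlgebra k S.K₁)) :=
  Spec.map (CommRingCat.ofHom
    (AddMonoidAlgebra.mapDomainAlgHom k k S.K₁.subtype.toAddMonoidHom).toRingHom)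

lemma p₂Map_lamMap : S.p₂Map k ≫ S.lamMap k = S.piMap k ≫ S.iMap k := by
  have h1 (i : I) (n : S.K₁) : S.form n (S.e i) = 0 :=
    congrArg (fun f : Module.Dual ℤ N => f (S.e i)) (LinearMap.mem_ker.1 n.2)
  have h2 : ∀ i q, S.dataX.u i (S.K₁.subtype.toAddMonoidHom q) = 0 := fun i q => h1 i q
  have h3 : ∀ i q, S.prin.dataA.u i
      ((LinearMap.flip (LinearMap.snd ℤ S.NI (Module.Dual ℤ N))).toAddMonoidHom q) = 0 :=
    fun i n => by simp [prin, dataA]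
  refine Eq.trans ?_ (S.prin.dataA.toTorus_comp k _ h3 S.K₁.subtype.toAddMonoidHom
    (fun i n => h3 i n)).symm
  refine S.p₂tildeHom.schemeMap_toTorus k _ _ h2 _ fun n => ?_
  ext w
  · simp [p₂tildeHom, p₂tilde, p₂]
    exact congrArg (fun f : Module.Dual ℤ N => f w) (LinearMap.mem_ker.1 n.2)
  · simp [p₂tildeHom, p₂tilde, p₂]

/-- The `k`-points of the torus `Spec k[K₁]`, as algebra homomorphisms `k[K₁] → k`. -/
abbrev KPoint : Type u := AddMonoidAlgebra k S.K₁ →ₐ[k] k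

variable {k} in
/-- A `k`-point as a morphism of schemes. -/
def KPoint.map (φ : S.KPoint k) : Spec (.of k) ⟶ Spec (.of (AddMonoidAlgebra k S.K₁)) :=
  Spec.map (CommRingCat.ofHom φ.toRingHom)

variable {k} (φ : S.KPoint k)

/-- The fibre of the `X`-variety over a `k`-point `φ` of `Spec k[K₁]`. -/
abbrev XFib : Scheme.{u} := pullback (S.lamMap k) (KPoint.map S φ)

/-- The inclusion of the fibre. -/
def XFibι : S.XFib φ ⟶ S.X k := pullback.fst _ _

/-- The fibre over `φ` of the `A`-variety with principal coefficients. -/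
abbrev AFib : Scheme.{u} := pullback (S.piMap k ≫ S.iMap k) (KPoint.map S φ)

/-- The inclusion of the fibre. -/
def AFibι : S.AFib φ ⟶ S.APrin k := pullback.fst _ _

/-- The restriction of `p₂Map` to the fibres over `φ`. -/
def p₂FibMap : S.AFib φ ⟶ S.XFib φ :=
  pullback.lift (pullback.fst _ _ ≫ S.p₂Map k) (pullback.snd _ _) (by
    rw [Category.assoc, S.p₂Map_lamMap, pullback.condition])

end Seed

namespace MutationDatum
variable {P I : Type u} [AddCommGroup P] (D : MutationDatum P I) (k : Type u) [Field k]

/-- A chart as an open subset. -/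
def chartOpen (j : Option I) : (D.scheme k).Opens := D.chart k j ''ᵁ ⊤

/-- An element of the chart ring as a section over the chart. -/
def chartSection (j : Option I) : D.ChartRing k j →+* Γ(D.scheme k, D.chartOpen k j) :=
  ((Scheme.ΓSpecIso (.of (D.ChartRing k j))).inv ≫ ((D.chart k j).appIso ⊤).inv).hom

/-- The prime divisor belonging to the index `i`: the part `U_i ∖ U_0` of the chart of `i` that is missing
from the central torus `U_0`. (This set is closed already; the closure makes this part of the type.) -/
def divisor (i : I) : TopologicalSpace.Closeds (D.scheme k) :=
  ⟨closure ((D.chartOpen k (some i) : Set (D.scheme k)) \ D.chartOpen k none), isClosed_closure⟩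

/-- The ideal sheaf of this divisor, with its reduced structure. -/
def divisorIdeal (i : I) : (D.scheme k).IdealSheafData :=
  Scheme.IdealSheafData.vanishingIdeal (D.divisor k i)

variable {k} {Λ : Type u} [AddCommGroup Λ] (deg : P →+ Λ)
  {B : Scheme.{u}} (q : B ⟶ D.scheme k)

/-- `g` is homogeneous of degree `d`, where the monomial `z ^ v` has degree `deg v`. -/
def IsHomogeneousOn (j : Option I) (d : Λ) (g : D.ChartRing k j) : Prop :=
  ∀ v : D.mon j, g.coeff v ≠ 0 → deg v = d

/-- The restriction to `W` of (the pullback along `q` of) a function on the chart `j`. -/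
def resChart {j : Option I} {W : B.Opens} (hW : W ≤ q ⁻¹ᵁ D.chartOpen k j) (g : D.ChartRing k j) :
    Γ(B, W) :=
  B.presheaf.map (homOfLE hW).op (q.app (D.chartOpen k j) (D.chartSection k j g))

/-- The grading induced on sections of the structure sheaf: a section `f` is homogeneous of degree `d` if
locally on its domain it is a quotient `g / h` of homogeneous functions on a chart with
`deg g = deg h + d`. This is stated for a scheme `B` over the glued scheme (the glued scheme itself,
or a fibre in it). -/
def IsHomogeneousSection (d : Λ) (W : B.Opens) (f : Γ(B, W)) : Prop :=
  ∀ y ∈ W, ∃ (W' : B.Opens) (hW : W' ≤ W) (j : Option I) (hj : W' ≤ q ⁻¹ᵁ D.chartOpen k j),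
    y ∈ W' ∧ ∃ (c : Λ) (g h : D.ChartRing k j),
      D.IsHomogeneousOn deg j (c + d) g ∧ D.IsHomogeneousOn deg j c h ∧
      IsUnit (D.resChart q hj h) ∧
      B.presheaf.map (homOfLE hW).op f * D.resChart q hj h = D.resChart q hj g

end MutationDatum

section divisors
variable {Y : Scheme.{u}} [AlgebraicGeometry.IsIntegral Y] {I : Type u} [Fintype I] (J : I → Y.IdealSheafData)

/-- Integral powers of a fractional ideal, with `1 / L = {x | x L ⊆ R}` as the inverse of `L`. -/
def idealZpow {R K : Type u} [CommRing R] [CommRing K] [Algebra R K] (L : Submodule R K) (a : ℤ) :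
    Submodule R K := L ^ a.toNat * (1 / L) ^ (-a).toNat

lemma idealZpow_mul_le {R K : Type u} [CommRing R] [CommRing K] [Algebra R K] (L : Submodule R K)
    (a b : ℤ) : idealZpow L a * idealZpow L b ≤ idealZpow L (a + b) := by
  obtain ⟨c, hc₁, hc₂⟩ : ∃ c : ℕ, a.toNat + b.toNat = (a + b).toNat + c ∧
      (-a).toNat + (-b).toNat = (-(a + b)).toNat + c :=
    ⟨a.toNat + b.toNat - (a + b).toNat, by omega, by omega⟩
  have h : (L * (1 / L)) ^ c ≤ 1 := pow_le_one' Submodule.mul_one_div_le_one c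
  calc idealZpow L a * idealZpow L b
      = L ^ (a.toNat + b.toNat) * (1 / L) ^ ((-a).toNat + (-b).toNat) := by
        unfold idealZpow; ring
    _ = idealZpow L (a + b) * (L * (1 / L)) ^ c := by
        rw [hc₁, hc₂]; unfold idealZpow; ring
    _ ≤ idealZpow L (a + b) * 1 := mul_le_mul_right h _
    _ = idealZpow L (a + b) := mul_one _

/-- The fractional ideal `∏ I_i ^ (-a i)` over an affine open `W`, where `I_i` is the ideal of the `i`-th
divisor `E_i` on `W`. -/
def localSections (a : I → ℤ) (W : Y.affineOpens) [Nonempty W.1] :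
    Submodule Γ(Y, W.1) Y.functionField :=
  ∏ i, idealZpow (IsLocalization.coeSubmodule Y.functionField ((J i).ideal W)) (-a i)

/-- The sections of `O_Y(∑ a_i E_i)` over `U` as elements of the function field, for effective Cartier
divisors `E_i` with ideal sheaves `J i`: rational functions that lie in `∏ I_i ^ (-a i)` over every
nonempty affine open `W ⊆ U`. (For nonempty `U`; over the empty set the sheaf is zero.) -/
def divisorSections (a : I → ℤ) (U : Y.Opens) : AddSubgroup Y.functionField where
  carrier := {f | ∀ (W : Y.affineOpens) [Nonempty W.1], W.1 ≤ U → f ∈ localSections J a W}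
  zero_mem' _ _ _ := zero_mem _
  add_mem' hf hg W _ hW := add_mem (hf W hW) (hg W hW)
  neg_mem' hf W _ hW := neg_mem (hf W hW)

lemma divisorSections_mul (a b : I → ℤ) (U : Y.Opens) {f g : Y.functionField}
    (hf : f ∈ divisorSections J a U) (hg : g ∈ divisorSections J b U) :
    f * g ∈ divisorSections J (a + b) U := by
  intro W _ hW
  have h := Submodule.mul_mem_mul (hf W hW) (hg W hW)
  refine SetLike.le_def.1 ?_ h
  unfold localSections
  rw [← Finset.prod_mul_distrib]
  refine Finset.prod_le_prod' fun i _ => ?_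
  refine (idealZpow_mul_le _ _ _).trans (le_of_eq ?_)
  simp [add_comm]

lemma germ_mem_divisorSections (U : Y.Opens) [Nonempty U] (f : Γ(Y, U)) :
    Y.germToFunctionField U f ∈ divisorSections J 0 U := by
  intro W _ hW
  have : localSections J 0 W = 1 := by simp [localSections, idealZpow]
  rw [this]
  refine Submodule.mem_one.2 ⟨Y.presheaf.map (homOfLE hW).op f, ?_⟩
  exact Y.presheaf.germ_res_apply (homOfLE hW) _ _ f

lemma one_mem_divisorSections (U : Y.Opens) : (1 : Y.functionField) ∈ divisorSections J 0 U := by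
  intro W _ hW
  have : localSections J 0 W = 1 := by simp [localSections, idealZpow]
  rw [this]
  exact Submodule.one_le.1 le_rfl

variable {Λ : Type u} [AddCommGroup Λ] (w : Λ →+ (I → ℤ))

/-- The sections over a nonempty open `U` of the `Λ`-graded algebra `⨁_m O_Y(w m) z ^ m`, where `w m` is
the divisor `∑ (w m i) E_i`, as a subring of `K(Y)[Λ]`. -/
def multisections (U : Y.Opens) : Subring (AddMonoidAlgebra Y.functionField Λ) where
  carrier := {s | ∀ m, s.coeff m ∈ divisorSections J (w m) U}
  zero_mem' _ := zero_mem _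
  add_mem' hs ht m := add_mem (hs m) (ht m)
  neg_mem' hs m := neg_mem (hs m)
  one_mem' m := by
    classical
    rw [AddMonoidAlgebra.one_def, AddMonoidAlgebra.coeff_single, Finsupp.single_apply]
    split_ifs with h
    · rw [← h, map_zero]
      exact one_mem_divisorSections J U
    · exact zero_mem _
  mul_mem' {s t} hs ht m := by
    classical
    rw [AddMonoidAlgebra.coeff_mul]
    refine sum_mem fun x _ => sum_mem fun y _ => ?_
    dsimp only
    split_ifs with h
    · rw [← h, map_add]
      exact divisorSections_mul J _ _ U (hs x) (ht y)
    · exact zero_mem _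

lemma multisections_mono {U U' : Y.Opens} (h : U ≤ U') :
    multisections J w U' ≤ multisections J w U :=
  fun _ hs m W _ hW => hs m W (hW.trans h)

/-- The structure map from `O_Y(U)`, onto regular functions in degree `0`. -/
def structureHom (U : Y.Opens) [Nonempty U] : Γ(Y, U) →+* multisections J w U :=
  ((AddMonoidAlgebra.singleZeroRingHom).comp (Y.germToFunctionField U).hom).codRestrict _
    (fun f m => by
      classical
      change (AddMonoidAlgebra.single 0 _).coeff m ∈ _
      rw [AddMonoidAlgebra.coeff_single, Finsupp.single_apply]
      split_ifs with h
      · rw [← h, map_zero]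
        exact germ_mem_divisorSections J U f
      · exact zero_mem _)

/-- An isomorphism of `Λ`-graded `O_Y`-algebras from `⨁_m O_Y(w m) z ^ m` onto `p_* O_B`, where `p : B ⟶ Y`,
and `O_B` is graded through a morphism `q` from `B` to a glued scheme. It consists of a ring isomorphism
over every nonempty open `U` (over the empty set both sheaves are zero), compatible with restriction
(`naturality`), with the structure maps from `O_Y` (`algebra`) and with the degrees (`graded`), and it
is the one induced by `p` and `z ^ m ↦ z ^ (ζ m)` over the subset `Y₀` (`monomial`). -/
structure GradedAlgIso {P : Type u} [AddCommGroup P] {D : MutationDatum P I} {k : Type u} [Field k]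
    (deg : P →+ Λ) (ζ : Λ →+ P) {B : Scheme.{u}} (q : B ⟶ D.scheme k) (p : B ⟶ Y)
    (Y₀ : Y.Opens) where
  iso : ∀ (U : Y.Opens) [Nonempty U], multisections J w U ≃+* Γ(B, p ⁻¹ᵁ U)
  naturality : ∀ (U U' : Y.Opens) [Nonempty U] [Nonempty U'] (h : U ≤ U')
    (s : multisections J w U'),
    iso U (Subring.inclusion (multisections_mono J w h) s) =
      B.presheaf.map (homOfLE (fun _ hx => h hx : p ⁻¹ᵁ U ≤ p ⁻¹ᵁ U')).op (iso U' s)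
  algebra : ∀ (U : Y.Opens) [Nonempty U] (f : Γ(Y, U)), iso U (structureHom J w U f) = p.app U f
  graded : ∀ (U : Y.Opens) [Nonempty U] (m : Λ) (s : multisections J w U),
    (∀ m', s.1.coeff m' ≠ 0 → m' = m) ↔ D.IsHomogeneousSection deg q m (p ⁻¹ᵁ U) (iso U s)
  monomial : ∀ (U : Y.Opens) [Nonempty U] (m : Λ), U ≤ Y₀ →
    ∃ (hU : p ⁻¹ᵁ U ≤ q ⁻¹ᵁ D.chartOpen k none)
      (hm : AddMonoidAlgebra.single m 1 ∈ multisections J w U),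
      iso U ⟨_, hm⟩ = D.resChart q hU (.single ⟨ζ m, trivial⟩ 1)

end divisors

namespace Seed
variable {N I : Type u} [AddCommGroup N] [Fintype I] (S : Seed N I) {k : Type u} [Field k]

/-- The coefficients of the divisor `W(m) = ∑ a_i E_i`, where `m = ∑ a_i e_i^*`, that is `a_i = ⟨e_i, m⟩`. -/
def W : S.MI →+ (I → ℤ) where
  toFun m i := m (S.eI i)
  map_zero' := rfl
  map_add' _ _ := rfl

/-- The degree of a monomial: `deg (z ^ v) = v|_{N_I} - (n' ↦ v (0, p₂ n'))`. In the decomposition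
`N_prin^* = M_I ⊕ N` this is `deg (z ^ (m, n)) = m - [n, ·]|_{N_I}`. -/
def deg : Module.Dual ℤ (S.NI × Module.Dual ℤ N) →+ S.MI where
  toFun v := v.comp (LinearMap.inl ℤ _ _) -
    (v.comp (LinearMap.inr ℤ _ _)).comp (S.p₂.comp S.NI.subtype)
  map_zero' := by simp
  map_add' v v' := by ext; simp; ring

/-- The inclusion `m ↦ (m, 0)` of `M_I` into `N_prin^* = M_I ⊕ N`. -/
def zeta : S.MI →+ Module.Dual ℤ (S.NI × Module.Dual ℤ N) where
  toFun m := m.comp (LinearMap.fst ℤ _ _)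
  map_zero' := by simp
  map_add' v v' := by ext <;> simp

end Seed

end ClusterTorsor

end

open ClusterTorsor

/-!
The morphism `p₂ : A_prin ⟶ X` is a torsor under the torus with character lattice `M_I`, and the
relative spectrum of the multisections of a family of divisors is the torsor that these divisors
define. The proof writes `A_prin` in charts as that torsor.

*Local structure.* The lattice map `n ↦ (p̄₁ n, n)` splits off `M_I` through `m ↦ (m, 0)`, with the
degree as a retraction. Hence functions on the chart `j` of `A_prin` are Laurent polynomials over the
chart `j` of `X` in monomials `χ_{j,m}` of degree `m` (`MutationDatum.laurentHom_chartMonomial_bijective`).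
On the central and unfrozen charts `χ_{j,m}` is `z ^ (m, 0)`. At a frozen index `i` the monomial
`z ^ (m, 0)` has order `m_i` along the boundary of the chart, and it has to be divided by the
`m_i`-th power of a monomial `z ^ v` of order one coming from `X`; such a `v` exists because `p₂ (e i)`
is primitive (`MutationDatum.Uniformizer`).

*The divisors.* The boundary of the chart `i` of `X` has the equation `t_i = 1 + z ^ (e i)` for an
unfrozen and `t_i = z ^ v` for a frozen index, and `t_i` generates a prime ideal; in the unfrozen case
this is so because `e i`, in a basis of a saturated sublattice, is primitive. As the charts meet only
in the central torus, `E_i` is trivial on all other charts (`MutationDatum.divisorIdeal_ideal`).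
The gluing map identifies `z ^ (m, 0)` on the central torus with `χ_{i,m}` times the power `m_i` of
`t_i` (`MutationDatum.mutation_chartMonomial`). In terms of `z ^ m := z ^ (m, 0)`, functions on the preimage
of the chart `i` are therefore the sums of terms `s z ^ m` where `s t_i ^ m_i` is regular, that is,
where `s` is a section of `O(W m)` on the chart.

*Gluing.* An atlas of this kind determines the functions on the preimage of every open set, since
sections of `O(W m)` can be tested on an affine cover (`TorsorAtlas.mem_regular_preimage`).

*Fibres.* Both parts of the theorem are cases of one statement on a closed immersion `f : Y ⟶ X`
and the base change of `p₂` along it (`MutationDatum.exists_isIntegral_gradedAlgIso`): `f` is the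
identity or the inclusion of the fibre over `φ`. What it needs of `f` is that the functions on the
charts of `Y` form domains and that the equations `t_i` do not vanish on them. For a fibre, a
retraction of `N` onto `K₁`, twisted by `φ`, identifies these rings with subrings of a Laurent
polynomial ring (`MutationDatum.isDomain_fibre`), and `1 + z ^ (e i)` vanishes only if `e i` lies in
`K₁` and `z ^ (e i)` has the value `-1` at `φ` (`MutationDatum.pullSection_eqn_ne_zero`).
-/

noncomputable section

namespace ClusterTorsor

/-! ### Fractional ideals under localization -/

section fractional
variable {R K : Type u} [CommRing R] [Field K] [Algebra R K]

lemma one_div_span_singleton {t : K} (ht : t ≠ 0) :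
    1 / Submodule.span R {t} = Submodule.span R {t⁻¹} := by
  ext x
  rw [Submodule.mem_div_iff_forall_mul_mem]
  constructor
  · intro h
    obtain ⟨r, hr⟩ := Submodule.mem_one.1 (h t (Submodule.mem_span_singleton_self t))
    refine Submodule.mem_span_singleton.2 ⟨r, ?_⟩
    rw [Algebra.smul_def, hr, mul_inv_cancel_right₀ ht]
  · intro h y hy
    obtain ⟨a, rfl⟩ := Submodule.mem_span_singleton.1 h
    obtain ⟨b, rfl⟩ := Submodule.mem_span_singleton.1 hy
    refine Submodule.mem_one.2 ⟨a * b, ?_⟩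
    rw [map_mul, Algebra.smul_def, Algebra.smul_def]
    field_simp

lemma idealZpow_span_singleton {t : K} (ht : t ≠ 0) (a : ℤ) :
    idealZpow (Submodule.span R {t}) a = Submodule.span R {t ^ a} := by
  unfold idealZpow
  rw [one_div_span_singleton ht, Submodule.span_pow, Submodule.span_pow, Set.singleton_pow, Set.singleton_pow,
    Submodule.span_mul_span, Set.singleton_mul_singleton]
  congr 2
  rw [inv_pow, ← zpow_natCast, ← zpow_natCast, ← zpow_neg, ← zpow_add₀ ht]
  congr 1
  omega

lemma prod_span_singleton {ι : Type*} (s : Finset ι) (t : ι → K) :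
    ∏ i ∈ s, Submodule.span R {t i} = Submodule.span R {∏ i ∈ s, t i} := by
  classical
  induction s using Finset.induction_on with
  | empty => simp [Submodule.one_eq_span]
  | insert i s hi h =>
    rw [Finset.prod_insert hi, Finset.prod_insert hi, h, Submodule.span_mul_span,
      Set.singleton_mul_singleton]

variable {R' : Type u} [CommRing R'] [Algebra R' K]

/-- Every element of the `R'`-submodule `A'` of `K` lies in the `R`-submodule `A` after multiplication
by a power of `s`. For `R' = R[1 / s]` this says that `A'` is contained in `A[1 / s]`. -/
def LocLE (s : R) (A : Submodule R K) (A' : Submodule R' K) : Prop :=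
  ∀ x ∈ A', ∃ n : ℕ, algebraMap R K s ^ n * x ∈ A

lemma pow_mul_mem_of_le (s : R) (A : Submodule R K) {x : K} {n m : ℕ} (h : n ≤ m)
    (hx : algebraMap R K s ^ n * x ∈ A) : algebraMap R K s ^ m * x ∈ A := by
  obtain ⟨d, rfl⟩ := Nat.exists_eq_add_of_le h
  have := A.smul_mem (s ^ d) hx
  rwa [Algebra.smul_def, map_pow, ← mul_assoc, ← pow_add, add_comm d] at this

lemma exists_uniform_pow {ι : Type*} (T : Finset ι) (s : R) (A : Submodule R K) (x : ι → K)
    (h : ∀ i ∈ T, ∃ n : ℕ, algebraMap R K s ^ n * x i ∈ A) :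
    ∃ n : ℕ, ∀ i ∈ T, algebraMap R K s ^ n * x i ∈ A := by
  classical
  choose! n hn using h
  exact ⟨T.sup n, fun i hi => pow_mul_mem_of_le s A (Finset.le_sup hi) (hn i hi)⟩

lemma exists_pow_add (s : R) (A : Submodule R K) {x y : K}
    (hx : ∃ n : ℕ, algebraMap R K s ^ n * x ∈ A) (hy : ∃ n : ℕ, algebraMap R K s ^ n * y ∈ A) :
    ∃ n : ℕ, algebraMap R K s ^ n * (x + y) ∈ A := by
  obtain ⟨n, hn⟩ := hx
  obtain ⟨m, hm⟩ := hy
  refine ⟨max n m, ?_⟩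
  rw [mul_add]
  exact A.add_mem (pow_mul_mem_of_le s A (le_max_left _ _) hn)
    (pow_mul_mem_of_le s A (le_max_right _ _) hm)

namespace LocLE
variable {s : R} {A B : Submodule R K} {A' B' : Submodule R' K}

lemma mul (hA : LocLE s A A') (hB : LocLE s B B') : LocLE s (A * B) (A' * B') := by
  intro x hx
  induction hx using Submodule.mul_induction_on' with
  | mem_mul_mem a ha b hb =>
    obtain ⟨n, hn⟩ := hA a ha
    obtain ⟨m, hm⟩ := hB b hb
    refine ⟨n + m, ?_⟩
    have := Submodule.mul_mem_mul hn hm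
    rwa [mul_mul_mul_comm, ← pow_add] at this
  | add a _ b _ ha hb => exact exists_pow_add s _ ha hb

lemma pow (h1 : LocLE s (1 : Submodule R K) (1 : Submodule R' K)) (hA : LocLE s A A') (n : ℕ) :
    LocLE s (A ^ n) (A' ^ n) := by
  induction n with
  | zero => simpa using h1
  | succ n ih => simpa only [pow_succ] using ih.mul hA

lemma prod {ι : Type*} (T : Finset ι) (A : ι → Submodule R K) (A' : ι → Submodule R' K)
    (h1 : LocLE s (1 : Submodule R K) (1 : Submodule R' K)) (h : ∀ i ∈ T, LocLE s (A i) (A' i)) :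
    LocLE s (∏ i ∈ T, A i) (∏ i ∈ T, A' i) := by
  classical
  induction T using Finset.induction_on with
  | empty => simpa using h1
  | insert i T hi ih =>
    rw [Finset.prod_insert hi, Finset.prod_insert hi]
    exact (h i (Finset.mem_insert_self _ _)).mul
      (ih fun j hj => h j (Finset.mem_insert_of_mem hj))

/-- Inverting a fractional ideal commutes with localization if the ideal is finitely generated. -/
lemma one_div (h1 : LocLE s (1 : Submodule R K) (1 : Submodule R' K)) (hfg : A.FG)
    (hle : ∀ x ∈ A, x ∈ A') : LocLE s (1 / A) (1 / A') := by
  intro x hx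
  obtain ⟨T, rfl⟩ := hfg
  rw [Submodule.mem_div_iff_forall_mul_mem] at hx
  obtain ⟨n, hn⟩ := exists_uniform_pow T s (1 : Submodule R K) (fun y => x * y)
    fun y hy => h1 _ (hx y (hle y (Submodule.subset_span hy)))
  refine ⟨n, Submodule.mem_div_iff_forall_mul_mem.2 fun y hy => ?_⟩
  induction hy using Submodule.span_induction with
  | mem y hy => simpa only [mul_assoc] using hn y hy
  | zero => simp
  | add y z _ _ hy hz => rw [mul_add]; exact add_mem hy hz
  | smul r y _ hy => rw [mul_smul_comm]; exact Submodule.smul_mem _ r hy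

lemma idealZpow (h1 : LocLE s (1 : Submodule R K) (1 : Submodule R' K)) (hfg : A.FG)
    (hle : ∀ x ∈ A, x ∈ A') (hA : LocLE s A A') (a : ℤ) :
    LocLE s (idealZpow A a) (idealZpow A' a) :=
  (LocLE.pow h1 hA _).mul (LocLE.pow h1 (LocLE.one_div h1 hfg hle) _)

lemma coeSubmodule [Algebra R R'] [IsScalarTower R R' K]
    (h1 : LocLE s (1 : Submodule R K) (1 : Submodule R' K)) (I : Ideal R) :
    LocLE s (IsLocalization.coeSubmodule K I)
      (IsLocalization.coeSubmodule K (I.map (algebraMap R R'))) := by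
  intro x hx
  rw [Ideal.map, IsLocalization.coeSubmodule_span] at hx
  induction hx using Submodule.span_induction with
  | mem y hy =>
    obtain ⟨_, ⟨r, hr, rfl⟩, rfl⟩ := hy
    refine ⟨0, ?_⟩
    rw [pow_zero, one_mul, ← IsScalarTower.algebraMap_apply]
    exact (IsLocalization.mem_coeSubmodule _ _).2 ⟨r, hr, rfl⟩
  | zero => exact ⟨0, by simp⟩
  | add y z _ _ hy hz => exact exists_pow_add s _ hy hz
  | smul r y _ hy =>
    obtain ⟨n, hn⟩ := hy
    obtain ⟨m, hm⟩ := h1 (algebraMap R' K r) (Submodule.mem_one.2 ⟨r, rfl⟩)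
    obtain ⟨c, hc⟩ := Submodule.mem_one.1 hm
    refine ⟨m + n, ?_⟩
    rw [Algebra.smul_def, pow_add, mul_mul_mul_comm, ← hc, ← Algebra.smul_def]
    exact Submodule.smul_mem _ c hn

end LocLE

end fractional

/-! ### Regular functions inside the function field -/

section functionField
variable {Y : Scheme.{u}} [AlgebraicGeometry.IsIntegral Y]

lemma germToFunctionField_res {U V : Y.Opens} [Nonempty U] [Nonempty V] (h : U ≤ V) (f : Γ(Y, V)) :
    Y.germToFunctionField U (Y.presheaf.map (homOfLE h).op f) = Y.germToFunctionField V f :=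
  Y.presheaf.germ_res_apply (homOfLE h) _ _ f

variable (Y) in
/-- The rational functions on `Y` that are regular on the nonempty open subset `U`. -/
def regular (U : Y.Opens) [Nonempty U] : Subring Y.functionField :=
  (Y.germToFunctionField U).hom.range

lemma germ_mem_regular (U : Y.Opens) [Nonempty U] (f : Γ(Y, U)) :
    Y.germToFunctionField U f ∈ regular Y U := ⟨f, rfl⟩

lemma regular_congr {U V : Y.Opens} [Nonempty U] [Nonempty V] (h : U = V) :
    regular Y U = regular Y V := by
  subst h
  rfl

lemma regular_mono {U V : Y.Opens} [Nonempty U] [Nonempty V] (h : U ≤ V) :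
    regular Y V ≤ regular Y U := by
  rintro _ ⟨f, rfl⟩
  exact ⟨_, germToFunctionField_res h f⟩

lemma nonempty_basicOpen {U : Y.Opens} [Nonempty U] {s : Γ(Y, U)} (hs : s ≠ 0) :
    Nonempty (Y.basicOpen s) := by
  have h : Y.basicOpen s ≠ ⊥ := fun h => hs ((basicOpen_eq_bot_iff s).1 h)
  exact ((TopologicalSpace.Opens.ne_bot_iff_nonempty _).1 h).to_subtype

lemma isUnit_res_basicOpen {Y : Scheme.{u}} {U : Y.Opens} (s : Γ(Y, U)) :
    IsUnit (Y.presheaf.map (homOfLE (Y.basicOpen_le s)).op s) :=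
  Y.toRingedSpace.isUnit_res_basicOpen s

lemma mem_regular_basicOpen {U : Y.Opens} (hU : IsAffineOpen U) [Nonempty U] (s : Γ(Y, U))
    [Nonempty (Y.basicOpen s)] (F : Y.functionField) :
    F ∈ regular Y (Y.basicOpen s) ↔ ∃ n : ℕ, Y.germToFunctionField U s ^ n * F ∈ regular Y U := by
  have hs : Y.germToFunctionField U s ≠ 0 := by
    rw [← germToFunctionField_res (Y.basicOpen_le s)]
    exact ((isUnit_res_basicOpen s).map
      (Y.germToFunctionField (Y.basicOpen s)).hom).ne_zero
  have := hU.isLocalization_basicOpen s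
  constructor
  · rintro ⟨f, rfl⟩
    obtain ⟨n, a, ha⟩ := IsLocalization.Away.surj s f
    refine ⟨n, a, ?_⟩
    have h2 := congrArg (Y.germToFunctionField (Y.basicOpen s)) ha
    rw [map_mul, map_pow] at h2
    erw [germToFunctionField_res (Y.basicOpen_le s), germToFunctionField_res (Y.basicOpen_le s)] at h2
    rw [mul_comm]
    exact h2.symm
  · rintro ⟨n, a, ha⟩
    obtain ⟨b, hb⟩ := ((isUnit_res_basicOpen s).pow n).exists_left_inv
    refine ⟨b * Y.presheaf.map (homOfLE (Y.basicOpen_le s)).op a, ?_⟩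
    change Y.germToFunctionField _ _ = F
    have h3 := congrArg (Y.germToFunctionField (Y.basicOpen s)) hb
    rw [map_mul, map_pow, map_one, germToFunctionField_res] at h3
    rw [map_mul, germToFunctionField_res]
    change _ * (Y.germToFunctionField U).hom a = F
    rw [ha, ← mul_assoc, h3, one_mul]

lemma mem_regular_of_cover {U : Y.Opens} [Nonempty U] {F : Y.functionField}
    (h : ∀ x ∈ U, ∃ (V : Y.Opens) (_ : Nonempty V), x ∈ V ∧ V ≤ U ∧ F ∈ regular Y V) :
    F ∈ regular Y U := by
  choose V hV hxV hVU hF using h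
  choose f hf using hF
  obtain ⟨s, hs, -⟩ := Y.sheaf.existsUnique_gluing' (fun x : U => V x.1 x.2) U
    (fun x => homOfLE (hVU x.1 x.2)) (fun x hx => by
      exact TopologicalSpace.Opens.mem_iSup.2 ⟨⟨x, hx⟩, hxV x hx⟩)
    (fun x => f x.1 x.2) (by
      intro x y
      have : Nonempty (V x.1 x.2 ⊓ V y.1 y.2 : Y.Opens) := by
        have hne := (PreirreducibleSpace.isPreirreducible_univ (X := Y)) _ _ (V x.1 x.2).isOpen
          (V y.1 y.2).isOpen ⟨x.1, trivial, hxV _ _⟩ ⟨y.1, trivial, hxV _ _⟩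
        obtain ⟨z, -, hz⟩ := hne
        exact ⟨⟨z, hz⟩⟩
      apply Y.germToFunctionField_injective (V x.1 x.2 ⊓ V y.1 y.2)
      exact (germToFunctionField_res inf_le_left _).trans
        ((hf x.1 x.2).trans ((hf y.1 y.2).symm.trans (germToFunctionField_res inf_le_right _).symm)))
  obtain ⟨x⟩ := ‹Nonempty U›
  refine ⟨s, ?_⟩
  have := hV x.1 x.2
  rw [← hf x.1 x.2, ← hs x]
  exact (germToFunctionField_res (hVU x.1 x.2) s).symm

end functionField

/-! ### Integral schemes from charts -/

/-- A scheme is integral if it is covered by open affine charts whose coordinate rings are domains and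
which all meet one of them. -/
lemma isIntegral_of_charts {Y : Scheme.{u}} {ι : Type*} (V : ι → Y.Opens)
    (hV : ∀ j, IsAffineOpen (V j)) (hdom : ∀ j, IsDomain Γ(Y, V j)) (hcov : ∀ y, ∃ j, y ∈ V j)
    (o : ι) (hmeet : ∀ j, ((V j ⊓ V o : Y.Opens) : Set Y).Nonempty) :
    AlgebraicGeometry.IsIntegral Y := by
  have hint (j) : AlgebraicGeometry.IsIntegral (V j).toScheme := by
    have := hdom j
    have : IsDomain Γ((V j).toScheme, ⊤) :=
      ((V j).topIso.commRingCatIsoToRingEquiv).toMulEquiv.isDomain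
    have : IsAffine (V j).toScheme := hV j
    have : Nonempty (V j).toScheme := by
      obtain ⟨y, hy⟩ := hmeet j
      exact ⟨⟨y, hy.1⟩⟩
    exact isIntegral_of_isAffine_of_isDomain _
  have hred : AlgebraicGeometry.IsReduced Y := by
    have (x : Y) : _root_.IsReduced (Y.presheaf.stalk x) := by
      obtain ⟨j, hj⟩ := hcov x
      have := hint j
      have : _root_.IsReduced ((V j).toScheme.presheaf.stalk ⟨x, hj⟩) :=
        isReduced_stalk_of_isReduced (X := (V j).toScheme) ⟨x, hj⟩
      exact isReduced_of_injective ((V j).stalkIso ⟨x, hj⟩).inv.hom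
        ((V j).stalkIso ⟨x, hj⟩).symm.commRingCatIsoToRingEquiv.injective
    exact isReduced_of_isReduced_stalk Y
  have hpre (j) : IsPreirreducible (V j : Set Y) := by
    have := hint j
    have h := (PreirreducibleSpace.isPreirreducible_univ (X := (V j).toScheme)).image (V j).ι
      (V j).ι.continuous.continuousOn
    rwa [Set.image_univ, Scheme.Opens.range_ι] at h
  have hirr : IrreducibleSpace Y := by
    have : PreirreducibleSpace Y := by
      constructor
      intro A B hA hB ⟨a, _, ha⟩ ⟨b, _, hb⟩
      -- every nonempty open subset meets the chart `o`
      have key (A : Set Y) (hA : IsOpen A) (a : Y) (ha : a ∈ A) : ((V o : Set Y) ∩ A).Nonempty := by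
        obtain ⟨j, hj⟩ := hcov a
        obtain ⟨c, hc⟩ := hmeet j
        obtain ⟨x, -, hx⟩ := hpre j A (V o) hA (V o).isOpen ⟨a, hj, ha⟩ ⟨c, hc.1, hc.2⟩
        exact ⟨x, hx.2, hx.1⟩
      obtain ⟨x, -, hx⟩ := hpre o A B hA hB (key A hA a ha) (key B hB b hb)
      exact ⟨x, trivial, hx⟩
    obtain ⟨y, -⟩ := hmeet o
    exact { toNonempty := ⟨y⟩ }
  exact isIntegral_of_irreducibleSpace_of_isReduced Y

/-! ### Function fields and morphisms -/

section functionFieldMap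
variable {Y B : Scheme.{u}} [AlgebraicGeometry.IsIntegral Y] [AlgebraicGeometry.IsIntegral B]
  (p : B ⟶ Y) (hp : ∀ U : Y.Opens, Nonempty U → Nonempty (p ⁻¹ᵁ U))

include hp in
lemma specializes_genericPoint_of_dominant : p (genericPoint B) ⤳ genericPoint Y := by
  rw [specializes_iff_forall_open]
  intro U hU hy
  have : Nonempty (p ⁻¹ᵁ ⟨U, hU⟩) := hp ⟨U, hU⟩ ⟨⟨_, hy⟩⟩
  exact ((genericPoint_spec B).mem_open_set_iff (p ⁻¹ᵁ ⟨U, hU⟩).isOpen).mpr (by simpa using this)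

/-- The extension of function fields belonging to a morphism which meets every nonempty open subset. -/
def functionFieldMap : Y.functionField →+* B.functionField :=
  (Y.presheaf.stalkSpecializes (specializes_genericPoint_of_dominant p hp) ≫
    p.stalkMap (genericPoint B)).hom

lemma functionFieldMap_germ (U : Y.Opens) [Nonempty U] [Nonempty (p ⁻¹ᵁ U)] (f : Γ(Y, U)) :
    functionFieldMap p hp (Y.germToFunctionField U f) =
      B.germToFunctionField (p ⁻¹ᵁ U) (p.app U f) := by
  unfold functionFieldMap Scheme.germToFunctionField
  rw [CommRingCat.hom_comp, RingHom.comp_apply]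
  have h1 := Y.presheaf.germ_stalkSpecializes (U := U)
    (((genericPoint_spec Y).mem_open_set_iff U.isOpen).mpr (by simpa using ‹Nonempty U›))
    (specializes_genericPoint_of_dominant p hp)
  have h2 := congrArg (fun g => g.hom f) h1
  simp only [CommRingCat.hom_comp, RingHom.comp_apply] at h2
  erw [h2]
  exact p.germ_stalkMap_apply U _ _ f

end functionFieldMap

/-! ### Sections of a divisor are determined locally -/

lemma ideal_fg_of_cover {Y : Scheme.{u}} (W : Y.affineOpens) (𝓘 : Y.IdealSheafData)
    (h : ∀ y ∈ W.1, ∃ s : Γ(Y, W.1), y ∈ Y.basicOpen s ∧ (𝓘.ideal (Y.affineBasicOpen s)).FG) :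
    (𝓘.ideal W).FG := by
  let T : Set Γ(Y, W.1) := {s | (𝓘.ideal (Y.affineBasicOpen s)).FG}
  refine Ideal.fg_of_localizationSpan T ?_ fun g => ?_
  · rw [← W.2.self_le_iSup_basicOpen_iff]
    intro y hy
    obtain ⟨s, hs, hfg⟩ := h y hy
    exact TopologicalSpace.Opens.mem_iSup.2 ⟨⟨s, hfg⟩, hs⟩
  · have hloc := W.2.isLocalization_basicOpen g.1
    let e : Γ(Y, Y.basicOpen g.1) →+* Localization.Away g.1 :=
      (IsLocalization.algEquiv (Submonoid.powers g.1) Γ(Y, Y.basicOpen g.1)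
        (Localization.Away g.1)).toRingEquiv.toRingHom
    have he : algebraMap Γ(Y, W.1) (Localization.Away g.1) =
        e.comp (Y.presheaf.map (homOfLE (Y.basicOpen_le g.1)).op).hom :=
      RingHom.ext fun x => ((IsLocalization.algEquiv (Submonoid.powers g.1) Γ(Y, Y.basicOpen g.1)
        (Localization.Away g.1)).commutes x).symm
    have h2 : (𝓘.ideal (Y.affineBasicOpen g.1)).FG := g.2
    rw [← 𝓘.map_ideal_basicOpen W g.1] at h2
    rw [he, ← Ideal.map_map]
    exact Ideal.FG.map h2 e

section localSections
variable {Y : Scheme.{u}} [AlgebraicGeometry.IsIntegral Y] {I : Type u} [Fintype I]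
  (J : I → Y.IdealSheafData)

lemma mem_one_iff_mem_regular (U : Y.Opens) [Nonempty U] (c : Y.functionField) :
    c ∈ (1 : Submodule Γ(Y, U) Y.functionField) ↔ c ∈ regular Y U :=
  Submodule.mem_one

/-- Where the divisors `E i` have equations `t i`, the sections of `∑ a i E i` are the rational functions
`c` for which `c * ∏ t i ^ (a i)` is regular. -/
lemma mem_localSections_of_principal (W : Y.affineOpens) [Nonempty W.1] (t : I → Γ(Y, W.1))
    (ht : ∀ i, Y.germToFunctionField W.1 (t i) ≠ 0)
    (hJ : ∀ i, (J i).ideal W = Ideal.span {t i}) (a : I → ℤ) (c : Y.functionField) :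
    c ∈ localSections J a W ↔
      c * ∏ i, Y.germToFunctionField W.1 (t i) ^ a i ∈ regular Y W.1 := by
  have h1 (i : I) : idealZpow (IsLocalization.coeSubmodule Y.functionField ((J i).ideal W)) (-a i) =
      Submodule.span Γ(Y, W.1) {Y.germToFunctionField W.1 (t i) ^ (-a i)} := by
    rw [hJ, IsLocalization.coeSubmodule_span, Set.image_singleton]
    exact idealZpow_span_singleton (ht i) _
  have hne : ∏ i, Y.germToFunctionField W.1 (t i) ^ a i ≠ 0 :=
    Finset.prod_ne_zero_iff.2 fun i _ => zpow_ne_zero _ (ht i)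
  unfold localSections
  simp only [h1, prod_span_singleton, zpow_neg, Finset.prod_inv_distrib]
  rw [Submodule.mem_span_singleton]
  constructor
  · rintro ⟨r, rfl⟩
    refine ⟨r, ?_⟩
    rw [Algebra.smul_def, inv_mul_cancel_right₀ hne]
    rfl
  · rintro ⟨r, hr⟩
    refine ⟨r, ?_⟩
    rw [Algebra.smul_def]
    exact (congrArg (· * _) hr).trans (mul_inv_cancel_right₀ hne c)

lemma mem_localSections_basicOpen (V : Y.affineOpens) [Nonempty V.1] (t : I → Γ(Y, V.1))
    (ht : ∀ i, Y.germToFunctionField V.1 (t i) ≠ 0)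
    (hJ : ∀ i, (J i).ideal V = Ideal.span {t i}) (a : I → ℤ) (c : Y.functionField)
    (s : Γ(Y, V.1)) [Nonempty (Y.basicOpen s)] [Nonempty (Y.affineBasicOpen s).1] :
    c ∈ localSections J a (Y.affineBasicOpen s) ↔ ∃ n : ℕ, Y.germToFunctionField V.1 s ^ n *
      (c * ∏ i, Y.germToFunctionField V.1 (t i) ^ a i) ∈ regular Y V.1 := by
  have h1 (i : I) : (J i).ideal (Y.affineBasicOpen s) =
      Ideal.span {Y.presheaf.map (homOfLE (Y.basicOpen_le s)).op (t i)} := by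
    rw [← (J i).map_ideal_basicOpen V s, hJ, Ideal.map_span, Set.image_singleton]
  have h2 (i : I) : Y.germToFunctionField (Y.affineBasicOpen s).1
      (Y.presheaf.map (homOfLE (Y.basicOpen_le s)).op (t i)) = Y.germToFunctionField V.1 (t i) :=
    germToFunctionField_res _ _
  rw [mem_localSections_of_principal J (Y.affineBasicOpen s)
    (fun i => Y.presheaf.map (homOfLE (Y.basicOpen_le s)).op (t i))
    (fun i => by rw [h2]; exact ht i) h1]
  simp only [h2]
  exact mem_regular_basicOpen V.2 s _

lemma mem_localSections_of_cover (W : Y.affineOpens) [Nonempty W.1] (a : I → ℤ)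
    (c : Y.functionField)
    (h : ∀ y ∈ W.1, ∃ (s : Γ(Y, W.1)) (_ : Nonempty (Y.affineBasicOpen s).1), y ∈ Y.basicOpen s ∧
      (∀ i, ((J i).ideal (Y.affineBasicOpen s)).FG) ∧
      c ∈ localSections J a (Y.affineBasicOpen s)) :
    c ∈ localSections J a W := by
  have hfg (i : I) : ((J i).ideal W).FG := ideal_fg_of_cover W (J i) fun y hy => by
    obtain ⟨s, _, h1, h2, -⟩ := h y hy
    exact ⟨s, h1, h2 i⟩
  -- the ideal of denominators of `c`
  let 𝔞 : Ideal Γ(Y, W.1) :=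
    { carrier := {r | algebraMap _ Y.functionField r * c ∈ localSections J a W}
      zero_mem' := by simp
      add_mem' := fun {r r'} hr hr' => by
        change algebraMap _ Y.functionField (r + r') * c ∈ localSections J a W
        rw [map_add, add_mul]
        exact add_mem hr hr'
      smul_mem' := fun r r' hr' => by
        change algebraMap _ Y.functionField (r * r') * c ∈ localSections J a W
        rw [map_mul, mul_assoc, ← Algebra.smul_def]
        exact Submodule.smul_mem _ r hr' }
  have key : ∀ y ∈ W.1, ∃ s ∈ 𝔞, y ∈ Y.basicOpen s := by
    intro y hy
    obtain ⟨s, hne, hys, -, hc⟩ := h y hy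
    have : Nonempty (Y.basicOpen s) := hne
    let W' := Y.affineBasicOpen s
    let _ : Algebra Γ(Y, W.1) Γ(Y, W'.1) :=
      (Y.presheaf.map (homOfLE (Y.basicOpen_le s)).op).hom.toAlgebra
    have : IsScalarTower Γ(Y, W.1) Γ(Y, W'.1) Y.functionField := IsScalarTower.of_algebraMap_eq
      fun x => (germToFunctionField_res (Y.basicOpen_le s) x).symm
    have h1 : LocLE s (1 : Submodule Γ(Y, W.1) Y.functionField)
        (1 : Submodule Γ(Y, W'.1) Y.functionField) := by
      intro x hx
      obtain ⟨n, hn⟩ := (mem_regular_basicOpen W.2 s x).1 ((mem_one_iff_mem_regular W'.1 x).1 hx)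
      exact ⟨n, (mem_one_iff_mem_regular W.1 _).2 hn⟩
    have hmap (i : I) : ((J i).ideal W).map (algebraMap Γ(Y, W.1) Γ(Y, W'.1)) = (J i).ideal W' :=
      (J i).map_ideal_basicOpen W s
    have h2 : LocLE s (localSections J a W) (localSections J a W') := by
      refine LocLE.prod _ _ _ h1 fun i _ => LocLE.idealZpow h1 ?_ ?_ ?_ _
      · exact Submodule.FG.map _ (hfg i)
      · rintro _ ⟨x, hx, rfl⟩
        refine (IsLocalization.mem_coeSubmodule _ _).2 ⟨algebraMap _ _ x, ?_, ?_⟩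
        · rw [← hmap]
          exact Ideal.mem_map_of_mem _ hx
        · exact (IsScalarTower.algebraMap_apply _ _ _ x).symm
      · rw [← hmap]
        exact LocLE.coeSubmodule h1 _
    obtain ⟨n, hn⟩ := h2 c hc
    refine ⟨s ^ (n + 1), ?_, ?_⟩
    · change algebraMap _ Y.functionField (s ^ (n + 1)) * c ∈ localSections J a W
      rw [map_pow]
      exact pow_mul_mem_of_le s _ (Nat.le_succ n) hn
    · rwa [Y.basicOpen_pow s (Nat.succ_pos n)]
  have htop : 𝔞 = ⊤ := by
    have h3 : Ideal.span (𝔞 : Set Γ(Y, W.1)) = ⊤ := by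
      rw [← W.2.self_le_iSup_basicOpen_iff]
      intro y hy
      obtain ⟨s, hs, hys⟩ := key y hy
      exact TopologicalSpace.Opens.mem_iSup.2 ⟨⟨s, hs⟩, hys⟩
    rwa [Ideal.span_eq] at h3
  have h4 : (1 : Γ(Y, W.1)) ∈ 𝔞 := htop ▸ Submodule.mem_top
  change algebraMap _ Y.functionField 1 * c ∈ localSections J a W at h4
  rwa [map_one, one_mul] at h4

lemma localSections_congr {W W' : Y.affineOpens} [Nonempty W.1] [Nonempty W'.1] (h : W = W')
    (a : I → ℤ) {c : Y.functionField} (hc : c ∈ localSections J a W') :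
    c ∈ localSections J a W := by
  subst h
  exact hc

/-- Sections of `∑ a i E i` over `U`, tested on the basic open subsets of charts on which the divisors
`E i` have equations `t j i`. -/
lemma mem_divisorSections_iff {ι : Type*} (V : ι → Y.affineOpens) [∀ j, Nonempty (V j).1]
    (hcov : ∀ y, ∃ j, y ∈ (V j).1) (t : ∀ j, I → Γ(Y, (V j).1)) (ht : ∀ j i, t j i ≠ 0)
    (hJ : ∀ j i, (J i).ideal (V j) = Ideal.span {t j i}) (a : I → ℤ) (U : Y.Opens)
    (c : Y.functionField) :
    c ∈ divisorSections J a U ↔ ∀ (j : ι) (s : Γ(Y, (V j).1)), s ≠ 0 → Y.basicOpen s ≤ U →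
      ∃ n : ℕ, Y.germToFunctionField (V j).1 s ^ n *
        (c * ∏ i, Y.germToFunctionField (V j).1 (t j i) ^ a i) ∈ regular Y (V j).1 := by
  have ht' (j : ι) (i : I) : Y.germToFunctionField (V j).1 (t j i) ≠ 0 := by
    rw [Ne, map_eq_zero_iff _ (Y.germToFunctionField_injective _)]
    exact ht j i
  constructor
  · intro h j s hs hU
    have := nonempty_basicOpen hs
    have : Nonempty (Y.affineBasicOpen s).1 := this
    exact (mem_localSections_basicOpen J (V j) (t j) (ht' j) (hJ j) a c s).1
      (h (Y.affineBasicOpen s) hU)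
  · intro h W _ hWU
    refine mem_localSections_of_cover J W a c fun y hy => ?_
    obtain ⟨j, hj⟩ := hcov y
    obtain ⟨s, r, hsr, hys⟩ := exists_basicOpen_le_affine_inter W.2 (V j).2 y ⟨hy, hj⟩
    have hsr' : Y.affineBasicOpen s = Y.affineBasicOpen r := Subtype.ext hsr
    have hne : Nonempty (Y.affineBasicOpen s).1 := ⟨⟨y, hys⟩⟩
    have hne' : Nonempty (Y.affineBasicOpen r).1 := ⟨⟨y, by rw [← hsr']; exact hys⟩⟩
    have hne'' : Nonempty (Y.basicOpen r) := hne'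
    refine ⟨s, hne, hys, fun i => ?_, ?_⟩
    · rw [hsr', ← (J i).map_ideal_basicOpen (V j) r, hJ]
      exact Ideal.FG.map ⟨{t j i}, by simp⟩ _
    · have hr : r ≠ 0 := by
        rintro rfl
        simp at hne''
      have := (mem_localSections_basicOpen J (V j) (t j) (ht' j) (hJ j) a c r).2
        (h j r hr (by rw [← hsr]; exact (Y.basicOpen_le s).trans hWU))
      exact localSections_congr J hsr' a this

end localSections

/-! ### Torus torsors and their multisections -/

section atlas
variable {Y B : Scheme.{u}} [AlgebraicGeometry.IsIntegral Y] [AlgebraicGeometry.IsIntegral B]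
  {I : Type u} [Fintype I] {Λ : Type u} [AddCommGroup Λ]

/-- The map `K(Y)[Λ] → K(B)` given by a dominant morphism `p : B ⟶ Y` and `z ^ m ↦ χ m`. -/
def laurentMap (p : B ⟶ Y) (hp : ∀ U : Y.Opens, Nonempty U → Nonempty (p ⁻¹ᵁ U))
    (χ : Multiplicative Λ →* B.functionField) :
    AddMonoidAlgebra Y.functionField Λ →+* B.functionField :=
  AddMonoidAlgebra.liftNCRingHom (functionFieldMap p hp) χ (fun _ _ => Commute.all _ _)

/-- An atlas of a torsor `p : B ⟶ Y` under the torus with character lattice `Λ`: there are rational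
functions `χ m` on `B` for `m ∈ Λ` and affine charts `V j` of `Y`, on which the divisors `E i` have
equations `t j i`, such that the functions on `p ⁻¹ (V j)` are the Laurent polynomials over `V j` in
the monomials `χ m * ∏ t j i ^ (-w m i)`. -/
structure TorsorAtlas (p : B ⟶ Y) (J : I → Y.IdealSheafData) (w : Λ →+ (I → ℤ)) where
  ι : Type u
  V : ι → Y.affineOpens
  nonempty : ∀ j, Nonempty (V j).1
  cover : ∀ y, ∃ j, y ∈ (V j).1
  affine_preimage : ∀ j, IsAffineOpen (p ⁻¹ᵁ (V j).1)
  t : ∀ j, I → Γ(Y, (V j).1)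
  t_ne_zero : ∀ j i, t j i ≠ 0
  ideal_eq : ∀ j i, (J i).ideal (V j) = Ideal.span {t j i}
  dominant : ∀ U : Y.Opens, Nonempty U → Nonempty (p ⁻¹ᵁ U)
  χ : Multiplicative Λ →* B.functionField
  injective : Function.Injective (laurentMap p dominant χ)
  mem_regular : ∀ (j : ι) [Nonempty (p ⁻¹ᵁ (V j).1)] (F : B.functionField),
    F ∈ regular B (p ⁻¹ᵁ (V j).1) ↔ ∃ x, laurentMap p dominant χ x = F ∧
      ∀ m, x.coeff m * ∏ i, Y.germToFunctionField (V j).1 (t j i) ^ w m i ∈ regular Y (V j).1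

namespace TorsorAtlas
variable {p : B ⟶ Y} {J : I → Y.IdealSheafData} {w : Λ →+ (I → ℤ)} (A : TorsorAtlas p J w)
attribute [instance] TorsorAtlas.nonempty

/-- The inclusion of `K(Y)[Λ]` in `K(B)`. -/
abbrev Ψ : AddMonoidAlgebra Y.functionField Λ →+* B.functionField :=
  laurentMap p A.dominant A.χ

lemma Ψ_single (m : Λ) (c : Y.functionField) :
    A.Ψ (.single m c) = functionFieldMap p A.dominant c * A.χ (Multiplicative.ofAdd m) :=
  AddMonoidAlgebra.liftNC_single _ _ _ _

lemma Ψ_smul (c : Y.functionField) (x : AddMonoidAlgebra Y.functionField Λ) :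
    A.Ψ (c • x) = functionFieldMap p A.dominant c * A.Ψ x :=
  AddMonoidAlgebra.liftNC_smul _ _ _ _

lemma mem_regular_preimage_basicOpen (j : A.ι) (s : Γ(Y, (A.V j).1)) [Nonempty (p ⁻¹ᵁ (A.V j).1)]
    [Nonempty (p ⁻¹ᵁ Y.basicOpen s)] (F : B.functionField) :
    F ∈ regular B (p ⁻¹ᵁ Y.basicOpen s) ↔ ∃ n : ℕ,
      functionFieldMap p A.dominant (Y.germToFunctionField (A.V j).1 s) ^ n * F ∈
        regular B (p ⁻¹ᵁ (A.V j).1) := by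
  have h : p ⁻¹ᵁ Y.basicOpen s = B.basicOpen (p.app _ s) := p.preimage_basicOpen s
  have : Nonempty (B.basicOpen (p.app _ s)) := by rw [← h]; infer_instance
  rw [regular_congr h, mem_regular_basicOpen (A.affine_preimage j), functionFieldMap_germ]

/-- Functions on the preimage of a basic open subset of a chart. -/
lemma mem_regular_preimage_basicOpen' (j : A.ι) (s : Γ(Y, (A.V j).1)) (hs : s ≠ 0)
    [Nonempty (p ⁻¹ᵁ Y.basicOpen s)] (F : B.functionField) :
    F ∈ regular B (p ⁻¹ᵁ Y.basicOpen s) ↔ ∃ x, A.Ψ x = F ∧ ∀ m, ∃ n : ℕ,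
      Y.germToFunctionField (A.V j).1 s ^ n *
        (x.coeff m * ∏ i, Y.germToFunctionField (A.V j).1 (A.t j i) ^ w m i) ∈
        regular Y (A.V j).1 := by
  have := A.dominant (A.V j).1 inferInstance
  set σ := functionFieldMap p A.dominant
  set c := Y.germToFunctionField (A.V j).1 s with hc
  have hc0 : c ≠ 0 := by
    rwa [hc, Ne, map_eq_zero_iff _ (Y.germToFunctionField_injective _)]
  rw [A.mem_regular_preimage_basicOpen]
  constructor
  · rintro ⟨n, hn⟩
    obtain ⟨x, hx, hxm⟩ := (A.mem_regular j _).1 hn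
    have hσ : σ c ^ n ≠ 0 := pow_ne_zero _ ((map_ne_zero σ).2 hc0)
    refine ⟨(c ^ n)⁻¹ • x, ?_, fun m => ⟨n, ?_⟩⟩
    · rw [Ψ_smul, hx, map_inv₀, map_pow, inv_mul_cancel_left₀ hσ]
    · rw [AddMonoidAlgebra.coeff_smul_apply, smul_eq_mul, ← mul_assoc, ← mul_assoc,
        mul_inv_cancel₀ (pow_ne_zero _ hc0), one_mul]
      exact hxm m
  · rintro ⟨x, rfl, hx⟩
    obtain ⟨n, hn⟩ := exists_uniform_pow x.coeff.support s
      (1 : Submodule Γ(Y, (A.V j).1) Y.functionField)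
      (fun m => x.coeff m * ∏ i, Y.germToFunctionField (A.V j).1 (A.t j i) ^ w m i)
      (fun m _ => by
        obtain ⟨n, hn⟩ := hx m
        exact ⟨n, (mem_one_iff_mem_regular _ _).2 hn⟩)
    refine ⟨n, (A.mem_regular j _).2 ⟨c ^ n • x, ?_, fun m => ?_⟩⟩
    · exact (A.Ψ_smul _ _).trans (by rw [map_pow])
    rw [AddMonoidAlgebra.coeff_smul_apply, smul_eq_mul, mul_assoc]
    by_cases hm : m ∈ x.coeff.support
    · exact (mem_one_iff_mem_regular _ _).1 (hn m hm)
    · rw [Finsupp.notMem_support_iff.1 hm, zero_mul, mul_zero]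
      exact zero_mem _

lemma exists_basicOpen_le (U : Y.Opens) (y : Y) (hy : y ∈ U) :
    ∃ (j : A.ι) (s : Γ(Y, (A.V j).1)), s ≠ 0 ∧ Y.basicOpen s ≤ U ∧ y ∈ Y.basicOpen s := by
  obtain ⟨j, hj⟩ := A.cover y
  obtain ⟨s, hs, hys⟩ := (A.V j).2.exists_basicOpen_le ⟨y, hy⟩ hj
  refine ⟨j, s, ?_, hs, hys⟩
  rintro rfl
  simp at hys

lemma mem_divisorSections (m : Λ) (U : Y.Opens) (c : Y.functionField) :
    c ∈ divisorSections J (w m) U ↔ ∀ (j : A.ι) (s : Γ(Y, (A.V j).1)), s ≠ 0 →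
      Y.basicOpen s ≤ U → ∃ n : ℕ, Y.germToFunctionField (A.V j).1 s ^ n *
        (c * ∏ i, Y.germToFunctionField (A.V j).1 (A.t j i) ^ w m i) ∈ regular Y (A.V j).1 :=
  mem_divisorSections_iff J A.V A.cover A.t A.t_ne_zero A.ideal_eq (w m) U c

/-- The functions on `p ⁻¹ U` are the multisections over `U`. -/
theorem mem_regular_preimage (U : Y.Opens) [Nonempty U] [Nonempty (p ⁻¹ᵁ U)]
    (F : B.functionField) :
    F ∈ regular B (p ⁻¹ᵁ U) ↔ ∃ x ∈ multisections J w U, A.Ψ x = F := by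
  constructor
  · intro hF
    have key (j : A.ι) (s : Γ(Y, (A.V j).1)) (hs : s ≠ 0) (hU : Y.basicOpen s ≤ U) :
        ∃ x, A.Ψ x = F ∧ ∀ m, ∃ n : ℕ, Y.germToFunctionField (A.V j).1 s ^ n *
          (x.coeff m * ∏ i, Y.germToFunctionField (A.V j).1 (A.t j i) ^ w m i) ∈
          regular Y (A.V j).1 := by
      have := A.dominant _ (nonempty_basicOpen hs)
      exact (A.mem_regular_preimage_basicOpen' j s hs F).1
        (regular_mono (fun b hb => hU hb : p ⁻¹ᵁ Y.basicOpen s ≤ p ⁻¹ᵁ U) hF)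
    obtain ⟨⟨y, hy⟩⟩ := ‹Nonempty U›
    obtain ⟨j, s, hs, hU, -⟩ := A.exists_basicOpen_le U y hy
    obtain ⟨x, hx, -⟩ := key j s hs hU
    refine ⟨x, fun m => (A.mem_divisorSections m U _).2 fun j s hs hU => ?_, hx⟩
    obtain ⟨x', hx', h⟩ := key j s hs hU
    rw [A.injective (hx.trans hx'.symm)]
    exact h m
  · rintro ⟨x, hx, rfl⟩
    refine mem_regular_of_cover fun b hb => ?_
    obtain ⟨j, s, hs, hU, hys⟩ := A.exists_basicOpen_le U (p b) hb
    have := A.dominant _ (nonempty_basicOpen hs)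
    exact ⟨p ⁻¹ᵁ Y.basicOpen s, this, hys, fun b hb => hU hb,
      (A.mem_regular_preimage_basicOpen' j s hs _).2
        ⟨x, rfl, fun m => (A.mem_divisorSections m U _).1 (hx m) j s hs hU⟩⟩

lemma exists_iso (U : Y.Opens) [Nonempty U] [Nonempty (p ⁻¹ᵁ U)] :
    ∃ e : multisections J w U ≃+* Γ(B, p ⁻¹ᵁ U),
      ∀ s, B.germToFunctionField (p ⁻¹ᵁ U) (e s) = A.Ψ s.1 := by
  have hinj := B.germToFunctionField_injective (p ⁻¹ᵁ U)
  have h (s : multisections J w U) :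
      ∃ f : Γ(B, p ⁻¹ᵁ U), B.germToFunctionField (p ⁻¹ᵁ U) f = A.Ψ s.1 :=
    (A.mem_regular_preimage U _).2 ⟨s.1, s.2, rfl⟩
  choose e he using h
  let e' : multisections J w U →+* Γ(B, p ⁻¹ᵁ U) :=
    { toFun := e
      map_one' := hinj (by rw [he, map_one]; exact map_one A.Ψ)
      map_zero' := hinj (by rw [he, map_zero]; exact map_zero A.Ψ)
      map_add' := fun s s' => hinj (by
        rw [map_add, he, he, he]
        exact map_add A.Ψ _ _)
      map_mul' := fun s s' => hinj (by
        rw [map_mul, he, he, he]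
        exact map_mul A.Ψ _ _) }
  refine ⟨RingEquiv.ofBijective e' ⟨fun s s' hs => ?_, fun f => ?_⟩, he⟩
  · have h2 : e s = e s' := hs
    exact Subtype.ext (A.injective (by rw [← he, ← he, h2]))
  · obtain ⟨x, hx, hxf⟩ := (A.mem_regular_preimage U _).1 (germ_mem_regular _ f)
    exact ⟨⟨x, hx⟩, hinj ((he ⟨x, hx⟩).trans hxf)⟩

/-- The isomorphism from the multisections over `U` to the functions on `p ⁻¹ U`. -/
def iso (U : Y.Opens) [Nonempty U] : multisections J w U ≃+* Γ(B, p ⁻¹ᵁ U) :=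
  have := A.dominant U ‹_›
  (A.exists_iso U).choose

lemma germ_iso (U : Y.Opens) [Nonempty U] [Nonempty (p ⁻¹ᵁ U)] (s : multisections J w U) :
    B.germToFunctionField (p ⁻¹ᵁ U) (A.iso U s) = A.Ψ s.1 :=
  (A.exists_iso U).choose_spec s

lemma iso_naturality (U U' : Y.Opens) [Nonempty U] [Nonempty U'] (h : U ≤ U')
    (s : multisections J w U') :
    A.iso U (Subring.inclusion (multisections_mono J w h) s) =
      B.presheaf.map (homOfLE (fun _ hx => h hx : p ⁻¹ᵁ U ≤ p ⁻¹ᵁ U')).op (A.iso U' s) := by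
  have := A.dominant U ‹_›
  have := A.dominant U' ‹_›
  apply B.germToFunctionField_injective (p ⁻¹ᵁ U)
  rw [A.germ_iso]
  exact (A.germ_iso U' s).symm.trans (germToFunctionField_res
    (fun _ hx => h hx : p ⁻¹ᵁ U ≤ p ⁻¹ᵁ U') _).symm

lemma iso_algebra (U : Y.Opens) [Nonempty U] (f : Γ(Y, U)) :
    A.iso U (structureHom J w U f) = p.app U f := by
  have := A.dominant U ‹_›
  apply B.germToFunctionField_injective (p ⁻¹ᵁ U)
  rw [A.germ_iso, ← functionFieldMap_germ p A.dominant]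
  refine (A.Ψ_single 0 _).trans ?_
  rw [ofAdd_zero, map_one, mul_one]

end TorsorAtlas

end atlas

/-! ### Coordinate rings of charts -/

/-- A principal ideal `(t)` is prime if it is the kernel of a ring endomorphism of a domain that is
congruent to the identity modulo `t`. -/
lemma span_isPrime_of_retraction {R : Type*} [CommRing R] [IsDomain R] (t : R) (π : R →+* R)
    (ht : π t = 0) (h : (Ideal.Quotient.mk (Ideal.span {t})).comp π = Ideal.Quotient.mk _) :
    (Ideal.span {t}).IsPrime := by
  have hker : Ideal.span {t} = RingHom.ker π := by
    refine le_antisymm ?_ fun x hx => ?_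
    · rw [Ideal.span_le, Set.singleton_subset_iff]
      exact ht
    · rw [← Ideal.Quotient.eq_zero_iff_mem, ← h, RingHom.comp_apply, RingHom.mem_ker.1 hx, map_zero]
  rw [hker]
  exact RingHom.ker_isPrime π

/-- The endomorphism `z ^ v ↦ c v * z ^ (v - r v)` of the monoid algebra of a submonoid of `P`. -/
def twistHom {P : Type u} [AddCommGroup P] (k : Type u) [Field k] (M : AddSubmonoid P) (r : P →+ P)
    (hr : ∀ v ∈ M, v - r v ∈ M) (c : Multiplicative P →* k) :
    AddMonoidAlgebra k M →ₐ[k] AddMonoidAlgebra k M :=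
  AddMonoidAlgebra.lift k _ M
    { toFun := fun v => .single ⟨v.toAdd - r v.toAdd, hr _ v.toAdd.2⟩
        (c (Multiplicative.ofAdd (v.toAdd : P)))
      map_one' := by
        simp only [toAdd_one, ZeroMemClass.coe_zero, map_zero, sub_zero, ofAdd_zero, map_one]
        rfl
      map_mul' := fun v w => by
        rw [AddMonoidAlgebra.single_mul_single]
        congr 1
        · refine Subtype.ext ?_
          simp only [toAdd_mul, AddMemClass.mk_add_mk, AddSubmonoid.coe_add, map_add]
          abel
        · simp }

lemma twistHom_single {P : Type u} [AddCommGroup P] (k : Type u) [Field k] (M : AddSubmonoid P)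
    (r : P →+ P) (hr : ∀ v ∈ M, v - r v ∈ M) (c : Multiplicative P →* k) (v : M) (a : k) :
    twistHom k M r hr c (.single v a) =
      .single ⟨v - r v, hr _ v.2⟩ (a * c (Multiplicative.ofAdd (v : P))) := by
  simp [twistHom]

namespace MutationDatum
variable {P I : Type u} [AddCommGroup P] (D : MutationDatum P I) (k : Type u) [Field k]

/-- Monomials `v i` of order one along the divisor of each frozen index `i`. -/
structure Uniformizer where
  v : I → P
  u_v : ∀ i ∈ D.F, D.u i (v i) = 1

variable {D} (n : D.Uniformizer)

open scoped Classical in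
/-- The equation on the chart `j` of the complement of the central torus: `1 + z ^ (ψ i)` for an unfrozen
and `z ^ (v i)` for a frozen index `i`. -/
def eqn : (j : Option I) → D.ChartRing k j
  | none => 1
  | some i => if h : i ∈ D.F then .single ⟨n.v i, fun _ => by rw [n.u_v i h]; exact zero_le_one⟩ 1
      else 1 + .single ⟨D.ψ i, fun h' => absurd h' h⟩ 1

lemma eqn_frozen {i : I} (h : i ∈ D.F) : eqn k n (some i) =
    .single ⟨n.v i, fun _ => by rw [n.u_v i h]; exact zero_le_one⟩ 1 := dif_pos h

lemma eqn_unfrozen {i : I} (h : i ∉ D.F) : eqn k n (some i) =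
    1 + .single ⟨D.ψ i, fun h' => absurd h' h⟩ 1 := dif_neg h

variable (D) in
lemma chartIncl_single (j : Option I) (v : D.mon j) (r : k) :
    D.chartIncl k j (.single v r) = .single (v : P) r := by
  simp [chartIncl]

variable (D) in
lemma chartIncl_injective (j : Option I) : Function.Injective (D.chartIncl k j) :=
  AddMonoidAlgebra.mapDomain_injective Subtype.val_injective

variable (D) in
lemma den_frozen {i : I} (h : i ∈ D.F) : D.den k (some i) = 1 := if_pos h

variable (D) in
lemma den_unfrozen {i : I} (h : i ∉ D.F) : D.den k (some i) = 1 + .single (D.ψ i) 1 := if_neg h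

lemma chartIncl_eqn_unfrozen {i : I} (h : i ∉ D.F) :
    D.chartIncl k (some i) (eqn k n (some i)) = D.den k (some i) := by
  rw [eqn_unfrozen k n h, den_unfrozen D k h, map_add, map_one, chartIncl_single]

variable (D) in
lemma mutation_apply (j : Option I) (x : D.ChartRing k j) :
    D.mutation k j x = D.extEquiv k j (algebraMap _ _ (D.chartIncl k j x)) :=
  (D.extHom_algebraMap k (-1) j _).symm

variable (D) in
lemma mutation_single (j : Option I) (v : D.mon j) :
    D.mutation k j (.single v 1) = algebraMap _ _ (AddMonoidAlgebra.single (v : P) (1 : k)) *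
      ((D.denUnit k j ^ (-D.wt j v) : (D.OverlapRing k j)ˣ) : D.OverlapRing k j) := by
  rw [mutation, AlgHom.comp_apply, chartIncl_single, mutHom_single, neg_one_mul]

variable (D) in
/-- The function `den j` comes from the chart. -/
lemma exists_chartIncl_eq_den (j : Option I) : ∃ x, D.chartIncl k j x = D.den k j ∧
    (x = 1 ∨ ∀ n : D.Uniformizer, x = eqn k n j) := by
  rcases j with _ | i
  · exact ⟨1, map_one _, Or.inl rfl⟩
  · by_cases h : i ∈ D.F
    · exact ⟨1, by rw [map_one, den_frozen D k h], Or.inl rfl⟩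
    · refine ⟨1 + .single ⟨D.ψ i, fun h' => absurd h' h⟩ 1, ?_, Or.inr fun n =>
        (eqn_unfrozen k n h).symm⟩
      rw [den_unfrozen D k h, map_add, map_one, chartIncl_single]

lemma isUnit_chartIncl_eqn (j : Option I) :
    IsUnit (algebraMap _ (D.OverlapRing k j) (D.chartIncl k j (eqn k n j))) := by
  rcases j with _ | i
  · simp [eqn]
  · by_cases h : i ∈ D.F
    · rw [eqn_frozen k n h, chartIncl_single]
      refine IsUnit.map _ (IsUnit.of_mul_eq_one (.single (-n.v i) 1) ?_)
      simp [AddMonoidAlgebra.single_mul_single, AddMonoidAlgebra.one_def]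
    · rw [chartIncl_eqn_unfrozen k n h]
      exact IsLocalization.Away.algebraMap_isUnit _

lemma exists_mul_chartIncl_eqn_pow (j : Option I) (x : AddMonoidAlgebra k P) :
    ∃ (m : ℕ) (a : D.ChartRing k j), x * D.chartIncl k j (eqn k n j) ^ m = D.chartIncl k j a := by
  induction x using AddMonoidAlgebra.induction_linear with
  | zero => exact ⟨0, 0, by simp⟩
  | add x y hx hy =>
    obtain ⟨m, a, ha⟩ := hx
    obtain ⟨m', b, hb⟩ := hy
    refine ⟨m + m', a * eqn k n j ^ m' + b * eqn k n j ^ m, ?_⟩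
    rw [map_add, map_mul, map_mul, ← ha, ← hb, map_pow, map_pow]
    ring
  | single v r =>
    rcases j with _ | i
    · exact ⟨0, .single ⟨v, trivial⟩ r, by rw [chartIncl_single, pow_zero, mul_one]⟩
    · by_cases h : i ∈ D.F
      · refine ⟨(D.u i v).natAbs, .single ⟨v + (D.u i v).natAbs • n.v i, fun _ => ?_⟩ r, ?_⟩
        · rw [map_add, map_nsmul, n.u_v i h, nsmul_eq_mul, mul_one]
          omega
        · rw [eqn_frozen k n h, chartIncl_single, chartIncl_single, AddMonoidAlgebra.single_pow,
            AddMonoidAlgebra.single_mul_single, one_pow, mul_one]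
      · exact ⟨0, .single ⟨v, fun h' => absurd h' h⟩ r, by
          rw [chartIncl_single, pow_zero, mul_one]⟩

/-- The overlap with the central torus is the locus in the chart where `eqn` does not vanish. -/
lemma mutation_away (j : Option I) :
    letI := (D.mutation k j).toRingHom.toAlgebra
    IsLocalization.Away (eqn k n j) (D.OverlapRing k j) := by
  let _ := (D.mutation k j).toRingHom.toAlgebra
  have hmut (x : D.ChartRing k j) : algebraMap (D.ChartRing k j) (D.OverlapRing k j) x =
      D.extEquiv k j (algebraMap _ _ (D.chartIncl k j x)) := D.mutation_apply k j x
  obtain ⟨d, hd, hd'⟩ := D.exists_chartIncl_eq_den k j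
  refine IsLocalization.Away.mk _ ?_ (fun F => ?_) (fun a b h => ?_)
  · rw [hmut]
    exact (isUnit_chartIncl_eqn k n j).map _
  · obtain ⟨m, y, hy⟩ := IsLocalization.Away.surj (D.den k j) ((D.extEquiv k j).symm F)
    obtain ⟨m', a, ha⟩ := exists_mul_chartIncl_eqn_pow k n j y
    rcases hd' with rfl | hd'
    · refine ⟨m', a, ?_⟩
      have h1 : algebraMap _ (D.OverlapRing k j) (D.den k j) = 1 := by
        rw [← map_one (algebraMap (AddMonoidAlgebra k P) (D.OverlapRing k j)),
          ← map_one (D.chartIncl k j)]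
        exact congrArg _ hd.symm
      rw [hmut, hmut, ← ha, map_mul, map_mul, map_pow, map_pow, ← hy, h1, one_pow, mul_one,
        RingEquiv.apply_symm_apply]
    · refine ⟨m + m', a, ?_⟩
      have h1 : algebraMap _ (D.OverlapRing k j) (D.chartIncl k j (eqn k n j)) =
          algebraMap _ _ (D.den k j) := congrArg _ (by rw [← hd' n, hd])
      rw [hmut, hmut, ← ha, map_mul, map_mul, map_pow, map_pow, ← hy, pow_add, map_mul, h1,
        map_pow, RingEquiv.apply_symm_apply]
      ring
  · rw [hmut, hmut] at h
    obtain ⟨m, hm⟩ := (IsLocalization.Away.exists_of_eq (D.den k j)) ((D.extEquiv k j).injective h)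
    rw [← hd, ← map_pow, ← map_mul, ← map_mul] at hm
    have hm := D.chartIncl_injective k j hm
    rcases hd' with rfl | hd'
    · exact ⟨0, by simpa using hm⟩
    · exact ⟨m, by rwa [hd' n] at hm⟩

lemma eqn_ne_zero (hψ : ∀ i ∉ D.F, D.ψ i ≠ 0) (j : Option I) : eqn k n j ≠ 0 := by
  classical
  rcases j with _ | i
  · exact one_ne_zero
  · by_cases h : i ∈ D.F
    · rw [eqn_frozen k n h]
      simp
    · rw [eqn_unfrozen k n h]
      intro h0
      have h1 := congrArg (fun x => x.coeff 0) h0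
      have h2 : (⟨D.ψ i, fun h' => absurd h' h⟩ : D.mon (some i)) ≠ 0 := fun e =>
        hψ i h (congrArg Subtype.val e)
      simp [AddMonoidAlgebra.one_def, h2] at h1

section domain
variable [TwoUniqueSums P]

instance (j : Option I) : IsDomain (D.ChartRing k j) := by
  have : TwoUniqueSums (D.mon j) := TwoUniqueSums.of_injective_addHom
    ((D.mon j).subtype : D.mon j →ₙ+ P) Subtype.val_injective inferInstance
  have : NoZeroDivisors (D.ChartRing k j) := inferInstance
  exact NoZeroDivisors.to_isDomain _

/-- The equation of the divisor of `i` generates a prime ideal, if `ψ i` is a primitive vector. -/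
lemma span_eqn_isPrime (i : I) (hℓ : i ∉ D.F → ∃ ℓ : P →+ ℤ, ℓ (D.ψ i) = 1) :
    (Ideal.span {eqn k n (some i)}).IsPrime := by
  classical
  by_cases h : i ∈ D.F
  · let π : D.ChartRing k (some i) →ₐ[k] D.ChartRing k (some i) := AddMonoidAlgebra.lift k _ _
      { toFun := fun v => if D.u i (v.toAdd : P) = 0 then .single v.toAdd 1 else 0
        map_one' := by
          rw [if_pos (by simp)]
          rfl
        map_mul' := fun v w => by
          have hv : 0 ≤ D.u i (v.toAdd : P) := v.toAdd.2 h
          have hw : 0 ≤ D.u i (w.toAdd : P) := w.toAdd.2 h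
          by_cases h1 : D.u i (v.toAdd : P) = 0 <;> by_cases h2 : D.u i (w.toAdd : P) = 0
          · rw [if_pos h1, if_pos h2, if_pos (by simp [h1, h2])]
            simp [AddMonoidAlgebra.single_mul_single]
          all_goals
            rw [if_neg (by simp; omega)]
            simp [h1, h2] }
    have hπ (v : D.mon (some i)) : π (.single v 1) =
        if D.u i (v : P) = 0 then .single v 1 else 0 := by simp [π]
    refine span_isPrime_of_retraction _ π.toRingHom ?_ ?_
    · rw [eqn_frozen k n h]
      refine (hπ _).trans (if_neg ?_)
      rw [n.u_v i h]
      exact one_ne_zero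
    · refine AddMonoidAlgebra.ringHom_ext (fun r => ?_) fun v => ?_
      · have : π (.single 0 r) = .single 0 r := π.commutes r
        exact congrArg _ this
      · refine (congrArg _ (hπ v)).trans ?_
        split_ifs with hv
        · rfl
        · have h0 : 0 ≤ D.u i (v : P) := v.2 h
          refine (map_zero (Ideal.Quotient.mk _)).trans ?_
          rw [eq_comm, Ideal.Quotient.eq_zero_iff_mem, Ideal.mem_span_singleton,
            eqn_frozen k n h]
          refine ⟨.single ⟨v - n.v i, fun _ => ?_⟩ 1, ?_⟩
          · rw [map_sub, n.u_v i h]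
            omega
          · rw [AddMonoidAlgebra.single_mul_single, mul_one]
            congr 1
            exact Subtype.ext (by simp)
  · obtain ⟨ℓ, hℓ⟩ := hℓ h
    have hmem (v : P) : v ∈ D.mon (some i) := fun h' => absurd h' h
    let r : P →+ P := ((smulAddHom ℤ P).flip (D.ψ i)).comp ℓ
    have hr (v : P) : r v = ℓ v • D.ψ i := rfl
    let c : Multiplicative P →* k :=
      { toFun := fun v => (((-1 : kˣ) ^ (ℓ v.toAdd) : kˣ) : k)
        map_one' := by simp
        map_mul' := fun v w => by rw [toAdd_mul, map_add, zpow_add, Units.val_mul] }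
    let π := twistHom k (D.mon (some i)) r (fun _ _ => hmem _) c
    refine span_isPrime_of_retraction _ π.toRingHom ?_ ?_
    · rw [eqn_unfrozen k n h, map_add, map_one]
      have : π (.single ⟨D.ψ i, hmem _⟩ 1) = -1 := by
        refine (twistHom_single _ _ _ _ _ _ _).trans ?_
        have h1 : (⟨D.ψ i - r (D.ψ i), hmem _⟩ : D.mon (some i)) = 0 :=
          Subtype.ext (by simp [hr, hℓ])
        have h2 : c (Multiplicative.ofAdd (D.ψ i)) = -1 := by simp [c, hℓ]
        change AddMonoidAlgebra.single (⟨D.ψ i - r (D.ψ i), hmem _⟩ : D.mon (some i))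
          (1 * c (Multiplicative.ofAdd (D.ψ i))) = _
        rw [h1, h2, one_mul, AddMonoidAlgebra.one_def, ← AddMonoidAlgebra.single_neg]
      exact (congrArg _ this).trans (by simp)
    · set 𝔮 := Ideal.span {eqn k n (some i)}
      -- in the quotient, `z ^ (a • ψ i)` becomes `(-1) ^ a`
      have key (a : ℤ) : Ideal.Quotient.mk 𝔮 (.single ⟨a • D.ψ i, hmem _⟩ 1) =
          Ideal.Quotient.mk 𝔮 (.single 0 (((-1 : kˣ) ^ a : kˣ) : k)) := by
        let f : Multiplicative ℤ →* D.ChartRing k (some i) ⧸ 𝔮 :=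
          { toFun := fun a => Ideal.Quotient.mk 𝔮 (.single ⟨a.toAdd • D.ψ i, hmem _⟩ 1)
            map_one' := by
              rw [← map_one (Ideal.Quotient.mk 𝔮), AddMonoidAlgebra.one_def]
              congr 2
              exact Subtype.ext (by simp)
            map_mul' := fun a b => by
              rw [← map_mul, AddMonoidAlgebra.single_mul_single, one_mul]
              congr 2
              exact Subtype.ext (by simp [add_smul]) }
        let g : Multiplicative ℤ →* D.ChartRing k (some i) ⧸ 𝔮 :=
          { toFun := fun a => Ideal.Quotient.mk 𝔮 (.single 0 (((-1 : kˣ) ^ a.toAdd : kˣ) : k))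
            map_one' := by
              simp [← AddMonoidAlgebra.one_def]
            map_mul' := fun a b => by
              rw [← map_mul, AddMonoidAlgebra.single_mul_single, toAdd_mul, zpow_add, Units.val_mul,
                add_zero] }
        have hfg : f = g := by
          apply MonoidHom.ext_mint
          change Ideal.Quotient.mk 𝔮 _ = Ideal.Quotient.mk 𝔮 _
          rw [Ideal.Quotient.eq]
          have : (AddMonoidAlgebra.single ⟨(1 : ℤ) • D.ψ i, hmem _⟩ 1 -
              AddMonoidAlgebra.single 0 (((-1 : kˣ) ^ (1 : ℤ) : kˣ) : k) : D.ChartRing k (some i)) =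
              eqn k n (some i) := by
            rw [eqn_unfrozen k n h, zpow_one, Units.val_neg, Units.val_one,
              AddMonoidAlgebra.single_neg, sub_neg_eq_add, ← AddMonoidAlgebra.one_def, add_comm]
            congr 2
            exact Subtype.ext (one_smul _ _)
          exact this ▸ Ideal.mem_span_singleton_self _
        exact DFunLike.congr_fun hfg (Multiplicative.ofAdd a)
      refine AddMonoidAlgebra.ringHom_ext (fun r => ?_) fun v => ?_
      · have : π (.single 0 r) = .single 0 r := π.commutes r
        exact congrArg _ this
      · refine (congrArg _ (twistHom_single _ _ _ _ _ _ _)).trans ?_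
        have h1 : (AddMonoidAlgebra.single v 1 : D.ChartRing k (some i)) =
            .single ⟨v - r v, hmem _⟩ 1 * .single ⟨ℓ (v : P) • D.ψ i, hmem _⟩ 1 := by
          rw [AddMonoidAlgebra.single_mul_single, one_mul]
          congr 1
          exact Subtype.ext (by simp [hr])
        rw [h1, map_mul, key, ← map_mul, AddMonoidAlgebra.single_mul_single, add_zero]
        rfl

end domain

end MutationDatum

/-! ### The topology of the glued scheme -/

lemma exists_point_of_eqToHom {A A' B B' U W : Scheme.{u}} (hA : A' = A) (hB : B' = B)
    (s : A ⟶ B) (f : A ⟶ U) (f' : B ⟶ W) (z : A') :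
    ∃ z' : A, f z' = (eqToHom hA ≫ f) z ∧
      (s ≫ f') z' = ((eqToHom hA ≫ s ≫ eqToHom hB.symm) ≫ eqToHom hB ≫ f') z := by
  subst hA hB
  exact ⟨z, by simp, by simp⟩

namespace StarData
variable {J : Type u} (D : StarData J)

lemma exists_of_ι_eq {i j : J} (hij : i ≠ j) (x : D.U i) (y : D.U j) (h : D.ι i x = D.ι j y) :
    ∃ (v : D.V i) (v' : D.V j), D.g i v = x ∧ D.g j v' = y ∧ D.a i v = D.a j v' := by
  classical
  obtain ⟨z, hz1, hz2⟩ := (D.glueData.ι_eq_iff i j x y).1 h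
  dsimp only at z hz1 hz2
  have e0 : D.glueData.t i j =
      eqToHom (dif_neg hij) ≫ D.swap i j ≫ eqToHom (dif_neg (Ne.symm hij)).symm := dif_neg hij
  have e1 : D.glueData.f i j = eqToHom (dif_neg hij) ≫ D.ovMap i j := dif_neg hij
  have e2 : D.glueData.f j i = eqToHom (dif_neg (Ne.symm hij)) ≫ D.ovMap j i :=
    dif_neg (Ne.symm hij)
  rw [e1] at hz1
  rw [e0, e2] at hz2
  have hA : D.glueData.V (i, j) = D.ov i j := dif_neg hij
  have hB : D.glueData.V (j, i) = D.ov j i := dif_neg (Ne.symm hij)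
  obtain ⟨z', h1, h2⟩ := exists_point_of_eqToHom hA hB
    (D.swap i j) (D.ovMap i j) (D.ovMap j i) z
  refine ⟨D.fst i j z', D.fst j i (D.swap i j z'), h1.trans hz1, h2.trans hz2, ?_⟩
  exact (congrArg (fun f : D.ov i j ⟶ D.Z => f z') (D.swap_fst_a i j)).symm

lemma exists_ι_eq (x : D.glued) : ∃ (j : J) (y : D.U j), D.ι j y = x :=
  D.glueData.ι_jointly_surjective x

end StarData

namespace MutationDatum
variable {P I : Type u} [AddCommGroup P] (D : MutationDatum P I) (k : Type u) [Field k]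

lemma exists_chart_eq (x : D.scheme k) :
    ∃ (j : Option I) (y : Spec (.of (D.ChartRing k j))), D.chart k j y = x :=
  (D.starData k).exists_ι_eq x

lemma mem_chartOpen {j : Option I} {x : D.scheme k} :
    x ∈ D.chartOpen k j ↔ ∃ y : Spec (.of (D.ChartRing k j)), D.chart k j y = x := by
  unfold chartOpen
  exact ⟨fun ⟨y, _, hy⟩ => ⟨y, hy⟩, fun ⟨y, hy⟩ => ⟨y, trivial, hy⟩⟩

lemma chart_mem_chartOpen (j : Option I) (y : Spec (.of (D.ChartRing k j))) :
    D.chart k j y ∈ D.chartOpen k j := (D.mem_chartOpen k).2 ⟨y, rfl⟩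

lemma exists_mem_chartOpen (x : D.scheme k) : ∃ j, x ∈ D.chartOpen k j := by
  obtain ⟨j, y, rfl⟩ := D.exists_chart_eq k x
  exact ⟨j, D.chart_mem_chartOpen k j y⟩

lemma isAffineOpen_chartOpen (j : Option I) : IsAffineOpen (D.chartOpen k j) :=
  (isAffineOpen_top _).image_of_isOpenImmersion _

lemma chart_injective (j : Option I) : Function.Injective (D.chart k j) :=
  (D.chart k j).isOpenEmbedding.injective

/-- The inclusion of the chart of index `none` as the central torus. -/
lemma center_mem_chartOpen_none (x : Spec (.of (AddMonoidAlgebra k P))) :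
    D.center k x ∈ D.chartOpen k none :=
  D.chart_mem_chartOpen k none _

lemma chartIncl_none_bijective : Function.Bijective (D.chartIncl k none) := by
  refine ⟨D.chartIncl_injective k none, fun x => ?_⟩
  induction x using AddMonoidAlgebra.induction_linear with
  | zero => exact ⟨0, map_zero _⟩
  | add x y hx hy =>
    obtain ⟨a, rfl⟩ := hx
    obtain ⟨b, rfl⟩ := hy
    exact ⟨a + b, map_add _ _ _⟩
  | single v r => exact ⟨.single ⟨v, trivial⟩ r, D.chartIncl_single k none _ _⟩

instance : IsIso (Spec.map (CommRingCat.ofHom (D.chartIncl k none).toRingHom)) := by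
  have : IsIso (CommRingCat.ofHom (D.chartIncl k none).toRingHom) :=
    (ConcreteCategory.isIso_iff_bijective _).2 (D.chartIncl_none_bijective k)
  infer_instance

lemma exists_center_eq {x : D.scheme k} (hx : x ∈ D.chartOpen k none) :
    ∃ y : Spec (.of (AddMonoidAlgebra k P)), D.center k y = x := by
  obtain ⟨y, rfl⟩ := (D.mem_chartOpen k).1 hx
  obtain ⟨z, rfl⟩ := (Spec.map (CommRingCat.ofHom (D.chartIncl k none).toRingHom)).surjective y
  exact ⟨z, rfl⟩

instance : IsOpenImmersion (D.center k) := by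
  unfold center
  infer_instance

variable {D} (n : D.Uniformizer)

lemma range_mutation (j : Option I) :
    Set.range (Spec.map (CommRingCat.ofHom (D.mutation k j).toRingHom)) =
      (PrimeSpectrum.basicOpen (eqn k n j) : Set (PrimeSpectrum (D.ChartRing k j))) := by
  let _ := (D.mutation k j).toRingHom.toAlgebra
  have := mutation_away k n j
  exact PrimeSpectrum.localization_away_comap_range (D.OverlapRing k j) (eqn k n j)

variable (D) in
lemma range_overlap (j : Option I) :
    Set.range (Spec.map (CommRingCat.ofHom
      (algebraMap (AddMonoidAlgebra k P) (D.OverlapRing k j)))) =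
      (PrimeSpectrum.basicOpen (D.den k j) : Set (PrimeSpectrum (AddMonoidAlgebra k P))) :=
  PrimeSpectrum.localization_away_comap_range (D.OverlapRing k j) (D.den k j)

variable (D) in
lemma mutation_chart_apply (j : Option I) (v : Spec (.of (D.OverlapRing k j))) :
    D.chart k j (Spec.map (CommRingCat.ofHom (D.mutation k j).toRingHom) v) =
      D.center k (Spec.map (CommRingCat.ofHom
        (algebraMap (AddMonoidAlgebra k P) (D.OverlapRing k j))) v) :=
  congrArg (fun f : Spec (.of (D.OverlapRing k j)) ⟶ D.scheme k => f v) (D.mutation_chart k j)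

lemma chart_mem_chartOpen_none (j : Option I) (x : Spec (.of (D.ChartRing k j))) :
    D.chart k j x ∈ D.chartOpen k none ↔ eqn k n j ∉ x.asIdeal := by
  have h1 : eqn k n j ∉ x.asIdeal ↔
      x ∈ Set.range (Spec.map (CommRingCat.ofHom (D.mutation k j).toRingHom)) := by
    rw [range_mutation k n]
    exact Iff.rfl
  rw [h1]
  constructor
  · intro h
    rcases j with _ | i
    · rw [← h1]
      exact fun h0 => x.2.ne_top ((Ideal.eq_top_iff_one _).2 h0)
    · obtain ⟨y, hy⟩ := (D.mem_chartOpen k).1 h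
      obtain ⟨v, -, hv, -, -⟩ := (D.starData k).exists_of_ι_eq (Option.some_ne_none i) x y hy.symm
      exact ⟨v, hv⟩
  · rintro ⟨v, rfl⟩
    rw [D.mutation_chart_apply k j v]
    exact D.center_mem_chartOpen_none k _

variable (D) in
lemma center_mem_chartOpen (j : Option I) (x : Spec (.of (AddMonoidAlgebra k P))) :
    D.center k x ∈ D.chartOpen k j ↔ D.den k j ∉ x.asIdeal := by
  have h1 : D.den k j ∉ x.asIdeal ↔ x ∈ Set.range (Spec.map (CommRingCat.ofHom
      (algebraMap (AddMonoidAlgebra k P) (D.OverlapRing k j)))) := by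
    rw [range_overlap]
    exact Iff.rfl
  rw [h1]
  constructor
  · intro h
    rcases j with _ | i
    · rw [← h1]
      exact fun h0 => x.2.ne_top ((Ideal.eq_top_iff_one _).2 h0)
    · obtain ⟨y, hy⟩ := (D.mem_chartOpen k).1 h
      obtain ⟨v, v', h1, h2, h3⟩ := (D.starData k).exists_of_ι_eq (Option.some_ne_none i) y
        (Spec.map (CommRingCat.ofHom (D.chartIncl k none).toRingHom) x) hy
      refine ⟨v, ?_⟩
      have h4 := D.mutation_chart_apply k (some i) v
      have h5 : D.chart k (some i) (Spec.map (CommRingCat.ofHom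
        (D.mutation k (some i)).toRingHom) v) = D.center k x := (congrArg _ h1).trans hy
      exact (D.center k).isOpenEmbedding.injective (h4.symm.trans h5)
  · rintro ⟨v, rfl⟩
    rw [← D.mutation_chart_apply k j v]
    exact D.chart_mem_chartOpen k j _

variable (D) in
/-- Distinct charts only meet inside the central torus. -/
lemma chartOpen_inf_le {i j : Option I} (hij : i ≠ j) :
    D.chartOpen k i ⊓ D.chartOpen k j ≤ D.chartOpen k none := by
  rintro x ⟨hi, hj⟩
  obtain ⟨y, rfl⟩ := (D.mem_chartOpen k).1 hi
  obtain ⟨z, hz⟩ := (D.mem_chartOpen k).1 hj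
  obtain ⟨v, v', h1, h2, h3⟩ := (D.starData k).exists_of_ι_eq hij y z hz.symm
  have h4 := D.mutation_chart_apply k i v
  rw [← show Spec.map (CommRingCat.ofHom (D.mutation k i).toRingHom) v = y from h1, h4]
  exact D.center_mem_chartOpen_none k _

/-! ### Functions on charts -/

variable (D) in
lemma chartSection_bijective (j : Option I) : Function.Bijective (D.chartSection k j) :=
  ((ConcreteCategory.isIso_iff_bijective ((Scheme.ΓSpecIso (.of (D.ChartRing k j))).inv ≫
    ((D.chart k j).appIso ⊤).inv)).1 inferInstance)

variable (D) in
lemma chart_appLE_chartSection (j : Option I)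
    (h : ⊤ ≤ D.chart k j ⁻¹ᵁ D.chartOpen k j) (x : D.ChartRing k j) :
    (D.chart k j).appLE (D.chartOpen k j) ⊤ h (D.chartSection k j x) =
      (Scheme.ΓSpecIso (.of (D.ChartRing k j))).inv x := by
  have := (D.chart k j).appIso_inv_appLE (U := ⊤) (V := ⊤)
    (e := ((D.chart k j).preimage_image_eq ⊤).ge)
  have h2 := congrArg (fun f => f.hom ((Scheme.ΓSpecIso (.of (D.ChartRing k j))).inv x)) this
  refine h2.trans ?_
  simp

variable (D) in
lemma appLE_chartSection {R : CommRingCat.{u}} (j : Option I) (φ : D.ChartRing k j →+* R)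
    (o : Spec R ⟶ D.scheme k) (ho : o = Spec.map (CommRingCat.ofHom φ) ≫ D.chart k j)
    (h : ⊤ ≤ o ⁻¹ᵁ D.chartOpen k j) (x : D.ChartRing k j) :
    o.appLE (D.chartOpen k j) ⊤ h (D.chartSection k j x) = (Scheme.ΓSpecIso R).inv (φ x) := by
  subst ho
  have h1 : ⊤ ≤ D.chart k j ⁻¹ᵁ D.chartOpen k j := ((D.chart k j).preimage_image_eq ⊤).ge
  have h2 := Scheme.Hom.appLE_comp_appLE (Spec.map (CommRingCat.ofHom φ)) (D.chart k j)
    (D.chartOpen k j) ⊤ ⊤ h1 le_top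
  have h3 := congrArg (fun f => f.hom (D.chartSection k j x)) h2
  refine h3.symm.trans ?_
  rw [CommRingCat.hom_comp, RingHom.comp_apply]
  refine (congrArg _ (D.chart_appLE_chartSection k j h1 x)).trans ?_
  have h4 := congrArg (fun f => f.hom x) (Scheme.ΓSpecIso_inv_naturality (CommRingCat.ofHom φ))
  refine Eq.trans ?_ h4.symm
  rw [CommRingCat.hom_comp, RingHom.comp_apply, Scheme.Hom.appTop, Scheme.Hom.app_eq_appLE]
  rfl

variable (D) in
lemma chart_mem_basicOpen (j : Option I) (g : D.ChartRing k j) (x : Spec (.of (D.ChartRing k j))) :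
    D.chart k j x ∈ (D.scheme k).basicOpen (D.chartSection k j g) ↔ g ∉ x.asIdeal := by
  have h1 : D.chart k j ''ᵁ (Spec (.of (D.ChartRing k j))).basicOpen
      ((Scheme.ΓSpecIso (.of (D.ChartRing k j))).inv g) =
      (D.scheme k).basicOpen (D.chartSection k j g) :=
    Scheme.image_basicOpen (D.chart k j) _
  rw [← h1, basicOpen_eq_of_affine]
  constructor
  · rintro ⟨y, hy, hyx⟩
    rw [← D.chart_injective k j hyx]
    exact hy
  · exact fun h => ⟨x, h, rfl⟩

/-- A relation between functions on the chart `j` and on the central torus holds on the overlap if it holds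
in the coordinate ring of the overlap. -/
lemma chartSection_transfer (j : Option I) (x x' : D.ChartRing k j) (y : D.ChartRing k none)
    (h : D.mutation k j x = algebraMap _ _ (D.chartIncl k none y) * D.mutation k j x')
    (n : D.Uniformizer) :
    (D.scheme k).presheaf.map (homOfLE (inf_le_left :
        D.chartOpen k j ⊓ D.chartOpen k none ≤ _)).op (D.chartSection k j x) =
      (D.scheme k).presheaf.map (homOfLE (inf_le_right :
        D.chartOpen k j ⊓ D.chartOpen k none ≤ _)).op (D.chartSection k none y) *
      (D.scheme k).presheaf.map (homOfLE (inf_le_left :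
        D.chartOpen k j ⊓ D.chartOpen k none ≤ _)).op (D.chartSection k j x') := by
  set W := D.chartOpen k j ⊓ D.chartOpen k none
  let o : Spec (.of (D.OverlapRing k j)) ⟶ D.scheme k :=
    Spec.map (CommRingCat.ofHom (D.mutation k j).toRingHom) ≫ D.chart k j
  have ho2 : o = Spec.map (CommRingCat.ofHom ((algebraMap _ (D.OverlapRing k j)).comp
      (D.chartIncl k none).toRingHom)) ≫ D.chart k none := by
    rw [CommRingCat.ofHom_comp, Spec.map_comp, Category.assoc]
    exact D.mutation_chart k j
  have hW : W ≤ o.opensRange := by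
    rintro z ⟨hz1, hz2⟩
    obtain ⟨y, rfl⟩ := (D.mem_chartOpen k).1 hz1
    have h1 := (chart_mem_chartOpen_none k n j y).1 hz2
    have h2 : y ∈ Set.range (Spec.map (CommRingCat.ofHom (D.mutation k j).toRingHom)) := by
      rw [range_mutation k n]
      exact h1
    obtain ⟨v, rfl⟩ := h2
    exact ⟨v, rfl⟩
  have hoW : ⊤ ≤ o ⁻¹ᵁ W := by
    intro v _
    refine ⟨D.chart_mem_chartOpen k j _, ?_⟩
    change D.chart k j (Spec.map (CommRingCat.ofHom (D.mutation k j).toRingHom) v) ∈ _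
    rw [D.mutation_chart_apply k j v]
    exact D.center_mem_chartOpen_none k _
  have hiso := o.isIso_app W hW
  have hinj : Function.Injective (o.appLE W ⊤ hoW) := by
    have e : o ⁻¹ᵁ W = ⊤ := top_le_iff.1 hoW
    have : IsIso (o.appLE W ⊤ hoW) := by
      unfold Scheme.Hom.appLE
      have : IsIso ((Spec (.of (D.OverlapRing k j))).presheaf.map (homOfLE hoW).op) := by
        have : IsIso (homOfLE hoW) := ⟨homOfLE (le_of_eq e), rfl, rfl⟩
        infer_instance
      infer_instance
    exact ((ConcreteCategory.isIso_iff_bijective _).1 this).1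
  apply hinj
  have hres (j' : Option I) (hj' : W ≤ D.chartOpen k j') (φ : D.ChartRing k j' →+* D.OverlapRing k j)
      (hφ : o = Spec.map (CommRingCat.ofHom φ) ≫ D.chart k j') (x : D.ChartRing k j') :
      o.appLE W ⊤ hoW ((D.scheme k).presheaf.map (homOfLE hj').op (D.chartSection k j' x)) =
        (Scheme.ΓSpecIso (.of (D.OverlapRing k j))).inv (φ x) := by
    have h1 := o.map_appLE hoW (homOfLE hj').op
    have h2 := congrArg (fun f => f.hom (D.chartSection k j' x)) h1
    exact h2.trans (D.appLE_chartSection k j' (R := .of (D.OverlapRing k j)) φ o hφ _ x)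
  rw [map_mul, hres j inf_le_left (D.mutation k j).toRingHom rfl,
    hres j inf_le_left (D.mutation k j).toRingHom rfl, hres none inf_le_right _ ho2, ← map_mul]
  exact congrArg _ h

end MutationDatum

/-! ### The ideals of the divisors on the charts -/

lemma mem_vanishingIdeal_ideal {X : Scheme.{u}} (Z : TopologicalSpace.Closeds X) (U : X.affineOpens)
    (f : Γ(X, U.1)) : f ∈ (Scheme.IdealSheafData.vanishingIdeal Z).ideal U ↔
      ∀ x ∈ U.1, x ∈ Z → x ∉ X.basicOpen f := by
  rw [Scheme.IdealSheafData.vanishingIdeal_ideal, PrimeSpectrum.mem_vanishingIdeal]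
  have h1 (y : Spec Γ(X, U.1)) : f ∉ y.asIdeal ↔ U.2.fromSpec y ∈ X.basicOpen f := by
    have h2 : y ∈ U.2.fromSpec ⁻¹ᵁ X.basicOpen f ↔ y ∈ PrimeSpectrum.basicOpen f := by
      rw [U.2.fromSpec_preimage_basicOpen]
      exact Iff.rfl
    exact h2.symm
  constructor
  · intro h x hx hZ hxf
    obtain ⟨y, rfl⟩ : x ∈ Set.range U.2.fromSpec := by
      rw [U.2.range_fromSpec]
      exact hx
    exact (h1 y).2 hxf (h y hZ)
  · intro h y hy
    by_contra hf
    refine h (U.2.fromSpec y) ?_ hy ((h1 y).1 hf)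
    have : U.2.fromSpec y ∈ Set.range U.2.fromSpec := ⟨y, rfl⟩
    rwa [U.2.range_fromSpec] at this

namespace MutationDatum
variable {P I : Type u} [AddCommGroup P] {D : MutationDatum P I} (k : Type u) [Field k]

variable (D) in
lemma mem_divisor {i : I} {x : D.scheme k} :
    x ∈ D.divisor k i ↔ x ∈ D.chartOpen k (some i) ∧ x ∉ D.chartOpen k none := by
  have h : IsClosed ((D.chartOpen k (some i) : Set (D.scheme k)) \ D.chartOpen k none) := by
    have h2 : ((D.chartOpen k (some i) : Set (D.scheme k)) \ D.chartOpen k none)ᶜ =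
        ⋃ j ∈ {j | j ≠ some i}, (D.chartOpen k j : Set (D.scheme k)) := by
      ext y
      simp only [Set.mem_compl_iff, Set.mem_sdiff, not_and, not_not, Set.mem_iUnion,
        Set.mem_ofPred_eq, exists_prop]
      constructor
      · intro hy
        obtain ⟨j, hj⟩ := D.exists_mem_chartOpen k y
        by_cases hji : j = some i
        · subst hji
          exact ⟨none, by simp, hy hj⟩
        · exact ⟨j, hji, hj⟩
      · rintro ⟨j, hji, hj⟩ hy
        exact D.chartOpen_inf_le k hji ⟨hj, hy⟩
    rw [← isOpen_compl_iff, h2]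
    exact isOpen_biUnion fun j _ => (D.chartOpen k j).isOpen
  change x ∈ closure _ ↔ _
  rw [h.closure_eq]
  rfl

variable (n : D.Uniformizer)

open scoped Classical in
/-- The equation on the chart `j` of the divisor of `i`. -/
def divisorEqn (j : Option I) (i : I) : D.ChartRing k j := if j = some i then eqn k n j else 1

lemma chart_mem_divisor (i : I) (j : Option I) (x : Spec (.of (D.ChartRing k j))) :
    D.chart k j x ∈ D.divisor k i ↔ divisorEqn k n j i ∈ x.asIdeal := by
  rw [mem_divisor, chart_mem_chartOpen_none k n, not_not, divisorEqn]
  split_ifs with h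
  · subst h
    exact and_iff_right (D.chart_mem_chartOpen k _ x)
  · refine iff_of_false (fun h2 => ?_) ((Ideal.ne_top_iff_one _).1 x.2.ne_top)
    exact (chart_mem_chartOpen_none k n j x).1
      (D.chartOpen_inf_le k h ⟨D.chart_mem_chartOpen k _ x, h2.1⟩) h2.2

variable (D) in
/-- The charts as affine open subschemes. -/
def affineChart (j : Option I) : (D.scheme k).affineOpens :=
  ⟨D.chartOpen k j, D.isAffineOpen_chartOpen k j⟩

lemma divisorIdeal_ideal [TwoUniqueSums P] (hℓ : ∀ i ∉ D.F, ∃ ℓ : P →+ ℤ, ℓ (D.ψ i) = 1)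
    (j : Option I) (i : I) : (D.divisorIdeal k i).ideal (D.affineChart k j) =
      Ideal.span {D.chartSection k j (divisorEqn k n j i)} := by
  ext f
  obtain ⟨g, rfl⟩ := (D.chartSection_bijective k j).2 f
  have h1 : D.chartSection k j g ∈ (D.divisorIdeal k i).ideal (D.affineChart k j) ↔
      ∀ x : Spec (.of (D.ChartRing k j)), divisorEqn k n j i ∈ x.asIdeal → g ∈ x.asIdeal := by
    refine (mem_vanishingIdeal_ideal _ _ _).trans ⟨fun h x hx => ?_, fun h x hx hxZ => ?_⟩
    · by_contra hg
      exact h _ (D.chart_mem_chartOpen k j x) ((chart_mem_divisor k n i j x).2 hx)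
        ((D.chart_mem_basicOpen k j g x).2 hg)
    · obtain ⟨y, rfl⟩ := (D.mem_chartOpen k).1 hx
      intro hg
      exact (D.chart_mem_basicOpen k j g y).1 hg (h y ((chart_mem_divisor k n i j y).1 hxZ))
  have h2 : D.chartSection k j g ∈ Ideal.span {D.chartSection k j (divisorEqn k n j i)} ↔
      g ∈ Ideal.span {divisorEqn k n j i} := by
    rw [Ideal.mem_span_singleton, Ideal.mem_span_singleton]
    refine ⟨fun ⟨c, hc⟩ => ?_, fun h => map_dvd _ h⟩
    obtain ⟨c, rfl⟩ := (D.chartSection_bijective k j).2 c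
    exact ⟨c, (D.chartSection_bijective k j).1 (by rw [hc, map_mul])⟩
  refine h1.trans (Iff.trans ?_ h2.symm)
  refine ⟨fun h => ?_, fun h x hx => (Ideal.span_singleton_le_iff_mem _).2 hx h⟩
  by_cases hji : j = some i
  · subst hji
    have hp := span_eqn_isPrime k n i (hℓ i)
    have hd : divisorEqn k n (some i) i = eqn k n (some i) := if_pos rfl
    rw [hd] at h ⊢
    exact h ⟨_, hp⟩ (Ideal.mem_span_singleton_self _)
  · have hd : divisorEqn k n j i = 1 := if_neg hji
    rw [hd, Ideal.span_singleton_one]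
    trivial

/-! ### Morphisms of glued schemes -/

variable {P' : Type u} [AddCommGroup P'] {D' : MutationDatum P' I} (T : D.Hom D')

/-- The image of the monomials `v i` under a map of gluing data. -/
def Uniformizer.map : D'.Uniformizer where
  v i := T.θ (n.v i)
  u_v i hi := by rw [T.u_θ, n.u_v i (T.F_eq ▸ hi)]

lemma Hom.chartHom_single (j : Option I) (v : D.mon j) (r : k) :
    T.chartHom k j (.single v r) = .single ⟨T.θ v, T.map_mem j v⟩ r := by
  simp [Hom.chartHom]
  rfl

lemma Hom.chartHom_eqn (j : Option I) : T.chartHom k j (eqn k n j) = eqn k (n.map T) j := by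
  rcases j with _ | i
  · exact map_one _
  · by_cases h : i ∈ D.F
    · have h' : i ∈ D'.F := T.F_eq ▸ h
      rw [eqn_frozen k n h, eqn_frozen k _ h', T.chartHom_single k]
      rfl
    · have h' : i ∉ D'.F := T.F_eq ▸ h
      rw [eqn_unfrozen k n h, eqn_unfrozen k _ h', map_add, map_one, T.chartHom_single k]
      congr 2
      exact Subtype.ext (T.θ_ψ i)

lemma Hom.schemeMap_chart_apply (j : Option I) (x : Spec (.of (D'.ChartRing k j))) :
    T.schemeMap k (D'.chart k j x) =
      D.chart k j (Spec.map (CommRingCat.ofHom (T.chartHom k j).toRingHom) x) :=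
  congrArg (fun f : Spec (.of (D'.ChartRing k j)) ⟶ D.scheme k => f x) (T.chart_schemeMap k j)

lemma Hom.center_schemeMap : D'.center k ≫ T.schemeMap k =
    Spec.map (CommRingCat.ofHom (T.torusHom k).toRingHom) ≫ D.center k := by
  unfold center
  rw [Category.assoc, T.chart_schemeMap k, ← Category.assoc, ← Category.assoc, ← Spec.map_comp,
    ← Spec.map_comp]
  congr 2
  refine CommRingCat.hom_ext (congrArg AlgHom.toRingHom
    (algHom_ext_single k (f := (D'.chartIncl k none).comp (T.chartHom k none))
      (g := (T.torusHom k).comp (D.chartIncl k none)) fun v => ?_))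
  rw [AlgHom.comp_apply, AlgHom.comp_apply, T.chartHom_single k, chartIncl_single, chartIncl_single,
    T.torusHom_single k]

lemma Hom.schemeMap_center_apply (x : Spec (.of (AddMonoidAlgebra k P'))) :
    T.schemeMap k (D'.center k x) =
      D.center k (Spec.map (CommRingCat.ofHom (T.torusHom k).toRingHom) x) :=
  congrArg (fun f : Spec (.of (AddMonoidAlgebra k P')) ⟶ D.scheme k => f x) (T.center_schemeMap k)

include n in
/-- The charts of the source are the preimages of the charts of the target. -/
lemma Hom.preimage_chartOpen (j : Option I) :
    T.schemeMap k ⁻¹ᵁ D.chartOpen k j = D'.chartOpen k j := by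
  apply le_antisymm
  · intro y hy
    obtain ⟨j', x, rfl⟩ := D'.exists_chart_eq k y
    by_cases hj : j' = j
    · subst hj
      exact D'.chart_mem_chartOpen k _ x
    have h1 : T.schemeMap k (D'.chart k j' x) ∈ D.chartOpen k j := hy
    have h2 : T.schemeMap k (D'.chart k j' x) ∈ D.chartOpen k none := by
      refine D.chartOpen_inf_le k hj ⟨?_, h1⟩
      rw [T.schemeMap_chart_apply k]
      exact D.chart_mem_chartOpen k _ _
    rw [T.schemeMap_chart_apply k, chart_mem_chartOpen_none k n] at h2
    have h3 : D'.chart k j' x ∈ D'.chartOpen k none := by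
      rw [chart_mem_chartOpen_none k (n.map T), ← T.chartHom_eqn k]
      exact h2
    obtain ⟨z, hz⟩ := D'.exists_center_eq k h3
    rw [← hz, T.schemeMap_center_apply k, D.center_mem_chartOpen] at h1
    change D'.chart k j' x ∈ _
    rw [← hz, D'.center_mem_chartOpen, ← T.torusHom_den k]
    exact h1
  · intro y hy
    obtain ⟨x, rfl⟩ := (D'.mem_chartOpen k).1 hy
    change T.schemeMap k (D'.chart k j x) ∈ D.chartOpen k j
    rw [T.schemeMap_chart_apply k]
    exact D.chart_mem_chartOpen k _ _

include n in
lemma Hom.isAffineHom_schemeMap : IsAffineHom (T.schemeMap k) := by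
  refine isAffineHom_of_forall_exists_isAffineOpen _ fun x => ?_
  obtain ⟨j, hj⟩ := D.exists_mem_chartOpen k x
  exact ⟨_, hj, D.isAffineOpen_chartOpen k j, by
    rw [T.preimage_chartOpen k n]
    exact D'.isAffineOpen_chartOpen k j⟩

lemma Hom.appLE_chartSection (j : Option I)
    (h : D'.chartOpen k j ≤ T.schemeMap k ⁻¹ᵁ D.chartOpen k j) (g : D.ChartRing k j) :
    (T.schemeMap k).appLE (D.chartOpen k j) (D'.chartOpen k j) h (D.chartSection k j g) =
      D'.chartSection k j (T.chartHom k j g) := by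
  obtain ⟨f, hf⟩ := (D'.chartSection_bijective k j).2 ((T.schemeMap k).appLE (D.chartOpen k j)
    (D'.chartOpen k j) h (D.chartSection k j g))
  rw [← hf]
  congr 1
  have h1 : ⊤ ≤ D'.chart k j ⁻¹ᵁ D'.chartOpen k j := ((D'.chart k j).preimage_image_eq ⊤).ge
  have h2 := congrArg ((D'.chart k j).appLE (D'.chartOpen k j) ⊤ h1) hf
  rw [D'.chart_appLE_chartSection] at h2
  have h3 := congrArg (fun φ => φ.hom (D.chartSection k j g))
    (Scheme.Hom.appLE_comp_appLE (D'.chart k j) (T.schemeMap k) (D.chartOpen k j)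
      (D'.chartOpen k j) ⊤ h h1)
  have h4 := D.appLE_chartSection k j (R := .of (D'.ChartRing k j)) (T.chartHom k j).toRingHom
    (D'.chart k j ≫ T.schemeMap k) (T.chart_schemeMap k j) (h1.trans fun _ hx => h hx) g
  exact (Scheme.ΓSpecIso (.of (D'.ChartRing k j))).symm.commRingCatIsoToRingEquiv.injective
    (h2.trans (h3.trans h4))

end MutationDatum

/-! ### Laurent polynomial rings -/

section laurent
variable {Λ : Type*} [AddCommGroup Λ] {R A : Type*} [CommRing R] [CommRing A]

/-- The homomorphism `R[Λ] → A` given by `σ : R → A` and `z ^ m ↦ χ m`. -/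
def laurentHom (σ : R →+* A) (χ : Multiplicative Λ →* A) : AddMonoidAlgebra R Λ →+* A :=
  AddMonoidAlgebra.liftNCRingHom σ χ (fun _ _ => Commute.all _ _)

lemma laurentHom_single (σ : R →+* A) (χ : Multiplicative Λ →* A) (m : Λ) (r : R) :
    laurentHom σ χ (.single m r) = σ r * χ (Multiplicative.ofAdd m) :=
  AddMonoidAlgebra.liftNC_single _ _ _ _

lemma laurentHom_ext {f g : AddMonoidAlgebra R Λ →+* A}
    (h : ∀ m r, f (.single m r) = g (.single m r)) : f = g :=
  AddMonoidAlgebra.ringHom_ext (fun r => h 0 r) (fun m => h m 1)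

lemma comp_laurentHom {B : Type*} [CommRing B] (g : A →+* B) (σ : R →+* A)
    (χ : Multiplicative Λ →* A) :
    g.comp (laurentHom σ χ) = laurentHom (g.comp σ) (g.toMonoidHom.comp χ) := by
  refine laurentHom_ext fun m r => ?_
  rw [RingHom.comp_apply, laurentHom_single, laurentHom_single, map_mul]
  rfl

lemma laurentHom_comp_mapRingHom {S : Type*} [CommRing S] (f : S →+* R) (σ : R →+* A)
    (χ : Multiplicative Λ →* A) :
    (laurentHom σ χ).comp (AddMonoidAlgebra.mapRingHom Λ f) = laurentHom (σ.comp f) χ := by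
  refine laurentHom_ext fun m r => ?_
  rw [RingHom.comp_apply, laurentHom_single]
  simp [laurentHom_single]

/-- The automorphism `z ^ m ↦ c m * z ^ m`. -/
def rescale (c : Multiplicative Λ →* Rˣ) : AddMonoidAlgebra R Λ →+* AddMonoidAlgebra R Λ :=
  laurentHom AddMonoidAlgebra.singleZeroRingHom
    { toFun := fun m => .single m.toAdd (c m : R)
      map_one' := by simp [AddMonoidAlgebra.one_def]
      map_mul' := fun a b => by
        rw [AddMonoidAlgebra.single_mul_single, _root_.map_mul c, Units.val_mul, toAdd_mul] }

lemma rescale_single (c : Multiplicative Λ →* Rˣ) (m : Λ) (r : R) :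
    rescale c (.single m r) = .single m (r * c (Multiplicative.ofAdd m)) := by
  refine (laurentHom_single _ _ _ _).trans ?_
  refine (AddMonoidAlgebra.single_mul_single _ _ _ _).trans ?_
  rw [zero_add]
  rfl

lemma coeff_rescale (c : Multiplicative Λ →* Rˣ) (x : AddMonoidAlgebra R Λ) (m : Λ) :
    (rescale c x).coeff m = x.coeff m * c (Multiplicative.ofAdd m) := by
  classical
  induction x using AddMonoidAlgebra.induction_linear with
  | zero => simp
  | add x y hx hy => simp [hx, hy, add_mul]
  | single a r =>
    rw [rescale_single, AddMonoidAlgebra.coeff_single, AddMonoidAlgebra.coeff_single,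
      Finsupp.single_apply, Finsupp.single_apply]
    split_ifs with h
    · rw [h]
    · rw [zero_mul]

lemma rescale_surjective (c : Multiplicative Λ →* Rˣ) : Function.Surjective (rescale c) := by
  intro x
  refine ⟨rescale c⁻¹ x, AddMonoidAlgebra.ext (Finsupp.ext fun m => ?_)⟩
  rw [coeff_rescale, coeff_rescale, mul_assoc, MonoidHom.inv_apply, ← Units.val_mul,
    inv_mul_cancel, Units.val_one, mul_one]

lemma laurentHom_rescale (σ : R →+* A) (c : Multiplicative Λ →* Rˣ)
    (χ χ' : Multiplicative Λ →* A) (h : ∀ m, χ m = χ' m * σ (c m)) (x : AddMonoidAlgebra R Λ) :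
    laurentHom σ χ' (rescale c x) = laurentHom σ χ x := by
  have : (laurentHom σ χ').comp (rescale c) = laurentHom σ χ := by
    refine laurentHom_ext fun m r => ?_
    rw [RingHom.comp_apply, rescale_single, laurentHom_single, laurentHom_single, h, map_mul]
    ring
  exact DFunLike.congr_fun this x

lemma exists_mapRingHom_eq {S : Type*} [CommRing S] (f : S →+* R) (x : AddMonoidAlgebra R Λ)
    (h : ∀ m, x.coeff m ∈ f.range) : ∃ y, AddMonoidAlgebra.mapRingHom Λ f y = x := by
  classical
  choose g hg using h
  refine ⟨∑ m ∈ x.coeff.support, .single m (g m), ?_⟩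
  rw [map_sum]
  refine Eq.trans (Finset.sum_congr rfl fun m _ => ?_) (AddMonoidAlgebra.sum_coeff_single x)
  simp [hg]

/-- Base change of a Laurent polynomial ring. -/
lemma laurentHom_bijective_of_isPushout {R A S C : CommRingCat.{u}} {Λ : Type u} [AddCommGroup Λ]
    {α : R ⟶ A} {γ : R ⟶ S} {a : A ⟶ C} {s : S ⟶ C} (H : IsPushout α γ a s)
    (χ : Multiplicative Λ →* A) (h : Function.Bijective (laurentHom α.hom χ)) :
    Function.Bijective (laurentHom s.hom (a.hom.toMonoidHom.comp χ)) := by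
  let e := RingEquiv.ofBijective _ h
  let b := laurentHom s.hom (a.hom.toMonoidHom.comp χ)
  let a' : A ⟶ CommRingCat.of (AddMonoidAlgebra S Λ) :=
    CommRingCat.ofHom ((AddMonoidAlgebra.mapRingHom Λ γ.hom).comp e.symm.toRingHom)
  let s' : S ⟶ CommRingCat.of (AddMonoidAlgebra S Λ) :=
    CommRingCat.ofHom AddMonoidAlgebra.singleZeroRingHom
  have he (m : Λ) (r : R) : e.symm (α.hom r * χ (Multiplicative.ofAdd m)) = .single m r := by
    rw [RingEquiv.symm_apply_eq]
    exact (laurentHom_single _ _ _ _).symm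
  have hw : α ≫ a' = γ ≫ s' := by
    refine CommRingCat.hom_ext (RingHom.ext fun r => ?_)
    change AddMonoidAlgebra.mapRingHom Λ γ.hom (e.symm (α.hom r)) = .single 0 (γ.hom r)
    have := he 0 r
    rw [ofAdd_zero, map_one, mul_one] at this
    rw [this]
    simp
  let d : C →+* AddMonoidAlgebra S Λ := (H.desc a' s' hw).hom
  have hda (x : A) : d (a.hom x) = AddMonoidAlgebra.mapRingHom Λ γ.hom (e.symm x) :=
    congrArg (fun f => f.hom x) (H.inl_desc a' s' hw)
  have hds (x : S) : d (s.hom x) = .single 0 x :=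
    congrArg (fun f => f.hom x) (H.inr_desc a' s' hw)
  have h1 : d.comp b = RingHom.id _ := by
    refine laurentHom_ext fun m r => ?_
    rw [RingHom.comp_apply, laurentHom_single, map_mul, hds]
    change _ * d (a.hom (χ _)) = _
    have := he m 1
    rw [map_one, one_mul] at this
    rw [hda, this]
    simp [AddMonoidAlgebra.single_mul_single]
  have h2 : b.comp d = RingHom.id _ := by
    have h3 : CommRingCat.ofHom d ≫ CommRingCat.ofHom b = 𝟙 C := by
      apply H.hom_ext
      · refine CommRingCat.hom_ext (RingHom.ext fun x => ?_)
        change b (d (a.hom x)) = a.hom x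
        obtain ⟨y, rfl⟩ := e.surjective x
        rw [hda, RingEquiv.symm_apply_apply]
        change (b.comp (AddMonoidAlgebra.mapRingHom Λ γ.hom)) y = (a.hom.comp (laurentHom α.hom χ)) y
        rw [laurentHom_comp_mapRingHom, comp_laurentHom]
        have : s.hom.comp γ.hom = a.hom.comp α.hom := congrArg CommRingCat.Hom.hom H.w.symm
        rw [this]
      · refine CommRingCat.hom_ext (RingHom.ext fun x => ?_)
        change b (d (s.hom x)) = s.hom x
        rw [hds]
        refine (laurentHom_single _ _ _ _).trans ?_
        rw [ofAdd_zero, map_one, mul_one]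
    exact congrArg CommRingCat.Hom.hom h3
  exact ⟨Function.LeftInverse.injective (g := d) fun x => DFunLike.congr_fun h1 x,
    Function.RightInverse.surjective (g := d) fun x => DFunLike.congr_fun h2 x⟩

end laurent

/-! ### Torus torsors of glued schemes -/

namespace MutationDatum
variable {P I : Type u} [AddCommGroup P] {D : MutationDatum P I} (k : Type u) [Field k]
  {P' : Type u} [AddCommGroup P'] {D' : MutationDatum P' I}

/-- A splitting `ζ` of the cokernel `deg : P' → Λ` of a map `θ : P → P'` of gluing data. -/
structure Hom.Splitting (T : D.Hom D') (Λ : Type u) [AddCommGroup Λ] where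
  ζ : Λ →+ P'
  deg : P' →+ Λ
  deg_θ : ∀ v, deg (T.θ v) = 0
  deg_ζ : ∀ m, deg (ζ m) = m
  θ_injective : Function.Injective T.θ
  exists_θ : ∀ v', deg v' = 0 → ∃ v, T.θ v = v'

variable {Λ : Type u} [AddCommGroup Λ] {T : D.Hom D'} (Z : T.Splitting Λ) (n : D.Uniformizer)

namespace Hom.Splitting

open scoped Classical in
/-- The exponents of the monomials that trivialize the torsor over the chart `j`: they are `ζ m`, corrected
by a multiple of `θ (v i)` for the chart of a frozen index `i` so as to be invertible on this chart. -/
def chartExp : Option I → Λ →+ P'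
  | none => Z.ζ
  | some i => if i ∈ D.F then
      Z.ζ - (((smulAddHom ℤ P').flip (T.θ (n.v i))).comp ((D'.u i).comp Z.ζ)) else Z.ζ

lemma chartExp_frozen {i : I} (h : i ∈ D.F) (m : Λ) :
    Z.chartExp n (some i) m = Z.ζ m - D'.u i (Z.ζ m) • T.θ (n.v i) := by
  rw [chartExp, if_pos h]
  rfl

lemma chartExp_unfrozen {i : I} (h : i ∉ D.F) (m : Λ) : Z.chartExp n (some i) m = Z.ζ m := by
  rw [chartExp, if_neg h]

lemma u_chartExp {i : I} (h : i ∈ D.F) (m : Λ) : D'.u i (Z.chartExp n (some i) m) = 0 := by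
  rw [Z.chartExp_frozen n h, map_sub, map_zsmul, T.u_θ, n.u_v i h]
  simp

lemma chartExp_mem (j : Option I) (m : Λ) : Z.chartExp n j m ∈ D'.mon j := by
  rcases j with _ | i
  · trivial
  · exact fun h => (Z.u_chartExp n (T.F_eq ▸ h) m).ge

lemma deg_chartExp (j : Option I) (m : Λ) : Z.deg (Z.chartExp n j m) = m := by
  rcases j with _ | i
  · exact Z.deg_ζ m
  · by_cases h : i ∈ D.F
    · rw [Z.chartExp_frozen n h, map_sub, map_zsmul, Z.deg_θ, Z.deg_ζ, smul_zero, sub_zero]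
    · rw [Z.chartExp_unfrozen n h, Z.deg_ζ]

/-- The exponents of the functions on a chart of the torsor are the sums of an exponent on the base
and one of the exponents `chartExp m`. -/
lemma exists_mon (j : Option I) (v' : D'.mon j) :
    ∃ v : D.mon j, T.θ v + Z.chartExp n j (Z.deg v') = v' := by
  obtain ⟨v, hv⟩ := Z.exists_θ (v' - Z.chartExp n j (Z.deg v')) (by
    rw [map_sub, Z.deg_chartExp, sub_self])
  refine ⟨⟨v, ?_⟩, ?_⟩
  · rcases j with _ | i
    · trivial
    · intro h
      rw [← T.u_θ, hv, map_sub, Z.u_chartExp n h, sub_zero]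
      exact v'.2 (T.F_eq ▸ h)
  · change T.θ v + _ = _
    rw [hv, sub_add_cancel]

/-- The trivializing monomials as functions on the chart. -/
def chartMonomial (j : Option I) : Multiplicative Λ →* D'.ChartRing k j where
  toFun m := .single ⟨Z.chartExp n j m.toAdd, Z.chartExp_mem n j _⟩ 1
  map_one' := by
    rw [AddMonoidAlgebra.one_def]
    congr 1
    exact Subtype.ext (map_zero _)
  map_mul' a b := by
    rw [AddMonoidAlgebra.single_mul_single, one_mul]
    congr 1
    exact Subtype.ext (map_add _ _ _)

/-- The functions on a chart of the torsor are the Laurent polynomials over the chart of the base. -/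
lemma laurentHom_chartMonomial_bijective (j : Option I) :
    Function.Bijective (laurentHom (T.chartHom k j).toRingHom (Z.chartMonomial k n j)) := by
  let μ : Λ × D.mon j →+ D'.mon j :=
    { toFun := fun x => ⟨T.θ x.2 + Z.chartExp n j x.1,
        add_mem (T.map_mem j _) (Z.chartExp_mem n j _)⟩
      map_zero' := Subtype.ext (by simp)
      map_add' := fun x y => Subtype.ext (by
        simp only [Prod.snd_add, Prod.fst_add, AddSubmonoid.coe_add, map_add]
        abel) }
  have hμ : Function.Bijective μ := by
    constructor
    · intro x y hxy
      have h1 : T.θ x.2 + Z.chartExp n j x.1 = T.θ y.2 + Z.chartExp n j y.1 :=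
        congrArg Subtype.val hxy
      have h2 := congrArg Z.deg h1
      rw [map_add, map_add, Z.deg_θ, Z.deg_θ, Z.deg_chartExp, Z.deg_chartExp, zero_add, zero_add]
        at h2
      rw [h2] at h1
      exact Prod.ext h2 (Subtype.ext (Z.θ_injective (add_right_cancel h1)))
    · intro v'
      obtain ⟨v, hv⟩ := Z.exists_mon n j v'
      exact ⟨(Z.deg v', v), Subtype.ext hv⟩
  let e : AddMonoidAlgebra (D.ChartRing k j) Λ ≃+* D'.ChartRing k j :=
    AddMonoidAlgebra.curryRingEquiv.symm.trans
      (AddMonoidAlgebra.mapDomainRingEquiv k (AddEquiv.ofBijective μ hμ))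
  have he : laurentHom (T.chartHom k j).toRingHom (Z.chartMonomial k n j) = e.toRingHom := by
    refine laurentHom_ext fun m r => ?_
    induction r using AddMonoidAlgebra.induction_linear with
    | zero => simp
    | add x y hx hy => rw [AddMonoidAlgebra.single_add, map_add, map_add, hx, hy]
    | single v a =>
      rw [laurentHom_single]
      change T.chartHom k j (.single v a) * .single ⟨Z.chartExp n j m, _⟩ 1 =
        AddMonoidAlgebra.mapDomainRingEquiv k (AddEquiv.ofBijective μ hμ)
          (AddMonoidAlgebra.curryRingEquiv.symm (.single m (.single v a)))
      rw [T.chartHom_single k, AddMonoidAlgebra.single_mul_single, mul_one,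
        AddMonoidAlgebra.curryRingEquiv_symm_single]
      simp
      rfl
  rw [he]
  exact e.bijective

lemma chartHom_isHomogeneousOn (j : Option I) (x : D.ChartRing k j) :
    D'.IsHomogeneousOn Z.deg j 0 (T.chartHom k j x) := by
  classical
  induction x using AddMonoidAlgebra.induction_linear with
  | zero => intro v hv; simp at hv
  | add x y hx hy =>
    intro v hv
    rw [map_add] at hv
    by_cases h : (T.chartHom k j x).coeff v = 0
    · refine hy v fun h' => hv ?_
      rw [AddMonoidAlgebra.coeff_add, Finsupp.add_apply, h, h', add_zero]
    · exact hx v h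
  | single w r =>
    intro v hv
    rw [T.chartHom_single k, AddMonoidAlgebra.coeff_single, Finsupp.single_apply] at hv
    split_ifs at hv with h
    · rw [← h]
      exact Z.deg_θ _
    · exact absurd rfl hv

lemma isHomogeneousOn_mul_chartMonomial (j : Option I) (x : D.ChartRing k j) (m : Λ) :
    D'.IsHomogeneousOn Z.deg j m
      (T.chartHom k j x * Z.chartMonomial k n j (Multiplicative.ofAdd m)) := by
  classical
  induction x using AddMonoidAlgebra.induction_linear with
  | zero => intro v hv; simp at hv
  | add x y hx hy =>
    intro v hv
    rw [map_add, add_mul, AddMonoidAlgebra.coeff_add, Finsupp.add_apply] at hv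
    by_cases h : (T.chartHom k j x * Z.chartMonomial k n j (Multiplicative.ofAdd m)).coeff v = 0
    · refine hy v fun h' => hv ?_
      rw [h, h', add_zero]
    · exact hx v h
  | single w r =>
    intro v hv
    rw [T.chartHom_single k] at hv
    have h1 := AddMonoidAlgebra.single_mul_single (⟨T.θ w, T.map_mem j w⟩ : D'.mon j)
      ⟨Z.chartExp n j m, Z.chartExp_mem n j m⟩ r 1
    rw [show Z.chartMonomial k n j (Multiplicative.ofAdd m) =
      .single ⟨Z.chartExp n j m, Z.chartExp_mem n j m⟩ 1 from rfl, h1,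
      AddMonoidAlgebra.coeff_single, Finsupp.single_apply] at hv
    split_ifs at hv with h
    · rw [← h]
      change Z.deg (T.θ w + Z.chartExp n j m) = m
      rw [map_add, Z.deg_θ, Z.deg_chartExp, zero_add]
    · exact absurd rfl hv

/-- A homogeneous function on a chart of the torsor is the product of a function on the base and
one of the trivializing monomials. -/
lemma exists_eq_of_isHomogeneousOn (j : Option I) (m : Λ) (g : D'.ChartRing k j)
    (hg : D'.IsHomogeneousOn Z.deg j m g) : ∃ x : D.ChartRing k j,
      g = T.chartHom k j x * Z.chartMonomial k n j (Multiplicative.ofAdd m) := by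
  classical
  have h (v' : D'.mon j) : ∃ x : D.ChartRing k j, AddMonoidAlgebra.single v' (g.coeff v') =
      T.chartHom k j x * Z.chartMonomial k n j (Multiplicative.ofAdd m) := by
    by_cases h0 : g.coeff v' = 0
    · exact ⟨0, by rw [h0, map_zero, zero_mul, AddMonoidAlgebra.single_zero]⟩
    · obtain ⟨v, hv⟩ := Z.exists_mon n j v'
      rw [hg v' h0] at hv
      refine ⟨.single v (g.coeff v'), ?_⟩
      rw [T.chartHom_single k]
      refine Eq.trans ?_ (AddMonoidAlgebra.single_mul_single _ _ _ _).symm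
      rw [mul_one]
      congr 1
      exact Subtype.ext hv.symm
  choose x hx using h
  refine ⟨∑ v' ∈ g.coeff.support, x v', ?_⟩
  rw [map_sum, Finset.sum_mul]
  refine (AddMonoidAlgebra.sum_coeff_single g).symm.trans ?_
  exact Finset.sum_congr rfl fun v' _ => hx v'

/-- The trivializing monomials on the chart `j` differ from the monomials `z ^ (ζ m)` by powers of the
equation of the boundary of the chart. -/
lemma mutation_chartMonomial (j : Option I) (m : Λ) :
    D'.mutation k j (Z.chartMonomial k n j (Multiplicative.ofAdd m) *
        eqn k (n.map T) j ^ (D'.wt j (Z.ζ m)).toNat) =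
      algebraMap _ _ (D'.chartIncl k none (.single ⟨Z.ζ m, trivial⟩ 1)) *
        D'.mutation k j (eqn k (n.map T) j ^ (-D'.wt j (Z.ζ m)).toNat) := by
  rcases j with _ | i
  · have h1 (x : D'.ChartRing k none) : D'.mutation k none x =
        algebraMap _ _ (D'.chartIncl k none x) := DFunLike.congr_fun (D'.mutation_none k) x
    change D'.mutation k none (_ * 1 ^ _) = _ * D'.mutation k none (1 ^ _)
    rw [one_pow, one_pow, map_one, mul_one, mul_one, h1]
    rfl
  · change D'.mutation k (some i) (_ * _ ^ (D'.u i (Z.ζ m)).toNat) =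
      _ * D'.mutation k (some i) (_ ^ (-D'.u i (Z.ζ m)).toNat)
    set a := D'.u i (Z.ζ m) with ha
    have ha2 : a = (a.toNat : ℤ) - ((-a).toNat : ℤ) := by omega
    by_cases h : i ∈ D.F
    · have h' : i ∈ D'.F := T.F_eq ▸ h
      have hd : D'.denUnit k (some i) = 1 := by
        ext
        change algebraMap _ _ (D'.den k (some i)) = 1
        exact (congrArg _ (den_frozen D' k h')).trans (map_one _)
      have hmut (v : D'.mon (some i)) : D'.mutation k (some i) (.single v 1) =
          algebraMap _ _ (AddMonoidAlgebra.single (v : P') (1 : k)) := by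
        rw [mutation_single, hd, one_zpow, Units.val_one, mul_one]
      rw [eqn_frozen k _ h']
      change D'.mutation k (some i) (AddMonoidAlgebra.single _ _ * _) = _
      rw [AddMonoidAlgebra.single_pow, AddMonoidAlgebra.single_pow,
        AddMonoidAlgebra.single_mul_single, one_pow, one_mul, one_pow, hmut, hmut, ← map_mul,
        chartIncl_single, AddMonoidAlgebra.single_mul_single, one_mul]
      congr 2
      change Z.chartExp n (some i) m + a.toNat • T.θ (n.v i) =
        Z.ζ m + (-a).toNat • T.θ (n.v i)
      rw [Z.chartExp_frozen n h, ← ha]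
      nth_rw 1 [ha2]
      rw [sub_smul, natCast_zsmul, natCast_zsmul]
      abel
    · have h' : i ∉ D'.F := T.F_eq ▸ h
      have he : D'.mutation k (some i) (eqn k (n.map T) (some i)) =
          (D'.denUnit k (some i) : D'.OverlapRing k (some i)) := by
        rw [mutation, AlgHom.comp_apply, chartIncl_eqn_unfrozen k _ h', mutHom_den]
        rfl
      have hχ : D'.mutation k (some i) (Z.chartMonomial k n (some i) (Multiplicative.ofAdd m)) =
          algebraMap _ _ (AddMonoidAlgebra.single (Z.ζ m) (1 : k)) *
          ((D'.denUnit k (some i) ^ (-a) : (D'.OverlapRing k (some i))ˣ) :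
            D'.OverlapRing k (some i)) := by
        refine (D'.mutation_single k (some i) _).trans ?_
        change algebraMap _ _ (AddMonoidAlgebra.single (Z.chartExp n (some i) m) (1 : k)) *
          ((D'.denUnit k (some i) ^ (-D'.u i (Z.chartExp n (some i) m)) :
            (D'.OverlapRing k (some i))ˣ) : D'.OverlapRing k (some i)) = _
        rw [Z.chartExp_unfrozen n h]
      rw [map_mul, hχ, map_pow, map_pow, he, chartIncl_single, mul_assoc, ← Units.val_pow_eq_pow_val,
        ← Units.val_pow_eq_pow_val, ← Units.val_mul, ← zpow_natCast, ← zpow_natCast, ← zpow_add]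
      congr 4
      omega

end Hom.Splitting

end MutationDatum

lemma mapRingHom_bijective {R S : Type*} [CommRing R] [CommRing S] {Λ : Type*} [AddCommGroup Λ]
    {g : R →+* S} (hg : Function.Bijective g) :
    Function.Bijective (AddMonoidAlgebra.mapRingHom Λ g) := by
  refine ⟨(injective_iff_map_eq_zero _).2 fun x hx => ?_,
    fun x => exists_mapRingHom_eq g x fun m => hg.2 _⟩
  refine AddMonoidAlgebra.ext (Finsupp.ext fun m => ?_)
  have h := congrArg (fun y => y.coeff m) hx
  rw [AddMonoidAlgebra.coeff_mapRingHom] at h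
  exact (map_eq_zero_iff g hg.1).1 h

lemma nonempty_basicOpen_of_ne_zero {X : Scheme.{u}} {U : X.Opens} (hU : IsAffineOpen U)
    [IsDomain Γ(X, U)] {s : Γ(X, U)} (hs : s ≠ 0) : (X.basicOpen s : Set X).Nonempty := by
  by_contra h
  rw [Set.not_nonempty_iff_eq_empty] at h
  have h2 : X.basicOpen s = ⊥ := TopologicalSpace.Opens.ext h
  exact hs ((Scheme.isNilpotent_iff_basicOpen_eq_bot_of_isCompact hU.isCompact s).2 h2).eq_zero

namespace MutationDatum
variable {P I : Type u} [AddCommGroup P] {D : MutationDatum P I} (k : Type u) [Field k]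
  {P' : Type u} [AddCommGroup P'] {D' : MutationDatum P' I}

lemma basicOpen_eqn_le (n : D.Uniformizer) (j : Option I) :
    (D.scheme k).basicOpen (D.chartSection k j (eqn k n j)) ≤
      D.chartOpen k j ⊓ D.chartOpen k none := by
  intro x hx
  have h := (D.scheme k).basicOpen_le _ hx
  obtain ⟨y, rfl⟩ := (D.mem_chartOpen k).1 h
  exact ⟨h, (chart_mem_chartOpen_none k n j y).2 ((D.chart_mem_basicOpen k j _ y).1 hx)⟩

variable {Λ : Type u} [AddCommGroup Λ] {T : D.Hom D'} (Z : T.Splitting Λ) (n : D.Uniformizer)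

lemma Hom.Splitting.laurentHom_appLE_bijective (j : Option I)
    (h : D'.chartOpen k j ≤ T.schemeMap k ⁻¹ᵁ D.chartOpen k j) :
    Function.Bijective (laurentHom
      ((T.schemeMap k).appLE (D.chartOpen k j) (D'.chartOpen k j) h).hom
      ((D'.chartSection k j).toMonoidHom.comp (Z.chartMonomial k n j))) := by
  rw [← Function.Bijective.of_comp_iff _ (mapRingHom_bijective (D.chartSection_bijective k j)),
    ← RingHom.coe_comp, laurentHom_comp_mapRingHom]
  have h1 : ((T.schemeMap k).appLE (D.chartOpen k j) (D'.chartOpen k j) h).hom.comp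
      (D.chartSection k j) = (D'.chartSection k j).comp (T.chartHom k j).toRingHom :=
    RingHom.ext fun g => T.appLE_chartSection k j h g
  rw [h1, ← comp_laurentHom, RingHom.coe_comp]
  exact (D'.chartSection_bijective k j).comp (Z.laurentHom_chartMonomial_bijective k n j)

section baseChange
variable {k} {Y B : Scheme.{u}} {f : Y ⟶ D.scheme k} {q : B ⟶ D'.scheme k} {p : B ⟶ Y}
  (H : IsPullback q p (T.schemeMap k) f)

variable (f) in
/-- The part of `Y` over a chart. -/
abbrev pullChart (j : Option I) : Y.Opens := f ⁻¹ᵁ D.chartOpen k j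

variable (f) in
/-- The restriction to `Y` of functions on a chart. -/
def pullSection (j : Option I) : D.ChartRing k j →+* Γ(Y, pullChart f j) :=
  (f.app _).hom.comp (D.chartSection k j)

include n H in
lemma preimage_pullChart (j : Option I) :
    p ⁻¹ᵁ pullChart f j = q ⁻¹ᵁ D'.chartOpen k j := by
  rw [← T.preimage_chartOpen k n j]
  change (p ≫ f) ⁻¹ᵁ D.chartOpen k j = (q ≫ T.schemeMap k) ⁻¹ᵁ D.chartOpen k j
  rw [H.w]

/-- The restriction to `B` of functions on a chart. -/
def liftSection (j : Option I) :
    D'.ChartRing k j →+* Γ(B, p ⁻¹ᵁ pullChart f j) :=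
  (q.appLE (D'.chartOpen k j) _ (preimage_pullChart n H j).le).hom.comp (D'.chartSection k j)

lemma liftSection_chartHom (j : Option I) (g : D.ChartRing k j) :
    liftSection n H j (T.chartHom k j g) = p.app _ (pullSection f j g) := by
  have h : D'.chartOpen k j ≤ T.schemeMap k ⁻¹ᵁ D.chartOpen k j :=
    (T.preimage_chartOpen k n j).ge
  have h1 := T.appLE_chartSection k j h g
  have h2 := Scheme.Hom.appLE_comp_appLE q (T.schemeMap k) (D.chartOpen k j) (D'.chartOpen k j)
    (p ⁻¹ᵁ pullChart f j) h (preimage_pullChart n H j).le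
  have h3 := congrArg (fun φ => φ.hom (D.chartSection k j g)) h2
  have h4 : (q ≫ T.schemeMap k).appLE (D.chartOpen k j) (p ⁻¹ᵁ pullChart f j)
      ((preimage_pullChart n H j).le.trans fun _ hx => h hx) =
      f.app (D.chartOpen k j) ≫ p.app (pullChart f j) := by
    simp only [H.w]
    rw [← Scheme.Hom.comp_app, Scheme.Hom.app_eq_appLE]
    rfl
  change q.appLE _ _ _ (D'.chartSection k j (T.chartHom k j g)) = _
  rw [← h1]
  refine h3.trans ?_
  rw [h4]
  rfl

lemma laurentHom_liftSection_bijective [IsAffineHom f] (j : Option I) :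
    Function.Bijective (laurentHom (p.app (pullChart f j)).hom
      ((liftSection n H j).toMonoidHom.comp (Z.chartMonomial k n j))) := by
  have h : D'.chartOpen k j ≤ T.schemeMap k ⁻¹ᵁ D.chartOpen k j :=
    (T.preimage_chartOpen k n j).ge
  have hU : p ⁻¹ᵁ pullChart f j = q ⁻¹ᵁ D'.chartOpen k j ⊓ p ⁻¹ᵁ pullChart f j := by
    rw [← preimage_pullChart n H j, inf_idem]
  have h1 := (isIso_pushoutSection_iff H (le_refl (pullChart f j)) h hU).1
    (isIso_pushoutSection_of_isAffineOpen H _ _ _ (D.isAffineOpen_chartOpen k j)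
      ((D.isAffineOpen_chartOpen k j).preimage f) (D'.isAffineOpen_chartOpen k j))
  have h2 := laurentHom_bijective_of_isPushout h1 _ (Z.laurentHom_appLE_bijective k n j h)
  rw [Scheme.Hom.app_eq_appLE]
  exact h2

include n Z H in
lemma app_injective [IsAffineHom f] (j : Option I) :
    Function.Injective (p.app (pullChart f j)) := by
  intro x y hxy
  have h := (laurentHom_liftSection_bijective Z n H j).1
  have h2 : laurentHom (p.app (pullChart f j)).hom
      ((liftSection n H j).toMonoidHom.comp (Z.chartMonomial k n j)) (.single 0 x) =
      laurentHom (p.app (pullChart f j)).hom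
      ((liftSection n H j).toMonoidHom.comp (Z.chartMonomial k n j)) (.single 0 y) := by
    rw [laurentHom_single, laurentHom_single]
    exact congrArg (· * _) hxy
  have h3 := congrArg (fun z => z.coeff 0) (h h2)
  simpa using h3

variable (hdom : ∀ j, IsDomain Γ(Y, pullChart f j)) (hne : ∀ j, pullSection f j (eqn k n j) ≠ 0)

variable (f) in
include hdom hne in
/-- The pullback of the charts gives an integral scheme if the coordinate rings are domains and the equations
of the boundary do not vanish. -/
lemma isIntegral_pull [IsAffineHom f] : AlgebraicGeometry.IsIntegral Y := by
  refine isIntegral_of_charts (fun j => pullChart f j)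
    (fun j => (D.isAffineOpen_chartOpen k j).preimage f) hdom
    (fun y => D.exists_mem_chartOpen k (f y)) none fun j => ?_
  have := hdom j
  obtain ⟨y, hy⟩ := nonempty_basicOpen_of_ne_zero
    ((D.isAffineOpen_chartOpen k j).preimage f) (hne j)
  have h1 : f ⁻¹ᵁ (D.scheme k).basicOpen (D.chartSection k j (eqn k n j)) =
      Y.basicOpen (pullSection f j (eqn k n j)) := f.preimage_basicOpen _
  have h2 : y ∈ f ⁻¹ᵁ (D.scheme k).basicOpen (D.chartSection k j (eqn k n j)) := by
    rw [h1]
    exact hy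
  exact ⟨y, basicOpen_eqn_le k n j h2⟩

include n Z H hdom hne in
lemma isIntegral_lift [TwoUniqueSums Λ] [IsAffineHom f] : AlgebraicGeometry.IsIntegral B := by
  have hp : IsAffineHom p := by
    have := T.isAffineHom_schemeMap k n
    exact MorphismProperty.of_isPullback H inferInstance
  have hd (j : Option I) : IsDomain Γ(B, p ⁻¹ᵁ pullChart f j) := by
    have := hdom j
    have : IsDomain (AddMonoidAlgebra Γ(Y, pullChart f j) Λ) := NoZeroDivisors.to_isDomain _
    exact (RingEquiv.ofBijective _
      (laurentHom_liftSection_bijective Z n H j)).symm.toMulEquiv.isDomain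
  have ha (j : Option I) : IsAffineOpen (p ⁻¹ᵁ pullChart f j) :=
    ((D.isAffineOpen_chartOpen k j).preimage f).preimage p
  refine isIntegral_of_charts (fun j => p ⁻¹ᵁ pullChart f j) ha hd
    (fun b => D.exists_mem_chartOpen k (f (p b))) none fun j => ?_
  have := hd j
  obtain ⟨b, hb⟩ := nonempty_basicOpen_of_ne_zero (ha j)
    ((map_ne_zero_iff _ (app_injective Z n H j)).2 (hne j))
  have h1 : p ⁻¹ᵁ (f ⁻¹ᵁ (D.scheme k).basicOpen (D.chartSection k j (eqn k n j))) =
      B.basicOpen (p.app _ (pullSection f j (eqn k n j))) := by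
    have : f ⁻¹ᵁ (D.scheme k).basicOpen (D.chartSection k j (eqn k n j)) =
      Y.basicOpen (pullSection f j (eqn k n j)) := f.preimage_basicOpen _
    rw [this]
    exact p.preimage_basicOpen _
  have h2 : b ∈ p ⁻¹ᵁ (f ⁻¹ᵁ (D.scheme k).basicOpen (D.chartSection k j (eqn k n j))) := by
    rw [h1]
    exact hb
  exact ⟨b, basicOpen_eqn_le k n j h2⟩

include n Z H in
lemma nonempty_preimage [IsAffineHom f] [AlgebraicGeometry.IsIntegral Y]
    [AlgebraicGeometry.IsIntegral B] (U : Y.Opens) (hU : Nonempty U) : Nonempty (p ⁻¹ᵁ U) := by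
  obtain ⟨⟨y, hy⟩⟩ := hU
  obtain ⟨j, hj⟩ := D.exists_mem_chartOpen k (f y)
  obtain ⟨s, hs, hys⟩ := ((D.isAffineOpen_chartOpen k j).preimage f).exists_basicOpen_le
    ⟨y, hy⟩ hj
  have hs0 : s ≠ 0 := by
    rintro rfl
    simp at hys
  have h := (map_ne_zero_iff _ (app_injective Z n H j)).2 hs0
  have h2 : B.basicOpen (p.app _ s) ≠ ⊥ := fun h' => h ((basicOpen_eq_bot_iff _).1 h')
  obtain ⟨b, hb⟩ := (TopologicalSpace.Opens.ne_bot_iff_nonempty _).1 h2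
  have h3 : p ⁻¹ᵁ Y.basicOpen s = B.basicOpen (p.app _ s) := p.preimage_basicOpen s
  have h4 : b ∈ p ⁻¹ᵁ Y.basicOpen s := by
    rw [h3]
    exact hb
  exact ⟨⟨b, hs h4⟩⟩

end baseChange

end MutationDatum

namespace MutationDatum

/-! ### The torsor structure of the pullback -/

section torsor
variable {P I : Type u} [AddCommGroup P] {D : MutationDatum P I} {k : Type u} [Field k]
  {P' : Type u} [AddCommGroup P'] {D' : MutationDatum P' I}
  {Λ : Type u} [AddCommGroup Λ] {T : D.Hom D'} (Z : T.Splitting Λ) (n : D.Uniformizer)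
  {Y B : Scheme.{u}} {f : Y ⟶ D.scheme k} {q : B ⟶ D'.scheme k} {p : B ⟶ Y}
  (H : IsPullback q p (T.schemeMap k) f)
  [AlgebraicGeometry.IsIntegral B] [hB : ∀ j, Nonempty (p ⁻¹ᵁ pullChart f j)]

/-- Functions on a chart as rational functions on `B`. -/
def ratB (j : Option I) : D'.ChartRing k j →+* B.functionField :=
  (B.germToFunctionField (p ⁻¹ᵁ pullChart f j)).hom.comp (liftSection n H j)

lemma germ_resChart {W : B.Opens} [Nonempty W] {j : Option I} (hW : W ≤ q ⁻¹ᵁ D'.chartOpen k j)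
    (g : D'.ChartRing k j) :
    B.germToFunctionField W (D'.resChart q hW g) = ratB n H j g := by
  have h : W ≤ p ⁻¹ᵁ pullChart f j := hW.trans (preimage_pullChart n H j).ge
  refine Eq.trans ?_ (germToFunctionField_res h (liftSection n H j g))
  congr 1
  change _ = (q.appLE _ _ _ ≫ B.presheaf.map (homOfLE h).op).hom (D'.chartSection k j g)
  rw [Scheme.Hom.appLE_map]
  rfl

lemma germ_appLE_res {W : (D'.scheme k).Opens} {O : B.Opens} [Nonempty O] (hO : O ≤ q ⁻¹ᵁ W)
    {j : Option I} (hW : W ≤ D'.chartOpen k j) (g : D'.ChartRing k j) :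
    B.germToFunctionField O (q.appLE W O hO ((D'.scheme k).presheaf.map (homOfLE hW).op
      (D'.chartSection k j g))) = ratB n H j g := by
  have h : O ≤ q ⁻¹ᵁ D'.chartOpen k j := hO.trans fun _ hx => hW hx
  refine Eq.trans ?_ (germ_resChart n H h g)
  congr 1
  exact congrArg (fun φ => φ.hom (D'.chartSection k j g)) (q.map_appLE hO (homOfLE hW).op)

lemma ratB_transfer (j : Option I) (x x' : D'.ChartRing k j) (y : D'.ChartRing k none)
    (h : D'.mutation k j x = algebraMap _ _ (D'.chartIncl k none y) * D'.mutation k j x') :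
    ratB n H j x = ratB n H none y * ratB n H j x' := by
  let W := D'.chartOpen k j ⊓ D'.chartOpen k none
  have hne : Nonempty (q ⁻¹ᵁ W) := by
    obtain ⟨x, hx⟩ := hB j
    obtain ⟨y, hy⟩ := hB none
    obtain ⟨z, -, hz⟩ := (PreirreducibleSpace.isPreirreducible_univ (X := B)) _ _
      (p ⁻¹ᵁ pullChart f j).isOpen (p ⁻¹ᵁ pullChart f none).isOpen ⟨x, trivial, hx⟩
      ⟨y, trivial, hy⟩
    exact ⟨⟨z, (preimage_pullChart n H j).le hz.1, (preimage_pullChart n H none).le hz.2⟩⟩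
  have h1 := congrArg (fun s => B.germToFunctionField (q ⁻¹ᵁ W) (q.appLE W _ le_rfl s))
    (D'.chartSection_transfer k j x x' y h (n.map T))
  simp only [map_mul] at h1
  rw [germ_appLE_res n H, germ_appLE_res n H, germ_appLE_res n H] at h1
  exact h1

/-- The trivializing monomials on the chart `j` as rational functions on `B`. -/
def ratMonomial (j : Option I) : Multiplicative Λ →* B.functionField :=
  (ratB n H j).toMonoidHom.comp (Z.chartMonomial k n j)

variable [AlgebraicGeometry.IsIntegral Y] [hY : ∀ j, Nonempty (pullChart f j)]

variable (f) in
/-- Functions on a chart as rational functions on `Y`. -/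
def ratY (j : Option I) : D.ChartRing k j →+* Y.functionField :=
  (Y.germToFunctionField (pullChart f j)).hom.comp (pullSection f j)

variable (hp : ∀ U : Y.Opens, Nonempty U → Nonempty (p ⁻¹ᵁ U))

lemma ratB_chartHom (j : Option I) (g : D.ChartRing k j) :
    ratB n H j (T.chartHom k j g) = functionFieldMap p hp (ratY f j g) := by
  refine Eq.trans ?_ (functionFieldMap_germ p hp (pullChart f j) _).symm
  exact congrArg _ (liftSection_chartHom n H j g)

lemma map_laurentHom_liftSection (j : Option I) (x : AddMonoidAlgebra Γ(Y, pullChart f j) Λ) :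
    B.germToFunctionField (p ⁻¹ᵁ pullChart f j) (laurentHom (p.app (pullChart f j)).hom
      ((liftSection n H j).toMonoidHom.comp (Z.chartMonomial k n j)) x) =
    laurentHom (functionFieldMap p hp) (ratMonomial Z n H j)
      (AddMonoidAlgebra.mapRingHom Λ (Y.germToFunctionField (pullChart f j)).hom x) := by
  change ((B.germToFunctionField _).hom.comp (laurentHom _ _)) x =
    ((laurentHom _ _).comp (AddMonoidAlgebra.mapRingHom Λ _)) x
  rw [comp_laurentHom, laurentHom_comp_mapRingHom]
  have : (B.germToFunctionField (p ⁻¹ᵁ pullChart f j)).hom.comp (p.app (pullChart f j)).hom =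
      (functionFieldMap p hp).comp (Y.germToFunctionField (pullChart f j)).hom :=
    RingHom.ext fun s => (functionFieldMap_germ p hp _ s).symm
  rw [this]
  rfl

/-- The functions on the chart `j` of `B` are the Laurent polynomials in the trivializing monomials. -/
lemma mem_regular_iff_laurentHom [IsAffineHom f] (j : Option I) (F : B.functionField) :
    F ∈ regular B (p ⁻¹ᵁ pullChart f j) ↔
      ∃ x, laurentHom (functionFieldMap p hp) (ratMonomial Z n H j) x = F ∧
        ∀ m, x.coeff m ∈ regular Y (pullChart f j) := by
  constructor
  · rintro ⟨s, rfl⟩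
    obtain ⟨x, rfl⟩ := (laurentHom_liftSection_bijective Z n H j).2 s
    refine ⟨_, (map_laurentHom_liftSection Z n H hp j x).symm, fun m => ?_⟩
    rw [AddMonoidAlgebra.coeff_mapRingHom]
    exact germ_mem_regular _ _
  · rintro ⟨x, rfl, hx⟩
    obtain ⟨y, rfl⟩ := exists_mapRingHom_eq _ x hx
    rw [← map_laurentHom_liftSection Z n H hp j y]
    exact germ_mem_regular _ _

lemma laurentHom_ratMonomial_injective [IsAffineHom f] (j : Option I) : Function.Injective
    (laurentHom (functionFieldMap p hp) (ratMonomial Z n H j)) := by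
  classical
  refine (injective_iff_map_eq_zero _).2 fun x hx => ?_
  have hfrac := functionField_isFractionRing_of_isAffineOpen Y (pullChart f j)
    ((D.isAffineOpen_chartOpen k j).preimage f)
  obtain ⟨b, hb⟩ := IsLocalization.exist_integer_multiples
    (nonZeroDivisors Γ(Y, pullChart f j)) x.coeff.support x.coeff
  have hb0 : Y.germToFunctionField (pullChart f j) b.1 ≠ 0 := by
    rw [Ne, map_eq_zero_iff _ (Y.germToFunctionField_injective _)]
    exact nonZeroDivisors.coe_ne_zero b
  set c := Y.germToFunctionField (pullChart f j) b.1
  -- after multiplication by a common denominator the coefficients are regular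
  obtain ⟨y, hy⟩ := exists_mapRingHom_eq (Y.germToFunctionField (pullChart f j)).hom (c • x)
    fun m => by
      rw [AddMonoidAlgebra.coeff_smul_apply]
      by_cases hm : m ∈ x.coeff.support
      · obtain ⟨r, hr⟩ := hb m hm
        refine ⟨r, hr.trans ?_⟩
        exact Algebra.smul_def _ _
      · rw [Finsupp.notMem_support_iff.1 hm, smul_zero]
        exact zero_mem _
  have h1 := map_laurentHom_liftSection Z n H hp j y
  have h2 : laurentHom (functionFieldMap p hp) (ratMonomial Z n H j) (c • x) = 0 := by
    refine (AddMonoidAlgebra.liftNC_smul _ _ _ _).trans ?_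
    exact (congrArg _ hx).trans (mul_zero _)
  rw [hy, h2, map_eq_zero_iff _ (B.germToFunctionField_injective _)] at h1
  have h3 : y = 0 := (laurentHom_liftSection_bijective Z n H j).1 (h1.trans (map_zero _).symm)
  rw [h3, map_zero] at hy
  exact (smul_eq_zero.1 hy.symm).resolve_left hb0

lemma ratMonomial_mul (j : Option I) (hj : ratY f j (eqn k n j) ≠ 0) (m : Λ) :
    ratMonomial Z n H none (Multiplicative.ofAdd m) = ratMonomial Z n H j (Multiplicative.ofAdd m) *
      functionFieldMap p hp (ratY f j (eqn k n j)) ^ D'.wt j (Z.ζ m) := by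
  have h1 := ratB_transfer n H j _ _ _ (Z.mutation_chartMonomial k n j m)
  rw [map_mul, map_pow, map_pow, ← T.chartHom_eqn k n j, ratB_chartHom n H hp] at h1
  set τ := functionFieldMap p hp (ratY f j (eqn k n j))
  have hτ : τ ≠ 0 := (map_ne_zero _).2 hj
  set a := D'.wt j (Z.ζ m)
  have ha : a = (a.toNat : ℤ) - ((-a).toNat : ℤ) := by omega
  rw [ha, zpow_sub₀ hτ, zpow_natCast, zpow_natCast, ← mul_div_assoc, eq_div_iff (pow_ne_zero _ hτ)]
  exact h1.symm

section
variable [Fintype I] (J : I → Y.IdealSheafData) (w : Λ →+ (I → ℤ))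

variable (f) in
lemma prod_divisorEqn (j : Option I) (a : I → ℤ) (b : ℤ) (h : ∀ i, j = some i → b = a i)
    (h0 : j = none → b = 0) :
    ∏ i, Y.germToFunctionField (pullChart f j) (pullSection f j (divisorEqn k n j i)) ^ a i =
      ratY f j (eqn k n j) ^ b := by
  classical
  rcases j with _ | i
  · rw [h0 rfl, zpow_zero]
    refine Finset.prod_eq_one fun i _ => ?_
    rw [divisorEqn, if_neg (by simp), map_one, map_one, one_zpow]
  · rw [h i rfl, Finset.prod_eq_single i]
    · rw [divisorEqn, if_pos rfl]
      rfl
    · intro i' _ hi'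
      rw [divisorEqn, if_neg (by simpa using hi'.symm), map_one, map_one, one_zpow]
    · simp

/-- The pullback `B` of a split map of gluing data as a torsor over `Y`. -/
def torsorAtlas [IsAffineHom f] [IsAffineHom p] (hne : ∀ j, pullSection f j (eqn k n j) ≠ 0)
    (hw : ∀ m i, D'.u i (Z.ζ m) = w m i)
    (hJ : ∀ j i, (J i).ideal ⟨pullChart f j, (D.isAffineOpen_chartOpen k j).preimage f⟩ =
      Ideal.span {pullSection f j (divisorEqn k n j i)}) : TorsorAtlas p J w where
  ι := Option I
  V j := ⟨pullChart f j, (D.isAffineOpen_chartOpen k j).preimage f⟩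
  nonempty := hY
  cover y := D.exists_mem_chartOpen k (f y)
  affine_preimage j := ((D.isAffineOpen_chartOpen k j).preimage f).preimage p
  t j i := pullSection f j (divisorEqn k n j i)
  t_ne_zero j i := by
    rw [divisorEqn]
    split_ifs
    · exact hne j
    · rw [map_one]
      exact one_ne_zero
  ideal_eq := hJ
  dominant := hp
  χ := ratMonomial Z n H none
  injective := laurentHom_ratMonomial_injective Z n H hp none
  mem_regular j _ F := by
    have hτ : ratY f j (eqn k n j) ≠ 0 := by
      refine (map_ne_zero_iff _ (Y.germToFunctionField_injective _)).2 (hne j)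
    let c : Multiplicative Λ →* (Y.functionField)ˣ :=
      { toFun := fun m => Units.mk0 _ hτ ^ D'.wt j (Z.ζ m.toAdd)
        map_one' := by simp
        map_mul' := fun a b => by rw [toAdd_mul, map_add, map_add, zpow_add] }
    have hc (m : Λ) : (c (Multiplicative.ofAdd m) : Y.functionField) =
        ∏ i, Y.germToFunctionField (pullChart f j) (pullSection f j (divisorEqn k n j i)) ^
          w m i := by
      rw [prod_divisorEqn n f j (w m) (D'.wt j (Z.ζ m))]
      · exact Units.val_zpow_eq_zpow_val (Units.mk0 _ hτ) _
      · rintro i rfl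
        exact hw m i
      · rintro rfl
        rfl
    have hχ (m : Multiplicative Λ) : ratMonomial Z n H none m =
        ratMonomial Z n H j m * functionFieldMap p hp (c m) := by
      refine (ratMonomial_mul Z n H hp j hτ m.toAdd).trans ?_
      rw [← map_zpow₀]
      congr 2
      exact (Units.val_zpow_eq_zpow_val (Units.mk0 _ hτ) _).symm
    refine (mem_regular_iff_laurentHom Z n H hp j F).trans ?_
    constructor
    · rintro ⟨x, rfl, hx⟩
      obtain ⟨y, rfl⟩ := rescale_surjective c x
      refine ⟨y, (laurentHom_rescale _ c _ _ hχ y).symm, fun m => ?_⟩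
      have := hx m
      rw [coeff_rescale, hc] at this
      exact this
    · rintro ⟨y, rfl, hy⟩
      refine ⟨rescale c y, laurentHom_rescale _ c _ _ hχ y, fun m => ?_⟩
      rw [coeff_rescale, hc]
      exact hy m

end

end torsor

end MutationDatum

namespace MutationDatum

/-! ### The graded isomorphism -/

section graded
variable {P I : Type u} [AddCommGroup P] {D : MutationDatum P I} {k : Type u} [Field k]
  {P' : Type u} [AddCommGroup P'] {D' : MutationDatum P' I}
  {Λ : Type u} [AddCommGroup Λ] {T : D.Hom D'} (Z : T.Splitting Λ) (n : D.Uniformizer)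
  {Y B : Scheme.{u}} {f : Y ⟶ D.scheme k} {q : B ⟶ D'.scheme k} {p : B ⟶ Y}
  (H : IsPullback q p (T.schemeMap k) f)
  [AlgebraicGeometry.IsIntegral B] [hB : ∀ j, Nonempty (p ⁻¹ᵁ pullChart f j)]
  [AlgebraicGeometry.IsIntegral Y] [hY : ∀ j, Nonempty (pullChart f j)]
  [Fintype I] {J : I → Y.IdealSheafData} {w : Λ →+ (I → ℤ)} (A : TorsorAtlas p J w)

/-- A homogeneous function on a chart as a rational function. -/
lemma exists_ratB_eq (j : Option I)
    (hχ : ∀ m, ∃ c, ratMonomial Z n H j (Multiplicative.ofAdd m) =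
      functionFieldMap p A.dominant c * A.χ (Multiplicative.ofAdd m))
    (m : Λ) (g : D'.ChartRing k j) (hg : D'.IsHomogeneousOn Z.deg j m g) :
    ∃ c, ratB n H j g = A.Ψ (.single m c) := by
  obtain ⟨x, rfl⟩ := Z.exists_eq_of_isHomogeneousOn k n j m g hg
  obtain ⟨c, hc⟩ := hχ m
  refine ⟨ratY f j x * c, ?_⟩
  rw [map_mul, ratB_chartHom n H A.dominant, A.Ψ_single, map_mul, mul_assoc, ← hc]
  rfl

lemma eq_of_isHomogeneousSection
    (hχ : ∀ j m, ∃ c, ratMonomial Z n H j (Multiplicative.ofAdd m) =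
      functionFieldMap p A.dominant c * A.χ (Multiplicative.ofAdd m))
    (U : Y.Opens) [Nonempty U] (m : Λ) (s : multisections J w U)
    (h : D'.IsHomogeneousSection Z.deg q m (p ⁻¹ᵁ U) (A.iso U s)) :
    ∃ c, s.1 = .single m c := by
  have hnU := A.dominant U ‹_›
  obtain ⟨y, hy⟩ := id hnU
  obtain ⟨W, hW, j, hj, hyW, d, g, h, hg, hh, hu, he⟩ := h y hy
  have : Nonempty W := ⟨⟨y, hyW⟩⟩
  have hu2 := hu.map (B.germToFunctionField W).hom
  have he2 := congrArg (B.germToFunctionField W) he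
  rw [map_mul] at he2
  have h1 : B.germToFunctionField W (B.presheaf.map (homOfLE hW).op (A.iso U s)) = A.Ψ s.1 :=
    (germToFunctionField_res hW _).trans (A.germ_iso U s)
  rw [h1, germ_resChart n H, germ_resChart n H] at he2
  have hu3 : ratB n H j h ≠ 0 := by
    rw [← germ_resChart n H hj]
    exact hu2.ne_zero
  obtain ⟨a, ha⟩ := exists_ratB_eq Z n H A j (hχ j) _ g hg
  obtain ⟨b, hb⟩ := exists_ratB_eq Z n H A j (hχ j) _ h hh
  rw [ha, hb] at he2
  rw [hb] at hu3
  have hb0 : b ≠ 0 := by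
    rintro rfl
    exact hu3 (by rw [AddMonoidAlgebra.single_zero]; exact map_zero _)
  refine ⟨a * b⁻¹, A.injective ?_⟩
  refine mul_right_cancel₀ hu3 (he2.trans ?_)
  refine Eq.trans ?_ (map_mul A.Ψ _ _)
  rw [AddMonoidAlgebra.single_mul_single, inv_mul_cancel_right₀ hb0, add_comm]

variable [IsAffineHom p]

lemma isHomogeneousSection_iso [IsClosedImmersion f] (hne : ∀ j, pullSection f j (eqn k n j) ≠ 0)
    (hw : ∀ m i, D'.u i (Z.ζ m) = w m i)
    (hJ : ∀ j i, (J i).ideal ⟨pullChart f j, (D.isAffineOpen_chartOpen k j).preimage f⟩ =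
      Ideal.span {pullSection f j (divisorEqn k n j i)})
    (hp : ∀ U : Y.Opens, Nonempty U → Nonempty (p ⁻¹ᵁ U))
    (U : Y.Opens) [Nonempty U] (m : Λ) (s : multisections J w U)
    (hs : ∀ m', s.1.coeff m' ≠ 0 → m' = m) :
    D'.IsHomogeneousSection Z.deg q m (p ⁻¹ᵁ U)
      ((torsorAtlas Z n H hp J w hne hw hJ).iso U s) := by
  intro b hb
  set A := torsorAtlas Z n H hp J w hne hw hJ
  have hnU := A.dominant U ‹_›
  have hsingle : s.1 = .single m (s.1.coeff m) := by
    classical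
    refine AddMonoidAlgebra.ext (Finsupp.ext fun m' => ?_)
    rw [AddMonoidAlgebra.coeff_single, Finsupp.single_apply]
    split_ifs with h
    · rw [h]
    · by_contra h0
      exact h (hs m' h0).symm
  obtain ⟨j, t, ht0, htU, hbt⟩ : ∃ (j : Option I) (t : Γ(Y, pullChart f j)),
      t ≠ 0 ∧ Y.basicOpen t ≤ U ∧ p b ∈ Y.basicOpen t := A.exists_basicOpen_le U (p b) hb
  obtain ⟨N, r, hr⟩ : ∃ N : ℕ, Y.germToFunctionField (pullChart f j) t ^ N * (s.1.coeff m *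
      ∏ i, Y.germToFunctionField (pullChart f j) (pullSection f j (divisorEqn k n j i)) ^ w m i) ∈
      regular Y (pullChart f j) := (A.mem_divisorSections m U _).1 (s.2 m) j t ht0 htU
  have hsurj : Function.Surjective (pullSection f j) :=
    (f.app_surjective _ (D.isAffineOpen_chartOpen k j)).comp (D.chartSection_bijective k j).2
  obtain ⟨t', rfl⟩ := hsurj t
  obtain ⟨r', rfl⟩ := hsurj r
  have hW : p ⁻¹ᵁ Y.basicOpen (pullSection f j t') ≤ p ⁻¹ᵁ U := fun _ hx => htU hx
  have hWj : p ⁻¹ᵁ Y.basicOpen (pullSection f j t') ≤ q ⁻¹ᵁ D'.chartOpen k j :=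
    le_trans (fun _ hx => Y.basicOpen_le _ hx) (preimage_pullChart n H j).le
  have : Nonempty (Y.basicOpen (pullSection f j t')) := nonempty_basicOpen ht0
  have : Nonempty (p ⁻¹ᵁ Y.basicOpen (pullSection f j t') : B.Opens) := ⟨⟨b, hbt⟩⟩
  refine ⟨p ⁻¹ᵁ Y.basicOpen (pullSection f j t'), hW, j, hWj, hbt, 0,
    T.chartHom k j r' * Z.chartMonomial k n j (Multiplicative.ofAdd m), T.chartHom k j (t' ^ N),
    ?_, Z.chartHom_isHomogeneousOn k j _, ?_, ?_⟩
  · rw [zero_add]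
    exact Z.isHomogeneousOn_mul_chartMonomial k n j r' m
  · have h1 : D'.resChart q hWj (T.chartHom k j (t' ^ N)) =
        p.app _ (Y.presheaf.map (homOfLE (Y.basicOpen_le (pullSection f j t'))).op
          (pullSection f j t')) ^ N := by
      apply B.germToFunctionField_injective _
      rw [germ_resChart n H, ratB_chartHom n H hp, map_pow, map_pow, map_pow,
        ← functionFieldMap_germ p hp]
      congr 2
      exact (germToFunctionField_res (Y.basicOpen_le _) _).symm
    rw [h1]
    exact ((isUnit_res_basicOpen _).map (p.app _).hom).pow N
  · apply B.germToFunctionField_injective (p ⁻¹ᵁ Y.basicOpen (pullSection f j t'))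
    rw [map_mul, germ_resChart n H, germ_resChart n H, map_mul (ratB n H j),
      ratB_chartHom n H hp, ratB_chartHom n H hp]
    have h1 := (germToFunctionField_res hW (A.iso U s)).trans (A.germ_iso U s)
    refine (congrArg (· * _) h1).trans ?_
    change A.Ψ s.1 * _ = _ * ratMonomial Z n H j (Multiplicative.ofAdd m)
    rw [hsingle, A.Ψ_single]
    change _ * ratMonomial Z n H none (Multiplicative.ofAdd m) * _ = _
    have hτ : ratY f j (eqn k n j) ≠ 0 :=
      (map_ne_zero_iff _ (Y.germToFunctionField_injective _)).2 (hne j)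
    rw [ratMonomial_mul Z n H hp j hτ]
    have h2 : ratY f j r' = ratY f j (t' ^ N) * (s.1.coeff m * ratY f j (eqn k n j) ^
        D'.wt j (Z.ζ m)) := by
      rw [← prod_divisorEqn n f j (w m) (D'.wt j (Z.ζ m)), map_pow]
      · exact hr
      · rintro i rfl
        exact hw m i
      · rintro rfl
        rfl
    rw [h2, map_mul (functionFieldMap p hp), map_mul (functionFieldMap p hp), map_zpow₀]
    change functionFieldMap p hp _ * _ * _ = _
    ring

include H in
/-- The functions on the pullback `B`, as a graded algebra over `Y`. -/
theorem nonempty_gradedAlgIso [IsClosedImmersion f]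
    (hne : ∀ j, pullSection f j (eqn k n j) ≠ 0)
    (hw : ∀ m i, D'.u i (Z.ζ m) = w m i)
    (hJ : ∀ j i, (J i).ideal ⟨pullChart f j, (D.isAffineOpen_chartOpen k j).preimage f⟩ =
      Ideal.span {pullSection f j (divisorEqn k n j i)})
    (hp : ∀ U : Y.Opens, Nonempty U → Nonempty (p ⁻¹ᵁ U)) :
    Nonempty (GradedAlgIso J w Z.deg Z.ζ q p (f ⁻¹ᵁ D.chartOpen k none)) := by
  let A := torsorAtlas Z n H hp J w hne hw hJ
  refine ⟨⟨fun U _ => A.iso U, fun U U' _ _ h s => A.iso_naturality U U' h s,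
    fun U _ s => A.iso_algebra U s, fun U _ m s => ⟨fun h =>
      isHomogeneousSection_iso Z n H hne hw hJ hp U m s h, fun h => ?_⟩, fun U _ m hU => ?_⟩⟩
  · obtain ⟨c, hc⟩ := eq_of_isHomogeneousSection Z n H A (fun j m => by
      have hτ : ratY f j (eqn k n j) ≠ 0 :=
        (map_ne_zero_iff _ (Y.germToFunctionField_injective _)).2 (hne j)
      refine ⟨(ratY f j (eqn k n j) ^ D'.wt j (Z.ζ m))⁻¹, ?_⟩
      change _ = _ * ratMonomial Z n H none (Multiplicative.ofAdd m)
      rw [ratMonomial_mul Z n H hp j hτ, map_inv₀, map_zpow₀, mul_comm, mul_inv_cancel_right₀]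
      exact zpow_ne_zero _ ((map_ne_zero _).2 hτ)) U m s h
    classical
    intro m' hm'
    rw [hc, AddMonoidAlgebra.coeff_single, Finsupp.single_apply] at hm'
    split_ifs at hm' with h'
    · exact h'.symm
    · exact absurd rfl hm'
  · have hU' : p ⁻¹ᵁ U ≤ q ⁻¹ᵁ D'.chartOpen k none :=
      le_trans (fun _ hx => hU hx) (preimage_pullChart n H none).le
    have := hp U ‹_›
    have h1 : A.Ψ (.single m 1) = B.germToFunctionField (p ⁻¹ᵁ U)
        (D'.resChart q hU' (.single ⟨Z.ζ m, trivial⟩ 1)) := by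
      rw [A.Ψ_single, map_one, one_mul, germ_resChart n H]
      rfl
    have hm : AddMonoidAlgebra.single m 1 ∈ multisections J w U := by
      obtain ⟨x, hx, hx2⟩ := (A.mem_regular_preimage U _).1 (germ_mem_regular (p ⁻¹ᵁ U)
        (D'.resChart q hU' (.single ⟨Z.ζ m, trivial⟩ 1)))
      rwa [A.injective (hx2.trans h1.symm)] at hx
    refine ⟨hU', hm, B.germToFunctionField_injective (p ⁻¹ᵁ U) ?_⟩
    exact (A.germ_iso U _).trans h1

end graded

/-- The pullback of a split map of gluing data along a closed immersion `f`, if the coordinate rings of the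
charts of `Y` are domains in which the equations of the boundary do not vanish. -/
theorem exists_isIntegral_gradedAlgIso {P I : Type u} [AddCommGroup P] {D : MutationDatum P I}
    {k : Type u} [Field k] {P' : Type u} [AddCommGroup P'] {D' : MutationDatum P' I}
    {Λ : Type u} [AddCommGroup Λ] [TwoUniqueSums Λ] {T : D.Hom D'} (Z : T.Splitting Λ)
    (n : D.Uniformizer) {Y B : Scheme.{u}} {f : Y ⟶ D.scheme k} {q : B ⟶ D'.scheme k}
    {p : B ⟶ Y} (H : IsPullback q p (T.schemeMap k) f) [IsClosedImmersion f] [Fintype I]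
    {J : I → Y.IdealSheafData} {w : Λ →+ (I → ℤ)}
    (hdom : ∀ j, IsDomain Γ(Y, pullChart f j))
    (hne : ∀ j, pullSection f j (eqn k n j) ≠ 0)
    (hw : ∀ m i, D'.u i (Z.ζ m) = w m i)
    (hJ : ∀ j i, (J i).ideal ⟨pullChart f j, (D.isAffineOpen_chartOpen k j).preimage f⟩ =
      Ideal.span {pullSection f j (divisorEqn k n j i)}) :
    ∃ _ : AlgebraicGeometry.IsIntegral Y, IsAffineHom p ∧
      Nonempty (GradedAlgIso J w Z.deg Z.ζ q p (f ⁻¹ᵁ D.chartOpen k none)) := by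
  have hY := isIntegral_pull n f hdom hne
  have hB := isIntegral_lift Z n H hdom hne
  have hp : IsAffineHom p := by
    have := T.isAffineHom_schemeMap k n
    exact MorphismProperty.of_isPullback H inferInstance
  have hdense := nonempty_preimage Z n H
  have hV (j : Option I) : Nonempty (pullChart f j) := by
    have h : Y.basicOpen (pullSection f j (eqn k n j)) ≠ ⊥ :=
      fun h => hne j ((basicOpen_eq_bot_iff _).1 h)
    obtain ⟨y, hy⟩ := (TopologicalSpace.Opens.ne_bot_iff_nonempty _).1 h
    exact ⟨⟨y, Y.basicOpen_le _ hy⟩⟩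
  have hV' (j : Option I) : Nonempty (p ⁻¹ᵁ pullChart f j) := hdense _ (hV j)
  exact ⟨hY, hp, nonempty_gradedAlgIso Z n H hne hw hJ hdense⟩

end MutationDatum

/-! ### Pullback of ideals -/

lemma ker_eq_map_of_isPushout {R A S C : CommRingCat.{u}} {α : R ⟶ A} {β : R ⟶ S} {a : A ⟶ C}
    {b : S ⟶ C} (H : IsPushout α β a b) (hβ : Function.Surjective β.hom) :
    RingHom.ker a.hom = (RingHom.ker β.hom).map α.hom := by
  apply le_antisymm
  · intro x hx
    let 𝔞 := (RingHom.ker β.hom).map α.hom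
    have hle : RingHom.ker β.hom ≤ RingHom.ker ((Ideal.Quotient.mk 𝔞).comp α.hom) := fun y hy =>
      Ideal.Quotient.eq_zero_iff_mem.2 (Ideal.mem_map_of_mem _ hy)
    let s : S ⟶ CommRingCat.of (A ⧸ 𝔞) := CommRingCat.ofHom
      (RingHom.liftOfSurjective β.hom hβ ⟨(Ideal.Quotient.mk 𝔞).comp α.hom, hle⟩)
    have hw : α ≫ CommRingCat.ofHom (Ideal.Quotient.mk 𝔞) = β ≫ s :=
      CommRingCat.hom_ext (RingHom.ext fun y => (RingHom.liftOfRightInverse_comp_apply β.hom _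
        (Function.rightInverse_surjInv hβ) ⟨(Ideal.Quotient.mk 𝔞).comp α.hom, hle⟩ y).symm)
    have h := congrArg (fun g => g.hom x) (H.inl_desc _ s hw)
    rw [← Ideal.Quotient.eq_zero_iff_mem (I := 𝔞)]
    refine h.symm.trans ?_
    change (H.desc _ s hw).hom (a.hom x) = 0
    rw [RingHom.mem_ker.1 hx, map_zero]
  · rw [Ideal.map_le_iff_le_comap]
    intro y hy
    have h := congrArg (fun g => g.hom y) H.w
    refine h.trans ?_
    change b.hom (β.hom y) = 0
    rw [RingHom.mem_ker.1 hy, map_zero]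

lemma ideal_comap {X Y : Scheme.{u}} (f : Y ⟶ X) [IsAffineHom f] (J : X.IdealSheafData)
    (U : X.affineOpens) :
    (J.comap f).ideal ⟨f ⁻¹ᵁ U.1, U.2.preimage f⟩ = (J.ideal U).map (f.app U.1).hom := by
  have H := IsPullback.of_hasPullback f J.subschemeι
  have h1 := (isIso_pushoutSection_iff H (le_refl (J.subschemeι ⁻¹ᵁ U.1)) (le_refl (f ⁻¹ᵁ U.1))
    (UY := pullback.fst f J.subschemeι ⁻¹ᵁ f ⁻¹ᵁ U.1) (by
      have : pullback.snd f J.subschemeι ⁻¹ᵁ J.subschemeι ⁻¹ᵁ U.1 =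
          pullback.fst f J.subschemeι ⁻¹ᵁ f ⁻¹ᵁ U.1 := by
        rw [← Scheme.Hom.comp_preimage, ← Scheme.Hom.comp_preimage, pullback.condition]
      rw [this, inf_idem])).1
    (isIso_pushoutSection_of_isAffineOpen H _ _ _ U.2 (U.2.preimage _) (U.2.preimage f))
  rw [← Scheme.Hom.app_eq_appLE, ← Scheme.Hom.app_eq_appLE, ← Scheme.Hom.app_eq_appLE] at h1
  have h2 := ker_eq_map_of_isPushout h1 (J.subschemeι.app_surjective _ U.2)
  have h3 : RingHom.ker (J.subschemeι.app U.1).hom = J.ideal U := J.ker_subschemeι_app U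
  rw [h3] at h2
  rw [← h2]
  exact Scheme.Hom.ker_apply _ _

/-! ### Fibres over points of a torus -/

namespace MutationDatum
variable {P I : Type u} [AddCommGroup P] {D : MutationDatum P I} {k : Type u} [Field k]

lemma ideal_comap_divisorIdeal [TwoUniqueSums P] (n : D.Uniformizer)
    (hℓ : ∀ i ∉ D.F, ∃ ℓ : P →+ ℤ, ℓ (D.ψ i) = 1) {Y : Scheme.{u}} (f : Y ⟶ D.scheme k)
    [IsAffineHom f] (j : Option I) (i : I) :
    ((D.divisorIdeal k i).comap f).ideal
      ⟨pullChart f j, (D.isAffineOpen_chartOpen k j).preimage f⟩ =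
      Ideal.span {pullSection f j (divisorEqn k n j i)} := by
  refine (ideal_comap f (D.divisorIdeal k i) (D.affineChart k j)).trans ?_
  refine (congrArg _ (divisorIdeal_ideal k n hℓ j i)).trans ((Ideal.map_span _ _).trans ?_)
  exact congrArg Ideal.span (Set.image_singleton)

section fibre
variable (D) {Q : Type u} [AddCommGroup Q] (τ : Q →+ P) (hτ : ∀ i a, D.u i (τ a) = 0)
  (φ : AddMonoidAlgebra k Q →ₐ[k] k) (r : P →+ Q) (hr : ∀ a, r (τ a) = a)

/-- The values `φ (z ^ (r v))`. -/
def pointValue : Multiplicative P →* k where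
  toFun v := φ (.single (r v.toAdd) 1)
  map_one' := by
    rw [toAdd_one, map_zero, ← AddMonoidAlgebra.one_def, map_one]
  map_mul' v w := by
    rw [toAdd_mul, map_add, ← map_mul, AddMonoidAlgebra.single_mul_single, one_mul]

include hτ in
lemma sub_mem_mon (j : Option I) (v : P) (hv : v ∈ D.mon j) : v - (τ.comp r) v ∈ D.mon j := by
  rcases j with _ | i
  · trivial
  · intro h
    rw [map_sub, AddMonoidHom.comp_apply, hτ, sub_zero]
    exact hv h

/-- The specialization `z ^ v ↦ φ (z ^ (r v)) * z ^ (v - τ (r v))`, which identifies the coordinate ring of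
the fibre over `φ` with a subring of the coordinate ring of the chart. -/
def specialize (j : Option I) : D.ChartRing k j →ₐ[k] D.ChartRing k j :=
  twistHom k (D.mon j) (τ.comp r) (D.sub_mem_mon τ hτ r j) (pointValue φ r)

lemma specialize_single (j : Option I) (v : D.mon j) (a : k) :
    D.specialize τ hτ φ r j (.single v a) =
      .single ⟨v - τ (r v), D.sub_mem_mon τ hτ r j v v.2⟩ (a * φ (.single (r v) 1)) :=
  twistHom_single _ _ _ _ _ _ _

lemma toTorusChart_single (j : Option I) (a : Q) (b : k) : D.toTorusChart k τ hτ j (.single a b) =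
    .single ⟨τ a, D.mem_mon_of_eq_zero τ hτ j a⟩ b := by
  simp [toTorusChart]

include hr in
lemma specialize_toTorusChart (j : Option I) (x : AddMonoidAlgebra k Q) :
    D.specialize τ hτ φ r j (D.toTorusChart k τ hτ j x) = algebraMap k _ (φ x) := by
  have : (D.specialize τ hτ φ r j).comp (D.toTorusChart k τ hτ j) =
      (Algebra.ofId k _).comp φ := by
    refine algHom_ext_single k fun a => ?_
    rw [AlgHom.comp_apply, toTorusChart_single, specialize_single]
    exact congrArg₂ AddMonoidAlgebra.single (Subtype.ext (by simp [hr])) (by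
      rw [hr, one_mul]
      rfl)
  exact DFunLike.congr_fun this x

lemma toTorus_appLE_eq (j : Option I) (x : AddMonoidAlgebra k Q) :
    (D.toTorus k τ hτ).appLE ⊤ (D.chartOpen k j) le_top ((Scheme.ΓSpecIso
      (.of (AddMonoidAlgebra k Q))).inv x) = D.chartSection k j (D.toTorusChart k τ hτ j x) := by
  obtain ⟨y, hy⟩ := (D.chartSection_bijective k j).2 ((D.toTorus k τ hτ).appLE ⊤
    (D.chartOpen k j) le_top ((Scheme.ΓSpecIso (.of (AddMonoidAlgebra k Q))).inv x))
  rw [← hy]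
  congr 1
  have h1 : ⊤ ≤ D.chart k j ⁻¹ᵁ D.chartOpen k j := ((D.chart k j).preimage_image_eq ⊤).ge
  have h2 := congrArg ((D.chart k j).appLE (D.chartOpen k j) ⊤ h1) hy
  rw [D.chart_appLE_chartSection] at h2
  have h3 := congrArg (fun φ => φ.hom ((Scheme.ΓSpecIso (.of (AddMonoidAlgebra k Q))).inv x))
    (Scheme.Hom.appLE_comp_appLE (D.chart k j) (D.toTorus k τ hτ) ⊤ (D.chartOpen k j) ⊤ le_top h1)
  have h4 : D.chart k j ≫ D.toTorus k τ hτ =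
      Spec.map (CommRingCat.ofHom (D.toTorusChart k τ hτ j).toRingHom) := D.chart_desc k _ _ _ j
  have h5 := congrArg (fun g => g.hom x)
    (Scheme.ΓSpecIso_inv_naturality (CommRingCat.ofHom (D.toTorusChart k τ hτ j).toRingHom))
  apply (Scheme.ΓSpecIso (.of (D.ChartRing k j))).symm.commRingCatIsoToRingEquiv.injective
  refine h2.trans (h3.trans ?_)
  simp only [h4]
  refine Eq.trans ?_ h5.symm
  rw [CommRingCat.hom_comp, RingHom.comp_apply, Scheme.Hom.appTop, Scheme.Hom.app_eq_appLE]
  rfl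

/-- The inclusion of the fibre over `φ`. -/
abbrev fibreι : pullback (D.toTorus k τ hτ) (Spec.map (CommRingCat.ofHom φ.toRingHom)) ⟶
    D.scheme k := pullback.fst _ _

include hr in
lemma specialize_eq_zero (j : Option I) (x : D.ChartRing k j)
    (hx : pullSection (D.fibreι τ hτ φ) j x = 0) : D.specialize τ hτ φ r j x = 0 := by
  let ρ := (D.specialize τ hτ φ r j).toRingHom
  let g : Spec (.of (D.ChartRing k j)) ⟶
      pullback (D.toTorus k τ hτ) (Spec.map (CommRingCat.ofHom φ.toRingHom)) :=
    pullback.lift (Spec.map (CommRingCat.ofHom ρ) ≫ D.chart k j)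
      (Spec.map (CommRingCat.ofHom (algebraMap k (D.ChartRing k j)))) (by
        have h4 : D.chart k j ≫ D.toTorus k τ hτ =
          Spec.map (CommRingCat.ofHom (D.toTorusChart k τ hτ j).toRingHom) :=
            D.chart_desc k _ _ _ j
        rw [Category.assoc, h4, ← Spec.map_comp, ← Spec.map_comp]
        congr 1
        exact CommRingCat.hom_ext (RingHom.ext (D.specialize_toTorusChart τ hτ φ r hr j)))
  have hg : g ≫ D.fibreι τ hτ φ = Spec.map (CommRingCat.ofHom ρ) ≫ D.chart k j :=
    pullback.lift_fst _ _ _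
  have h1 : ⊤ ≤ (g ≫ D.fibreι τ hτ φ) ⁻¹ᵁ D.chartOpen k j := by
    rw [hg]
    intro y _
    exact D.chart_mem_chartOpen k j _
  have h2 := D.appLE_chartSection k j (R := .of (D.ChartRing k j)) ρ _ hg h1 x
  have h3 := congrArg (fun φ => φ.hom (D.chartSection k j x))
    (Scheme.Hom.appLE_comp_appLE g (D.fibreι τ hτ φ) (D.chartOpen k j)
      (pullChart (D.fibreι τ hτ φ) j) ⊤ le_rfl h1)
  have h4 : (D.fibreι τ hτ φ).appLE (D.chartOpen k j) (pullChart (D.fibreι τ hτ φ) j) le_rfl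
      (D.chartSection k j x) = 0 := by
    rw [← Scheme.Hom.app_eq_appLE]
    exact hx
  apply (Scheme.ΓSpecIso (.of (D.ChartRing k j))).symm.commRingCatIsoToRingEquiv.injective
  refine (h2.symm.trans (h3.symm.trans ?_)).trans (map_zero _).symm
  exact (congrArg (g.appLE (pullChart (D.fibreι τ hτ φ) j) ⊤ h1).hom h4).trans (map_zero _)

lemma pullSection_toTorusChart (j : Option I) (x : AddMonoidAlgebra k Q) (hx : φ x = 0) :
    pullSection (D.fibreι τ hτ φ) j (D.toTorusChart k τ hτ j x) = 0 := by
  change (D.fibreι τ hτ φ).app _ (D.chartSection k j _) = 0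
  rw [← D.toTorus_appLE_eq τ hτ j x, Scheme.Hom.app_eq_appLE]
  have h1 := Scheme.Hom.appLE_comp_appLE (D.fibreι τ hτ φ) (D.toTorus k τ hτ) ⊤ (D.chartOpen k j)
    (pullChart (D.fibreι τ hτ φ) j) le_top le_rfl
  have h2 := congrArg (fun g => g.hom ((Scheme.ΓSpecIso (.of (AddMonoidAlgebra k Q))).inv x)) h1
  refine h2.trans ?_
  simp only [pullback.condition]
  rw [← Scheme.Hom.appLE_comp_appLE _ _ ⊤ ⊤ _ le_top le_top]
  have h3 := congrArg (fun g => g.hom x)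
    (Scheme.ΓSpecIso_inv_naturality (CommRingCat.ofHom φ.toRingHom))
  have h4 : (Spec.map (CommRingCat.ofHom φ.toRingHom)).appLE ⊤ ⊤ le_top
      ((Scheme.ΓSpecIso (.of (AddMonoidAlgebra k Q))).inv x) = 0 := by
    have h5 : (Spec.map (CommRingCat.ofHom φ.toRingHom)).appLE ⊤ ⊤ le_top =
      (Spec.map (CommRingCat.ofHom φ.toRingHom)).appTop := (Scheme.Hom.app_eq_appLE _).symm
    rw [h5]
    refine h3.symm.trans ?_
    change (Scheme.ΓSpecIso (.of k)).inv (φ x) = 0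
    rw [hx, map_zero]
  exact (congrArg ((pullback.snd (D.toTorus k τ hτ)
    (Spec.map (CommRingCat.ofHom φ.toRingHom))).appLE ⊤ (pullChart (D.fibreι τ hτ φ) j)
    le_top).hom h4).trans (map_zero _)

lemma pullSection_specialize (j : Option I) (x : D.ChartRing k j) :
    pullSection (D.fibreι τ hτ φ) j (D.specialize τ hτ φ r j x) =
      pullSection (D.fibreι τ hτ φ) j x := by
  have : (pullSection (D.fibreι τ hτ φ) j).comp (D.specialize τ hτ φ r j).toRingHom =
      pullSection (D.fibreι τ hτ φ) j := by
    refine AddMonoidAlgebra.ringHom_ext (fun a => ?_) fun v => ?_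
    · have : D.specialize τ hτ φ r j (.single 0 a) = .single 0 a :=
        (D.specialize τ hτ φ r j).commutes a
      exact congrArg (pullSection (D.fibreι τ hτ φ) j) this
    · refine (congrArg (pullSection (D.fibreι τ hτ φ) j) (D.specialize_single τ hτ φ r j v 1)).trans ?_
      have h0 := D.pullSection_toTorusChart τ hτ φ j
        (.single (r v) 1 - .single 0 (φ (.single (r v) 1))) (by
          rw [map_sub, show (AddMonoidAlgebra.single 0 (φ (.single (r v) 1)) :
            AddMonoidAlgebra k Q) = algebraMap k _ (φ (.single (r v) 1)) from rfl, AlgHom.commutes]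
          exact sub_self _)
      rw [map_sub, map_sub, sub_eq_zero, toTorusChart_single, toTorusChart_single] at h0
      have h1 : (AddMonoidAlgebra.single v 1 : D.ChartRing k j) =
          .single ⟨v - τ (r v), D.sub_mem_mon τ hτ r j v v.2⟩ 1 *
          .single ⟨τ (r v), D.mem_mon_of_eq_zero τ hτ j _⟩ 1 := by
        rw [AddMonoidAlgebra.single_mul_single, one_mul]
        congr 1
        exact Subtype.ext (sub_add_cancel _ _).symm
      rw [h1, map_mul, h0, ← map_mul, AddMonoidAlgebra.single_mul_single]
      congr 2
      exact Subtype.ext (by simp)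
  exact DFunLike.congr_fun this x

instance : IsClosedImmersion (D.fibreι τ hτ φ) := by
  have : IsClosedImmersion (Spec.map (CommRingCat.ofHom φ.toRingHom)) :=
    IsClosedImmersion.spec_of_surjective _ fun a => ⟨algebraMap k _ a, φ.commutes a⟩
  infer_instance

include hr in
lemma pullSection_eq_zero_iff (j : Option I) (x : D.ChartRing k j) :
    pullSection (D.fibreι τ hτ φ) j x = 0 ↔ D.specialize τ hτ φ r j x = 0 :=
  ⟨D.specialize_eq_zero τ hτ φ r hr j x, fun h => by
    rw [← D.pullSection_specialize τ hτ φ r, h, map_zero]⟩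

include hr in
lemma isDomain_fibre [TwoUniqueSums P] (j : Option I) :
    IsDomain Γ(pullback (D.toTorus k τ hτ) (Spec.map (CommRingCat.ofHom φ.toRingHom)),
      pullChart (D.fibreι τ hτ φ) j) := by
  have hsurj : Function.Surjective (pullSection (D.fibreι τ hτ φ) j) :=
    ((D.fibreι τ hτ φ).app_surjective _ (D.isAffineOpen_chartOpen k j)).comp
      (D.chartSection_bijective k j).2
  have hker : RingHom.ker (pullSection (D.fibreι τ hτ φ) j) =
      RingHom.ker (D.specialize τ hτ φ r j).toRingHom :=
    Ideal.ext fun x => D.pullSection_eq_zero_iff τ hτ φ r hr j x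
  have hp : (RingHom.ker (pullSection (D.fibreι τ hτ φ) j)).IsPrime := by
    rw [hker]
    exact RingHom.ker_isPrime _
  have := Ideal.Quotient.isDomain (RingHom.ker (pullSection (D.fibreι τ hτ φ) j))
  exact (RingHom.quotientKerEquivOfSurjective hsurj).symm.toMulEquiv.isDomain

include hr in
/-- The boundary does not contain a chart of the fibre, unless it is given by an equation `1 + z ^ (ψ i)`
that vanishes at `φ`. -/
lemma pullSection_eqn_ne_zero (n : D.Uniformizer)
    (hφ : ∀ i ∉ D.F, ∀ a, τ a = D.ψ i → φ (.single a 1) ≠ -1) (j : Option I) :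
    pullSection (D.fibreι τ hτ φ) j (eqn k n j) ≠ 0 := by
  classical
  rw [Ne, D.pullSection_eq_zero_iff τ hτ φ r hr]
  have hu (a : Q) : φ (.single a 1) ≠ 0 := by
    intro h0
    have h1 : φ (.single a 1 * .single (-a) 1) = 1 := by
      rw [AddMonoidAlgebra.single_mul_single, add_neg_cancel, one_mul, ← AddMonoidAlgebra.one_def,
        map_one]
    rw [map_mul, h0, zero_mul] at h1
    exact zero_ne_one h1
  rcases j with _ | i
  · change D.specialize τ hτ φ r none 1 ≠ 0
    rw [map_one]
    exact one_ne_zero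
  · by_cases h : i ∈ D.F
    · rw [eqn_frozen k n h, specialize_single, one_mul, AddMonoidAlgebra.single_eq_zero]
      exact hu _
    · rw [eqn_unfrozen k n h, map_add, map_one, specialize_single, one_mul]
      intro h0
      by_cases he : τ (r (D.ψ i)) = D.ψ i
      · refine hφ i h _ he ?_
        have h1 : (⟨D.ψ i - τ (r (D.ψ i)), fun h' => absurd h' h⟩ : D.mon (some i)) = 0 :=
          Subtype.ext (by simp [he])
        have h2 := congrArg (fun x => x.coeff 0) h0
        simp [h1, AddMonoidAlgebra.one_def] at h2
        exact eq_neg_of_add_eq_zero_right h2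
      · have h1 : (⟨D.ψ i - τ (r (D.ψ i)), fun h' => absurd h' h⟩ : D.mon (some i)) ≠ 0 := by
          intro h'
          exact he (sub_eq_zero.1 (congrArg Subtype.val h')).symm
        have h2 := congrArg (fun x => x.coeff 0) h0
        simp [h1, AddMonoidAlgebra.one_def] at h2

end fibre

end MutationDatum

/-! ### Lattices -/

lemma twoUniqueSums_of_free (L : Type*) [AddCommGroup L] [Module.Free ℤ L] : TwoUniqueSums L :=
  TwoUniqueSums.of_injective_addHom
    (G := Module.Free.ChooseBasisIndex ℤ L →₀ ℤ)
    ((Module.Free.chooseBasis ℤ L).repr.toLinearMap.toAddMonoidHom : L →+ _).toAddHom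
    (Module.Free.chooseBasis ℤ L).repr.injective inferInstance

/-- A nonzero linear form that is primitive takes the value one. -/
lemma exists_apply_eq_one {N : Type*} [AddCommGroup N] (p : Module.Dual ℤ N) (h0 : p ≠ 0)
    (hp : ∀ (c : ℤ) (m : Module.Dual ℤ N), p = c • m → IsUnit c) : ∃ v, p v = 1 := by
  obtain ⟨d, hd⟩ := IsPrincipalIdealRing.principal (LinearMap.range p)
  have hdvd (v : N) : d ∣ p v := by
    have h : p v ∈ LinearMap.range p := LinearMap.mem_range_self p v
    rw [hd] at h
    exact Ideal.mem_span_singleton.1 h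
  obtain ⟨v₀, hv₀⟩ : d ∈ LinearMap.range p := by
    rw [hd]
    exact Submodule.mem_span_singleton_self d
  have hd0 : d ≠ 0 := by
    rintro rfl
    exact h0 (LinearMap.ext fun v => zero_dvd_iff.1 (hdvd v))
  let m : N →+ ℤ :=
    { toFun := fun v => p v / d
      map_zero' := by simp
      map_add' := fun v w => by rw [map_add, Int.add_ediv_of_dvd_left (hdvd v)] }
  have hu := hp d m.toIntLinearMap (LinearMap.ext fun v => (Int.mul_ediv_cancel' (hdvd v)).symm)
  refine ⟨d • v₀, ?_⟩
  rw [map_smul, hv₀, smul_eq_mul]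
  exact Int.isUnit_mul_self hu

/-- The kernel of a linear map to a free module of finite rank is a direct summand. -/
lemma exists_retraction_ker {N M : Type*} [AddCommGroup N] [AddCommGroup M] [Module.Free ℤ M]
    [Module.Finite ℤ M] (p : N →ₗ[ℤ] M) :
    ∃ r : N →ₗ[ℤ] LinearMap.ker p, ∀ a : LinearMap.ker p, r a = a := by
  obtain ⟨s, hs⟩ := Module.projective_lifting_property p.rangeRestrict LinearMap.id
    p.surjective_rangeRestrict
  have hps (v : N) : p (s (p.rangeRestrict v)) = p v :=
    congrArg Subtype.val (LinearMap.congr_fun hs (p.rangeRestrict v))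
  refine ⟨(LinearMap.id - s.comp p.rangeRestrict).codRestrict _ fun v => ?_, fun a => ?_⟩
  · refine Subtype.ext ?_
    have h : p.rangeRestrict a = 0 := Subtype.ext a.2
    change (a : N) - s (p.rangeRestrict a) = a
    rw [h, map_zero, sub_zero]
  · change p (v - s (p.rangeRestrict v)) = 0
    rw [map_sub, hps, sub_self]

namespace Seed
variable {N I : Type u} [AddCommGroup N] (S : Seed N I)

/-- The basis vectors of a seed are part of a basis of the lattice. -/
lemma exists_apply_e_eq_one [Module.Finite ℤ N] (i : I) : ∃ ℓ : N →+ ℤ, ℓ (S.e i) = 1 := by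
  have htf : Module.IsTorsionFree ℤ (N ⧸ S.NI) := by
    refine Module.isTorsionFree_iff_smul_eq_zero.2 fun c x hx => or_iff_not_imp_left.2 fun hc => ?_
    obtain ⟨n, rfl⟩ := S.NI.mkQ_surjective x
    rw [← map_smul] at hx
    exact (Submodule.Quotient.mk_eq_zero _).2
      (S.saturated c n hc ((Submodule.Quotient.mk_eq_zero _).1 hx))
  have : Module.Free ℤ (N ⧸ S.NI) := inferInstance
  obtain ⟨s, hs⟩ := Module.projective_lifting_property S.NI.mkQ LinearMap.id
    S.NI.mkQ_surjective
  let π : N →ₗ[ℤ] S.NI := (LinearMap.id - s.comp S.NI.mkQ).codRestrict _ fun v => by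
    refine (Submodule.Quotient.mk_eq_zero _).1 ?_
    change S.NI.mkQ (v - s (S.NI.mkQ v)) = 0
    rw [map_sub, sub_eq_zero]
    exact (LinearMap.congr_fun hs (S.NI.mkQ v)).symm
  refine ⟨((Module.Basis.span S.linearIndependent).coord i ∘ₗ π).toAddMonoidHom, ?_⟩
  have h : π (S.e i) = Module.Basis.span S.linearIndependent i := by
    refine Subtype.ext ?_
    have h0 : S.NI.mkQ (S.e i) = 0 := (Submodule.Quotient.mk_eq_zero _).2 (S.eI i).2
    change S.e i - s (S.NI.mkQ (S.e i)) = _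
    rw [h0, map_zero, sub_zero, Module.Basis.span_apply]
  change (Module.Basis.span S.linearIndependent).coord i (π (S.e i)) = 1
  rw [h]
  simp

lemma isPullback_fibre {k : Type u} [Field k] (φ : S.KPoint k) :
    IsPullback (S.AFibι φ) (S.p₂FibMap φ) (S.p₂Map k) (S.XFibι φ) := by
  have h1 : IsPullback (pullback.snd _ _) (S.XFibι φ) (KPoint.map S φ) (S.lamMap k) :=
    (IsPullback.of_hasPullback _ _).flip
  have h2 : IsPullback (pullback.snd (S.piMap k ≫ S.iMap k) (KPoint.map S φ)) (S.AFibι φ)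
      (KPoint.map S φ) (S.p₂Map k ≫ S.lamMap k) := by
    rw [S.p₂Map_lamMap]
    exact (IsPullback.of_hasPullback _ _).flip
  have h3 : S.p₂FibMap φ ≫ pullback.snd _ _ =
      pullback.snd (S.piMap k ≫ S.iMap k) (KPoint.map S φ) := pullback.lift_snd _ _ _
  rw [← h3] at h2
  refine (IsPullback.of_right h2 ?_ h1).flip
  exact pullback.lift_fst _ _ _

variable [Module.Free ℤ N] [Module.Finite ℤ N] [Fintype I]

/-- The lattice `N_prin^* = M_I ⊕ N` as an extension of `M_I` by `N`. -/
def splitting : S.p₂tildeHom.Splitting S.MI where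
  ζ := S.zeta
  deg := S.deg
  deg_θ n := by
    ext w
    simp [deg, p₂tildeHom, p₂tilde]
  deg_ζ m := by
    ext w
    simp [deg, zeta]
  θ_injective := by
    intro n n' h
    rw [← sub_eq_zero, ← Module.forall_dual_apply_eq_zero_iff ℤ]
    intro m
    have := LinearMap.congr_fun h (0, m)
    simpa [p₂tildeHom, p₂tilde, sub_eq_zero] using this
  exists_θ v hv := by
    obtain ⟨n, hn⟩ := (Module.evalEquiv ℤ N).surjective
      (v.comp (LinearMap.inr ℤ S.NI (Module.Dual ℤ N)))
    refine ⟨n, ?_⟩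
    have h1 (m : Module.Dual ℤ N) : m n = v (0, m) := LinearMap.congr_fun hn m
    have h2 (w : S.NI) : v (w, 0) = v (0, S.p₂ w) :=
      sub_eq_zero.1 (LinearMap.congr_fun hv w)
    refine LinearMap.ext fun x => ?_
    have h3 : v x = v (x.1, 0) + v (0, x.2) := by
      rw [← map_add]
      simp
    rw [h3, h2, ← h1, ← h1]
    rfl

end Seed

end ClusterTorsor

end

theorem theorem3p4 {k N I : Type u} [Field k] [AddCommGroup N] [Module.Free ℤ N]
    [Module.Finite ℤ N] [Fintype I] (S : Seed N I)
    (hne : ∀ i, S.p₂ (S.e i) ≠ 0)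
    (hprim : ∀ i ∈ S.F, ∀ (c : ℤ) (m : Module.Dual ℤ N), S.p₂ (S.e i) = c • m → IsUnit c) :
    (∃ _ : AlgebraicGeometry.IsIntegral (S.X k),
      IsAffineHom (S.p₂Map k) ∧
      Nonempty (GradedAlgIso (fun i => S.dataX.divisorIdeal k i) S.W S.deg S.zeta
        (𝟙 (S.APrin k)) (S.p₂Map k) (S.dataX.chartOpen k none))) ∧
    ∀ φ : S.KPoint k,
      (∀ (i : I) (h : S.e i ∈ S.K₁), i ∉ S.F → φ (.single ⟨S.e i, h⟩ 1) ≠ -1) →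
      ∃ _ : AlgebraicGeometry.IsIntegral (S.XFib φ),
        IsAffineHom (S.p₂FibMap φ) ∧
        Nonempty (GradedAlgIso (fun i => (S.dataX.divisorIdeal k i).comap (S.XFibι φ))
          S.W S.deg S.zeta (S.AFibι φ) (S.p₂FibMap φ)
          (S.XFibι φ ⁻¹ᵁ S.dataX.chartOpen k none)) := by
  classical
  have := twoUniqueSums_of_free N
  have := twoUniqueSums_of_free S.MI
  have hℓ : ∀ i ∉ S.dataX.F, ∃ ℓ : N →+ ℤ, ℓ (S.dataX.ψ i) = 1 :=
    fun i _ => S.exists_apply_e_eq_one i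
  choose v hv using fun i (hi : i ∈ S.F) => exists_apply_eq_one _ (hne i) (hprim i hi)
  let n : S.dataX.Uniformizer :=
    { v := fun i => if hi : i ∈ S.F then v i hi else 0
      u_v := fun i hi => by
        rw [dif_pos (show i ∈ S.F from hi)]
        exact hv i hi }
  have hw (m : S.MI) (i : I) : S.prin.dataA.u i (S.splitting.ζ m) = S.W m i := rfl
  refine ⟨?_, fun φ hφ => ?_⟩
  · have H : IsPullback (𝟙 (S.APrin k)) (S.p₂Map k) (S.p₂Map k) (𝟙 (S.X k)) :=
      IsPullback.of_horiz_isIso ⟨by simp⟩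
    have hbij (j : Option I) : Function.Bijective (MutationDatum.pullSection (𝟙 (S.X k)) j) :=
      ((ConcreteCategory.isIso_iff_bijective ((𝟙 (S.X k) : S.X k ⟶ S.X k).app
        (S.dataX.chartOpen k j))).1 inferInstance).comp (S.dataX.chartSection_bijective k j)
    have h := MutationDatum.exists_isIntegral_gradedAlgIso S.splitting n H (w := S.W)
      (fun j => (RingEquiv.ofBijective _ (hbij j)).symm.toMulEquiv.isDomain)
      (fun j => (map_ne_zero_iff _ (hbij j).1).2 (MutationDatum.eqn_ne_zero k n (fun i hi h0 => by
        obtain ⟨ℓ, hℓ⟩ := hℓ i hi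
        rw [h0, map_zero] at hℓ
        exact zero_ne_one hℓ) j)) hw
      (MutationDatum.ideal_comap_divisorIdeal n hℓ (𝟙 (S.X k)))
    simp only [Scheme.IdealSheafData.comap_id] at h
    exact h
  · obtain ⟨r, hr⟩ := exists_retraction_ker S.p₁
    have hτ (i : I) (a : S.K₁) : S.dataX.u i (S.K₁.subtype.toAddMonoidHom a) = 0 :=
      LinearMap.congr_fun (LinearMap.mem_ker.1 a.2) (S.e i)
    have hcl : IsClosedImmersion (S.XFibι φ) := inferInstanceAs
      (IsClosedImmersion (S.dataX.fibreι S.K₁.subtype.toAddMonoidHom hτ φ))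
    exact MutationDatum.exists_isIntegral_gradedAlgIso S.splitting n (S.isPullback_fibre φ)
      (fun j => S.dataX.isDomain_fibre S.K₁.subtype.toAddMonoidHom hτ φ r.toAddMonoidHom hr j)
      (fun j => S.dataX.pullSection_eqn_ne_zero S.K₁.subtype.toAddMonoidHom hτ φ
        r.toAddMonoidHom hr n (fun i hi a ha => by
          have hi' : S.e i ∈ S.K₁ := by
            rw [show S.e i = (a : N) from ha.symm]
            exact a.2
          have : a = ⟨S.e i, hi'⟩ := Subtype.ext ha
          rw [this]
          exact hφ i hi' hi) j) hw
      (MutationDatum.ideal_comap_divisorIdeal n hℓ (S.XFibι φ))
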